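/- Let $n\ge 1$ and $\ell\in\{1,\dots,n\}$, and let $K_0,K_1,K_2,\dots$ be real numbers. Then there is a constant $C$, depending only on $n$, $\ell$ and $(K_j)$, such that the following holds. Let $\Omega\subset\mathbb R^n$ be a bounded open set that is star shaped with respect to an open ball $B\subset\Omega$, i.e. for every $y\in\Omega$ the convex hull of $B\cup\{y\}$ is contained in $\Omega$. Set $R=\operatorname{diam}\Omega$ and $\rho=\operatorname{diam}B$. Let $\theta\in C_0^\infty(\mathbb R^n)$ be supported in $\overline B$, with $\int\theta\,dx=1$ and, for every multi-index $\alpha$, \[ \|\partial^\alpha\theta\|_{L^1}\le \frac{K_{|\alpha|}}{\rho^{|\alpha|}},\qquad \|\partial^\alpha\theta\|_{L^\infty}\le \frac{K_{|\alpha|}}{\rho^{n+|\alpha|}} . \] For an integer $m$ let $G_m(x,y)=\int_1^\infty (t-1)^{n-m}t^{m-1}\theta(y+t(x-y))\,dt$, and for an $\ell$-form $u=\sum_I u_I\,dx_I$ on $\Omega$ (sum over $I=(i_1<\dots<i_\ell)$) with all $u_I\in L^2(\Omega)$ let \[ \mathtt P_\ell u(x)=\int_\Omega G_{n-\ell+1}(y,x)\,(x-y)\lrcorner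 u(y)\,dy , \] where $z\lrcorner u(y)=u(y)(z,\cdot,\dots,\cdot)$ is the interior product. Then this integral converges absolutely for almost every $x\in\Omega$, all coefficients of the $(\ell-1)$-form $\mathtt P_\ell u$ belong to $H^1(\Omega)$, and \[ |\mathtt P_\ell u|_{H^1(\Omega,\Lambda^{\ell-1})}\le C\,\frac R\rho\,\kappa\,\|u\|_{L^2(\Omega,\Lambda^\ell)} . \] Here $\|u\|_{L^2(\Omega,\Lambda^\ell)}^2=\sum_I\|u_I\|_{L^2(\Omega)}^2$, $|w|_{H^1(\Omega,\Lambda^{\ell-1})}^2=\sum_I\sum_{j=1}^n\|\partial_j w_I\|_{L^2(\Omega)}^2$ with weak derivatives $\partial_j$, and \[ \kappa=\begin{cases} 1, & 2\ell>n,\\[4pt] 1+\left(\dfrac{|\Omega|}{|B|}\right)^{\frac{n-2\ell}{2(n-\ell)}}\left(\log\dfrac{|\Omega|}{|B|}\right)^{\frac{n}{2(n-\ell)}}, & 2\ell\in\{n-1,n\},\\[8pt] 1+\left(\dfrac{|\Omega|}{|B|}\right)^{\frac{n-2\ell}{2(n-\ell)}}\left(\log\dfrac{|\Omega|}{|B|}\right)^{\frac{n}{2(n-\ell-1)}},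 & 2\ell\le n-2. \end{cases} \] -/

import Mathlib

namespace PoincareEstimate

open MeasureTheory
open scoped ContDiff

/-- Euclidean space `ℝⁿ`. -/
abbrev E (n : ℕ) : Type := EuclideanSpace ℝ (Fin n)

/-- Exterior `ℓ`-forms on `ℝⁿ`: alternating `ℓ`-linear functions on `ℝⁿ`
(continuity is automatic in finite dimension). -/
abbrev Form (n ℓ : ℕ) : Type := E n [⋀^Fin ℓ]→L[ℝ] ℝ

noncomputable section

/-- The canonical basis vector `e_i` of `ℝⁿ`. -/
def e {n : ℕ} (i : Fin n) : E n := EuclideanSpace.single i 1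

/-- The coefficient `η_I = η(e_{i₁}, …, e_{i_ℓ})` of `dx_I` in `η = ∑_I η_I dx_I`, where
`I = (i₁ < ⋯ < i_ℓ)` is a strictly increasing multi-index. -/
def coeff {n ℓ : ℕ} (I : Fin ℓ ↪o Fin n) (η : Form n ℓ) : ℝ := η (fun m => e (I m))

/-- The interior product `z ⌟ η = η(z, ·, …, ·)` of a vector with a `(k+1)`-form. On basis forms it
is `z ⌟ dx_I = ∑_m (-1)^(m-1) z_{i_m} dx_{Î_m}`, with `Î_m` the multi-index `I` without `i_m`. -/
def contract {n k : ℕ} (z : E n) (η : Form n (k + 1)) : Form n k := η.curryLeft z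

/-- `D` is star shaped with respect to `B`: `B ⊆ D`, and for every `y ∈ D` the convex hull of
`B ∪ {y}` is contained in `D`. -/
def StarShapedWrt {n : ℕ} (D B : Set (E n)) : Prop :=
  B ⊆ D ∧ ∀ y ∈ D, convexHull ℝ (B ∪ {y}) ⊆ D

/-- The partial derivative `∂_{i₁} ⋯ ∂_{i_k} θ` at `x`. -/
def partialDeriv {n k : ℕ} (i : Fin k → Fin n) (θ : E n → ℝ) (x : E n) : ℝ :=
  iteratedFDeriv ℝ k θ x (fun m => e (i m))

/-- `θ` is a smooth function supported in the (closed) ball with centre `c` and radius `r`, with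
integral one, all of whose partial derivatives of order `k` are bounded by `K k / ρ ^ k` in `L¹`
and by `K k / ρ ^ (n + k)` in `L^∞`, where `ρ` is the diameter of the ball. -/
structure IsRegularizer {n : ℕ} (K : ℕ → ℝ) (c : E n) (r : ℝ) (θ : E n → ℝ) : Prop where
  contDiff : ContDiff ℝ ∞ θ
  tsupport_subset : tsupport θ ⊆ Metric.closedBall c r
  integral_eq_one : ∫ x, θ x = 1
  l1_bound : ∀ (k : ℕ) (i : Fin k → Fin n),
    ∫ x, |partialDeriv i θ x| ≤ K k / Metric.diam (Metric.ball c r) ^ k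
  sup_bound : ∀ (k : ℕ) (i : Fin k → Fin n) (x : E n),
    |partialDeriv i θ x| ≤ K k / Metric.diam (Metric.ball c r) ^ (n + k)

/-- The kernel `G_m(x, y) = ∫_1^∞ (t-1)^(n-m) t^(m-1) θ(y + t (x - y)) dt`
(the exponents are integers). -/
def G {n : ℕ} (θ : E n → ℝ) (m : ℤ) (x y : E n) : ℝ :=
  ∫ t in Set.Ioi (1 : ℝ), (t - 1) ^ ((n : ℤ) - m) * t ^ (m - 1) * θ (y + t • (x - y))

/-- The integrand `G_{n-ℓ+1}(y, x) (x - y) ⌟ u(y)` of the Poincaré-type operator on `ℓ`-forms,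
with `ℓ = k + 1`. -/
def poincareIntegrand {n k : ℕ} (θ : E n → ℝ) (u : E n → Form n (k + 1)) (x y : E n) : Form n k :=
  G θ ((n : ℤ) - ((k + 1 : ℕ) : ℤ) + 1) y x • contract (x - y) (u y)

/-- The regularized Poincaré-type operator `P_ℓ u(x) = ∫_Ω G_{n-ℓ+1}(y, x) (x - y) ⌟ u(y) dy`
applied to an `ℓ`-form `u` on `Ω`, with `ℓ = k + 1`. -/
def poincareOp {n k : ℕ} (Ω : Set (E n)) (θ : E n → ℝ) (u : E n → Form n (k + 1)) (x : E n) :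
    Form n k :=
  ∫ y in Ω, poincareIntegrand θ u x y

/-- `g` is the weak partial derivative `∂_j f` on the open set `Ω`. -/
def HasWeakPartial {n : ℕ} (Ω : Set (E n)) (j : Fin n) (f g : E n → ℝ) : Prop :=
  LocallyIntegrableOn f Ω ∧ LocallyIntegrableOn g Ω ∧
    ∀ φ : E n → ℝ, ContDiff ℝ ∞ φ → HasCompactSupport φ → tsupport φ ⊆ Ω →
      ∫ x in Ω, f x * fderiv ℝ φ x (e j) = -∫ x in Ω, g x * φ x

/-- `f ∈ H¹(Ω)`: `f` and its first-order weak derivatives are in `L²(Ω)`. -/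
def MemH1 {n : ℕ} (Ω : Set (E n)) (f : E n → ℝ) : Prop :=
  MemLp f 2 (volume.restrict Ω) ∧
    ∀ j : Fin n, ∃ g : E n → ℝ, HasWeakPartial Ω j f g ∧ MemLp g 2 (volume.restrict Ω)

open Classical in
/-- A representative of the weak partial derivative `∂_j f` on `Ω` (unique up to null sets);
zero if there is none. -/
def weakPartial {n : ℕ} (Ω : Set (E n)) (j : Fin n) (f : E n → ℝ) : E n → ℝ :=
  if h : ∃ g : E n → ℝ, HasWeakPartial Ω j f g then h.choose else 0

/-- `u ∈ L²(Ω, Λ^ℓ)`: all coefficients of `u` are in `L²(Ω)`. -/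
def MemL2Form {n ℓ : ℕ} (Ω : Set (E n)) (u : E n → Form n ℓ) : Prop :=
  ∀ I : Fin ℓ ↪o Fin n, MemLp (fun x => coeff I (u x)) 2 (volume.restrict Ω)

/-- `‖u‖_{L²(Ω, Λ^ℓ)} = (∑_I ‖u_I‖²_{L²(Ω)})^(1/2)`. -/
def l2NormForm {n ℓ : ℕ} (Ω : Set (E n)) (u : E n → Form n ℓ) : ℝ :=
  √(∑ I : Fin ℓ ↪o Fin n, ∫ x in Ω, coeff I (u x) ^ 2)

/-- `w ∈ H¹(Ω, Λ^ℓ)`: all coefficients of `w` are in `H¹(Ω)`. -/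
def MemH1Form {n ℓ : ℕ} (Ω : Set (E n)) (w : E n → Form n ℓ) : Prop :=
  ∀ I : Fin ℓ ↪o Fin n, MemH1 Ω (fun x => coeff I (w x))

/-- `|w|_{H¹(Ω, Λ^ℓ)} = (∑_I ∑_j ‖∂_j w_I‖²_{L²(Ω)})^(1/2)`. -/
def h1SeminormForm {n ℓ : ℕ} (Ω : Set (E n)) (w : E n → Form n ℓ) : ℝ :=
  √(∑ I : Fin ℓ ↪o Fin n, ∑ j : Fin n,
      ∫ x in Ω, weakPartial Ω j (fun y => coeff I (w y)) x ^ 2)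

/-- The factor `κ`, as a function of `n`, `ℓ` and the ratio `q = |Ω| / |B|`. -/
def kappa (n ℓ : ℕ) (q : ℝ) : ℝ :=
  if n < 2 * ℓ then 1
  else if n ≤ 2 * ℓ + 1 then
    1 + q ^ (((n : ℝ) - 2 * ℓ) / (2 * ((n : ℝ) - ℓ))) *
      Real.log q ^ ((n : ℝ) / (2 * ((n : ℝ) - ℓ)))
  else
    1 + q ^ (((n : ℝ) - 2 * ℓ) / (2 * ((n : ℝ) - ℓ))) *
      Real.log q ^ ((n : ℝ) / (2 * ((n : ℝ) - ℓ - 1)))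

end

end PoincareEstimate

/-!
Let `w` be a coefficient of the Poincaré operator applied to `u`. Writing the kernel as an integral
over scales `t > 1`, the pairing of `w` with `∂_j φ` becomes an integral over `t` of bilinear forms
`∫∫ φ(x) v(y) f(t y - (t - 1) x) dx dy`, where `v` is a component of `u` and `f` a bump living at
the scale `ρ` of the ball. At a fixed scale one integrates by parts, so that the derivative falls on
`f`; since `t (x - y) = (x - c) - (a - c)` for `a = t y - (t - 1) x`, the factor `x - y` only
multiplies `f` by lengths at most `diam Ω` and `ρ`.

For large scales `t > 2`, Plancherel's identity turns the bilinear form into an integral of `f̂`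
over dilated frequencies. As `f` is a derivative, `f̂` is bounded by `τ / (1 + τ²)` with `τ = ρ‖ζ‖`,
and the integral over `t` is that of a Cauchy kernel, hence bounded uniformly. For small scales
`σ = t - 1 ≤ 1`, Schur's test bounds the bilinear form by `min (σ ^ (-n/2)) √(|Ω| / |B|)`, and the
weighted integral of this minimum over `σ` is what produces the factor `κ`.

The pairing is thus bounded in the `L²` norms of `φ` and `v`, and the Riesz representation theorem
supplies the weak derivatives of `w`.
-/

namespace PoincareEstimate

open MeasureTheory FourierTransform Module
open scoped ContDiff ENNReal

noncomputable section

section Integration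

variable {α β : Type*} [MeasurableSpace α] [MeasurableSpace β] {μ : Measure α} {ν : Measure β}

theorem eLpNorm_two_eq_lintegral {F : Type*} [ENorm F] (f : α → F) :
    eLpNorm f 2 μ = (∫⁻ x, ‖f x‖ₑ ^ 2 ∂μ) ^ (1 / 2 : ℝ) := by
  simp [eLpNorm_eq_lintegral_rpow_enorm_toReal]

theorem lintegral_mul_mul_le_sqrt_mul_sqrt {w X Y : α → ℝ≥0∞} (hw : Measurable w)
    (hX : Measurable X) (hY : Measurable Y) :
    ∫⁻ a, w a * (X a * Y a) ∂μ ≤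
      (∫⁻ a, w a * X a ^ 2 ∂μ) ^ (1 / 2 : ℝ) * (∫⁻ a, w a * Y a ^ 2 ∂μ) ^ (1 / 2 : ℝ) := by
  have h := ENNReal.lintegral_mul_le_Lp_mul_Lq (μ.withDensity w) Real.HolderConjugate.two_two
    hX.aemeasurable hY.aemeasurable
  rw [lintegral_withDensity_eq_lintegral_mul _ hw (hX.mul hY),
    lintegral_withDensity_eq_lintegral_mul _ hw (hX.pow_const _),
    lintegral_withDensity_eq_lintegral_mul _ hw (hY.pow_const _)] at h
  simpa using h

theorem rpow_half_mul_rpow_half (a : ℝ≥0∞) : a ^ (1 / 2 : ℝ) * a ^ (1 / 2 : ℝ) = a := by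
  rw [← ENNReal.rpow_add_of_nonneg _ _ (by norm_num) (by norm_num)]
  norm_num

theorem rpow_half_sq (a : ℝ≥0∞) : (a ^ (1 / 2 : ℝ)) ^ 2 = a := by
  rw [sq, rpow_half_mul_rpow_half]

theorem ofReal_rpow_half {a : ℝ} (ha : 0 ≤ a) :
    (ENNReal.ofReal a) ^ (1 / 2 : ℝ) = ENNReal.ofReal √a := by
  rw [ENNReal.ofReal_rpow_of_nonneg ha (by norm_num), Real.sqrt_eq_rpow]

theorem lintegral_sq_lintegral_mul_le_of_schur [SFinite μ] [SFinite ν] {K : α → β → ℝ≥0∞}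
    (hK : Measurable K.uncurry) {Y : β → ℝ≥0∞} (hY : Measurable Y) {A B : ℝ≥0∞}
    (hA : ∀ᵐ x ∂μ, ∫⁻ y, K x y ∂ν ≤ A) (hB : ∀ᵐ y ∂ν, ∫⁻ x, K x y ∂μ ≤ B) :
    ∫⁻ x, (∫⁻ y, K x y * Y y ∂ν) ^ 2 ∂μ ≤ A * B * ∫⁻ y, Y y ^ 2 ∂ν := by
  have row : ∀ᵐ x ∂μ, (∫⁻ y, K x y * Y y ∂ν) ^ 2 ≤ A * ∫⁻ y, K x y * Y y ^ 2 ∂ν := by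
    filter_upwards [hA] with x hx
    have h := lintegral_mul_mul_le_sqrt_mul_sqrt (μ := ν) (w := K x) hK.of_uncurry_left
      (measurable_const (a := 1)) hY
    simp only [one_mul, one_pow, mul_one] at h
    calc (∫⁻ y, K x y * Y y ∂ν) ^ 2
        ≤ ((∫⁻ y, K x y ∂ν) ^ (1 / 2 : ℝ) * (∫⁻ y, K x y * Y y ^ 2 ∂ν) ^ (1 / 2 : ℝ)) ^ 2 := by
          gcongr
      _ = (∫⁻ y, K x y ∂ν) * ∫⁻ y, K x y * Y y ^ 2 ∂ν := by
          rw [mul_pow, rpow_half_sq, rpow_half_sq]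
      _ ≤ A * ∫⁻ y, K x y * Y y ^ 2 ∂ν := by gcongr
  calc ∫⁻ x, (∫⁻ y, K x y * Y y ∂ν) ^ 2 ∂μ
      ≤ ∫⁻ x, A * ∫⁻ y, K x y * Y y ^ 2 ∂ν ∂μ := lintegral_mono_ae row
    _ = A * ∫⁻ y, ∫⁻ x, K x y * Y y ^ 2 ∂μ ∂ν := by
        have hKY : Measurable fun p : α × β => K p.1 p.2 * Y p.2 ^ 2 :=
          hK.mul ((hY.comp measurable_snd).pow_const 2)
        rw [lintegral_const_mul _ (Measurable.lintegral_prod_right' hKY),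
          lintegral_lintegral_swap hKY.aemeasurable]
    _ ≤ A * ∫⁻ y, B * Y y ^ 2 ∂ν := by
        gcongr 1
        refine lintegral_mono_ae ?_
        filter_upwards [hB] with y hy
        rw [lintegral_mul_const _ hK.of_uncurry_right]
        gcongr
    _ = A * B * ∫⁻ y, Y y ^ 2 ∂ν := by rw [lintegral_const_mul _ (hY.pow_const 2), mul_assoc]

theorem lintegral_prod_mul_le_of_schur [SFinite μ] [SFinite ν] {K : α → β → ℝ≥0∞}
    (hK : Measurable K.uncurry) {X : α → ℝ≥0∞} (hX : Measurable X) {Y : β → ℝ≥0∞}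
    (hY : Measurable Y) {A B : ℝ≥0∞}
    (hA : ∀ᵐ x ∂μ, ∫⁻ y, K x y ∂ν ≤ A) (hB : ∀ᵐ y ∂ν, ∫⁻ x, K x y ∂μ ≤ B) :
    ∫⁻ p, K p.1 p.2 * (X p.1 * Y p.2) ∂μ.prod ν ≤ (A * B) ^ (1 / 2 : ℝ) *
      ((∫⁻ x, X x ^ 2 ∂μ) ^ (1 / 2 : ℝ) * (∫⁻ y, Y y ^ 2 ∂ν) ^ (1 / 2 : ℝ)) := by
  have hKY : Measurable fun p : α × β => K p.1 p.2 * Y p.2 := hK.mul (hY.comp measurable_snd)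
  have h := lintegral_mul_mul_le_sqrt_mul_sqrt (μ := μ) (measurable_const (a := 1)) hX
    (Measurable.lintegral_prod_right' (ν := ν) hKY)
  simp only [one_mul] at h
  calc ∫⁻ p, K p.1 p.2 * (X p.1 * Y p.2) ∂μ.prod ν
      = ∫⁻ x, X x * ∫⁻ y, K x y * Y y ∂ν ∂μ := by
        have hKXY : Measurable fun p : α × β => K p.1 p.2 * (X p.1 * Y p.2) := hK.mul (by fun_prop)
        rw [lintegral_prod _ hKXY.aemeasurable]
        refine lintegral_congr fun x => ?_
        rw [← lintegral_const_mul (X x) (f := fun y => K x y * Y y)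
          (hK.of_uncurry_left.mul hY)]
        exact lintegral_congr fun y => by ring
    _ ≤ _ := h
    _ ≤ (∫⁻ x, X x ^ 2 ∂μ) ^ (1 / 2 : ℝ) * (A * B * ∫⁻ y, Y y ^ 2 ∂ν) ^ (1 / 2 : ℝ) := by
        gcongr
        exact lintegral_sq_lintegral_mul_le_of_schur hK hY hA hB
    _ = _ := by
        rw [ENNReal.mul_rpow_of_nonneg _ _ (by norm_num)]
        ring

theorem setLIntegral_preimage_sub_right (g : ℝ → ℝ≥0∞) (s : Set ℝ) (b : ℝ) :
    ∫⁻ t in (fun t => t - b) ⁻¹' s, g (t - b) = ∫⁻ t in s, g t :=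
  (measurePreserving_sub_right (volume : Measure ℝ) b).setLIntegral_comp_preimage_emb
    (MeasurableEquiv.subRight b).measurableEmbedding g s

end Integration

section EuclideanSpace

variable {V : Type*} [NormedAddCommGroup V] [InnerProductSpace ℝ V] [FiniteDimensional ℝ V]
  [MeasurableSpace V] [BorelSpace V]

theorem lintegral_comp_smul {f : V → ℝ≥0∞} (hf : Measurable f) {t : ℝ} (ht : 0 < t) :
    ∫⁻ x, f (t • x) = ENNReal.ofReal (t ^ finrank ℝ V)⁻¹ * ∫⁻ x, f x := by
  rw [← lintegral_map hf (measurable_const_smul t), Measure.map_addHaar_smul _ ht.ne',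
    lintegral_smul_measure, abs_of_pos (by positivity), smul_eq_mul]

section Fourier

variable {F : Type*} [NormedAddCommGroup F] [NormedSpace ℂ F]

theorem continuous_fourier_of_integrable {v : V → F} (hv : Integrable v) : Continuous (𝓕 v) :=
  VectorFourier.fourierIntegral_continuous Real.continuous_fourierChar
    (innerSL ℝ).continuous₂ hv

theorem norm_fourier_le_integral_norm (v : V → F) (ζ : V) : ‖𝓕 v ζ‖ ≤ ∫ x, ‖v x‖ :=
  VectorFourier.norm_fourierIntegral_le_integral_norm _ _ _ _ _

/-- Plancherel's identity on `L¹ ∩ L²`: there the integral defining the Fourier transform and its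
extension to `L²` agree, since they agree when tested against smooth functions. -/
theorem eLpNorm_fourier_eq {v : V → ℂ} (hv : Integrable v) (hv2 : MemLp v 2) :
    eLpNorm (𝓕 v) 2 volume = eLpNorm v 2 volume := by
  set W : Lp ℂ 2 (volume : Measure V) := hv2.toLp v
  have fourier_ae_eq : 𝓕 v =ᵐ[volume] (𝓕 W : Lp ℂ 2 (volume : Measure V)) := by
    refine ae_eq_of_integral_contDiff_smul_eq
      (continuous_fourier_of_integrable hv).locallyIntegrable
      ((Lp.memLp _).locallyIntegrable (by norm_num)) fun g hg hgc => ?_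
    have hgc' : HasCompactSupport (fun x => (g x : ℂ)) := hgc.comp_left Complex.ofReal_zero
    have hg' : ContDiff ℝ ∞ (fun x => (g x : ℂ)) := Complex.ofRealCLM.contDiff.comp hg
    set S : SchwartzMap V ℂ := hgc'.toSchwartzMap hg'
    calc ∫ x, g x • 𝓕 v x = ∫ ξ, 𝓕 v ξ • S ξ :=
          integral_congr_ae (.of_forall fun x => by simp [S, mul_comm])
      _ = ∫ x, v x • 𝓕 (S : V → ℂ) x := by
          have h := VectorFourier.integral_fourierIntegral_smul_eq_flip (μ := volume)
            (ν := volume) (L := innerₗ V) Real.continuous_fourierChar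
            (innerSL ℝ).continuous₂ hv S.integrable
          rwa [flip_innerₗ] at h
      _ = ∫ x, (𝓕 S) x • (W : V → ℂ) x := by
          refine integral_congr_ae ?_
          filter_upwards [hv2.coeFn_toLp] with x hx
          rw [show (W : V → ℂ) x = v x from hx, SchwartzMap.fourier_coe, smul_eq_mul,
            smul_eq_mul, mul_comm]
      _ = ∫ x, S x • ((𝓕 W : Lp ℂ 2 (volume : Measure V)) : V → ℂ) x := by
          have h := congrArg (fun T : TemperedDistribution V ℂ => T S)
            (Lp.fourier_toTemperedDistribution_eq W)
          simpa only [TemperedDistribution.fourier_apply,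
            Lp.toTemperedDistribution_apply] using h
      _ = _ := integral_congr_ae (.of_forall fun x => by simp [S])
  rw [eLpNorm_congr_ae fourier_ae_eq, ← eLpNorm_congr_ae hv2.coeFn_toLp, ← Lp.enorm_def,
    ← Lp.enorm_def, ← ofReal_norm, ← ofReal_norm, Lp.norm_fourier_eq]

theorem norm_fourier_fderiv {h : V → F} (hh : Integrable h) (hd : Differentiable ℝ h)
    (hh' : Integrable (fderiv ℝ h)) (ζ : V) :
    ‖𝓕 (fderiv ℝ h) ζ‖ = 2 * Real.pi * ‖ζ‖ * ‖𝓕 h ζ‖ := by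
  rw [Real.fourier_fderiv hh hd hh', VectorFourier.norm_fourierSMulRight,
    neg_apply, norm_neg, innerSL_apply_norm]

/-- The factor `ρ‖ζ‖ / (1 + (ρ‖ζ‖)²)` vanishes at the origin because a derivative has mean zero,
and at infinity because the derivative is itself differentiable. -/
theorem norm_fourier_fderiv_apply_le {h : V → F} (hh : ContDiff ℝ 2 h)
    (hc : HasCompactSupport h) (m : V) {a b ρ : ℝ} (hρ : 0 < ρ) (ha : ∫ x, ‖h x‖ ≤ a)
    (hb : ∫ x, ‖fderiv ℝ (fun y => fderiv ℝ h y m) x‖ ≤ b) (ζ : V) :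
    ‖𝓕 (fun x => fderiv ℝ h x m) ζ‖ ≤
      (2 * Real.pi * ‖m‖ * a / ρ + b * ρ) * (ρ * ‖ζ‖ / (1 + (ρ * ‖ζ‖) ^ 2)) := by
  set f : V → F := fun x => fderiv ℝ h x m
  have hf : ContDiff ℝ 1 f := (hh.fderiv_right (m := 1) (by norm_num)).clm_apply contDiff_const
  have hfc : HasCompactSupport f := hc.fderiv_apply (𝕜 := ℝ) m
  have hh' : Integrable (fderiv ℝ h) :=
    (hh.continuous_fderiv (by norm_num)).integrable_of_hasCompactSupport (hc.fderiv ℝ)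
  have hf' : Integrable (fderiv ℝ f) :=
    (hf.continuous_fderiv one_ne_zero).integrable_of_hasCompactSupport (hfc.fderiv ℝ)
  have low : ‖𝓕 f ζ‖ ≤ 2 * Real.pi * ‖m‖ * a * ‖ζ‖ := by
    calc ‖𝓕 f ζ‖ = ‖𝓕 (fderiv ℝ h) ζ m‖ := by rw [Real.fourier_continuousLinearMap_apply hh']
      _ ≤ ‖𝓕 (fderiv ℝ h) ζ‖ * ‖m‖ := ContinuousLinearMap.le_opNorm _ _
      _ = 2 * Real.pi * ‖ζ‖ * ‖𝓕 h ζ‖ * ‖m‖ := by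
          rw [norm_fourier_fderiv (hh.continuous.integrable_of_hasCompactSupport hc)
            (hh.differentiable two_ne_zero) hh']
      _ ≤ 2 * Real.pi * ‖ζ‖ * a * ‖m‖ := by
          gcongr
          exact (norm_fourier_le_integral_norm h ζ).trans ha
      _ = 2 * Real.pi * ‖m‖ * a * ‖ζ‖ := by ring
  have high : ‖ζ‖ * ‖𝓕 f ζ‖ ≤ b := by
    calc ‖ζ‖ * ‖𝓕 f ζ‖ ≤ 2 * Real.pi * (‖ζ‖ * ‖𝓕 f ζ‖) :=
          le_mul_of_one_le_left (by positivity) (by linarith [Real.pi_gt_three])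
      _ = ‖𝓕 (fderiv ℝ f) ζ‖ := by
          rw [norm_fourier_fderiv (hf.continuous.integrable_of_hasCompactSupport hfc)
            (hf.differentiable one_ne_zero) hf']
          ring
      _ ≤ b := (norm_fourier_le_integral_norm _ ζ).trans hb
  rw [← mul_div_assoc, le_div_iff₀ (by positivity)]
  calc ‖𝓕 f ζ‖ * (1 + (ρ * ‖ζ‖) ^ 2) = ‖𝓕 f ζ‖ + ρ ^ 2 * ‖ζ‖ * (‖ζ‖ * ‖𝓕 f ζ‖) := by ring
    _ ≤ 2 * Real.pi * ‖m‖ * a * ‖ζ‖ + ρ ^ 2 * ‖ζ‖ * b := by gcongr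
    _ = (2 * Real.pi * ‖m‖ * a / ρ + b * ρ) * (ρ * ‖ζ‖) := by field_simp

theorem integrable_fourier_of_hasCompactSupport {h : V → F} (hh : ContDiff ℝ ∞ h)
    (hc : HasCompactSupport h) : Integrable (𝓕 h) :=
  (𝓕 (hc.toSchwartzMap hh)).integrable

end Fourier

/-- The bilinear form `∫∫ φ(x) v(y) f(t y - (t - 1) x) dx dy` in `φ` and `v`: the contribution of
the scale `t` to the pairing of `φ` with an operator of Poincaré type applied to `v`. -/
def scalePairing (f φ v : V → ℝ) (t : ℝ) : ℝ :=
  ∫ p : V × V, φ p.1 * v p.2 * f (t • p.2 - (t - 1) • p.1)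

/-- The complex-valued function underlying a real-valued one, to which the Fourier transform
applies. -/
abbrev toC (f : V → ℝ) : V → ℂ := fun x => (f x : ℂ)

section LargeScales

theorem scalePairing_eq_integral_fourier {f φ v : V → ℝ} (hf : Continuous f) (hfi : Integrable f)
    (hfF : Integrable (𝓕 (toC f))) (hφ : Integrable φ) (hv : Integrable v) (t : ℝ) :
    (scalePairing f φ v t : ℂ) =
      ∫ ζ, 𝓕 (toC f) ζ * (𝓕 (toC φ) ((t - 1) • ζ) * 𝓕 (toC v) (-(t • ζ))) := by
  have inversion (a : V) : (f a : ℂ) = ∫ ζ, 𝐞 (inner ℝ ζ a) • 𝓕 (toC f) ζ := by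
    have hfC : Continuous (toC f) := Complex.continuous_ofReal.comp hf
    rw [← Real.fourierInv_eq, hfC.fourierInv_fourier_eq hfi.ofReal hfF]
  have hint : Integrable (fun q : (V × V) × V =>
      𝐞 (inner ℝ q.2 (t • q.1.2 - (t - 1) • q.1.1)) •
        ((toC φ q.1.1 * toC v q.1.2) * 𝓕 (toC f) q.2))
      ((volume : Measure (V × V)).prod volume) := by
    have h := ((hφ.ofReal (𝕜 := ℂ)).mul_prod (hv.ofReal (𝕜 := ℂ))).mul_prod hfF
    refine h.norm.mono' (AEStronglyMeasurable.fun_smul (Continuous.aestronglyMeasurable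
      (Real.continuous_fourierChar.comp (by fun_prop))) h.aestronglyMeasurable)
      (.of_forall fun q => (Circle.norm_smul _ _).le)
  calc (scalePairing f φ v t : ℂ)
      = ∫ p : V × V, ∫ ζ, 𝐞 (inner ℝ ζ (t • p.2 - (t - 1) • p.1)) •
        ((toC φ p.1 * toC v p.2) * 𝓕 (toC f) ζ) := by
        rw [scalePairing, ← integral_complex_ofReal]
        refine integral_congr_ae (.of_forall fun p => ?_)
        simp only [Complex.ofReal_mul, inversion]
        rw [← integral_const_mul]
        refine integral_congr_ae (.of_forall fun ζ => ?_)
        simp only [Circle.smul_def, smul_eq_mul]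
        ring
    _ = ∫ ζ, ∫ p : V × V, 𝐞 (inner ℝ ζ (t • p.2 - (t - 1) • p.1)) •
        ((toC φ p.1 * toC v p.2) * 𝓕 (toC f) ζ) := integral_integral_swap hint
    _ = _ := by
        refine integral_congr_ae (.of_forall fun ζ => ?_)
        simp only [Real.fourier_eq (toC φ), Real.fourier_eq (toC v)]
        rw [← integral_prod_mul, ← integral_const_mul]
        refine integral_congr_ae (.of_forall fun p => ?_)
        have phase : 𝐞 (inner ℝ ζ (t • p.2 - (t - 1) • p.1)) =
            𝐞 (-inner ℝ p.1 ((t - 1) • ζ)) * 𝐞 (-inner ℝ p.2 (-(t • ζ))) := by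
          rw [← AddChar.map_add_eq_mul]
          congr 1
          simp only [inner_sub_right, inner_smul_right, inner_neg_right, real_inner_comm ζ]
          ring
        simp only [phase, Circle.smul_def, Circle.coe_mul, smul_eq_mul]
        ring

theorem enorm_scalePairing_le_lintegral_fourier {f φ v : V → ℝ} (hf : Continuous f)
    (hfi : Integrable f) (hfF : Integrable (𝓕 (toC f))) (hφ : Integrable φ) (hv : Integrable v)
    (t : ℝ) :
    ‖scalePairing f φ v t‖ₑ ≤
      ∫⁻ ζ, ‖𝓕 (toC f) ζ‖ₑ * (‖𝓕 (toC φ) ((t - 1) • ζ)‖ₑ * ‖𝓕 (toC v) (-(t • ζ))‖ₑ) := by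
  have h : ‖scalePairing f φ v t‖ₑ = ‖(scalePairing f φ v t : ℂ)‖ₑ := by
    rw [← ofReal_norm, ← ofReal_norm, Complex.norm_real]
  rw [h, scalePairing_eq_integral_fourier hf hfi hfF hφ hv]
  refine (enorm_integral_le_lintegral_enorm _).trans_eq ?_
  simp only [enorm_mul]

theorem lintegral_cauchy_kernel_le {a : ℝ} (ha : 0 ≤ a) :
    ∫⁻ t, ENNReal.ofReal (a / (t ^ 2 + a ^ 2)) ≤ ENNReal.ofReal Real.pi := by
  rcases ha.eq_or_lt with rfl | ha
  · simp
  have rescale (t : ℝ) : a / (t ^ 2 + a ^ 2) = a⁻¹ * (1 + (a⁻¹ * t) ^ 2)⁻¹ := by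
    have : t ^ 2 + a ^ 2 ≠ 0 := by positivity
    field_simp
    ring
  have hint : Integrable (fun t : ℝ => a⁻¹ * (1 + (a⁻¹ * t) ^ 2)⁻¹) :=
    (integrable_inv_one_add_sq.comp_mul_left' (by positivity)).const_mul _
  simp only [rescale]
  rw [← ofReal_integral_eq_lintegral_ofReal hint (.of_forall fun t => by positivity),
    integral_const_mul, Measure.integral_comp_mul_left (fun t => (1 + t ^ 2)⁻¹),
    integral_univ_inv_one_add_sq, inv_inv, abs_of_pos ha, smul_eq_mul,
    inv_mul_cancel_left₀ ha.ne']

section Dilation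

variable [Nontrivial V] {F : V → ℂ} {A ρ : ℝ} {H : V → ℝ≥0∞}

theorem lintegral_pow_mul_comp_smul_le (hF : Continuous F) (hρ : 0 < ρ)
    (hFA : ∀ ζ, ‖F ζ‖ ≤ A * (ρ * ‖ζ‖ / (1 + (ρ * ‖ζ‖) ^ 2))) (hH : Measurable H) {t : ℝ}
    (ht : 0 < t) :
    ∫⁻ ζ, ENNReal.ofReal (t ^ (finrank ℝ V - 1)) * ‖F ζ‖ₑ * H (t • ζ) ≤
      ∫⁻ η, ENNReal.ofReal (A * (ρ * ‖η‖ / (t ^ 2 + (ρ * ‖η‖) ^ 2))) * H η := by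
  have change_var := lintegral_comp_smul (f := fun η => ‖F (t⁻¹ • η)‖ₑ * H η)
    ((hF.measurable.comp (measurable_const_smul _)).enorm.mul hH) ht
  simp only [smul_smul, inv_mul_cancel₀ ht.ne', one_smul] at change_var
  have jacobian : t ^ (finrank ℝ V - 1) * (t ^ finrank ℝ V)⁻¹ = t⁻¹ := by
    obtain ⟨m, hm⟩ : ∃ m, finrank ℝ V = m + 1 := ⟨_, (Nat.sub_add_cancel finrank_pos).symm⟩
    have : t ^ m ≠ 0 := by positivity
    rw [hm, Nat.add_sub_cancel, pow_succ]
    field_simp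
  simp only [mul_assoc]
  rw [lintegral_const_mul' _ _ ENNReal.ofReal_ne_top, change_var, ← mul_assoc,
    ← ENNReal.ofReal_mul (by positivity), jacobian,
    ← lintegral_const_mul' _ _ ENNReal.ofReal_ne_top]
  refine lintegral_mono fun η => ?_
  rw [← mul_assoc, ← ofReal_norm, ← ENNReal.ofReal_mul (by positivity)]
  refine mul_le_mul_left (ENNReal.ofReal_le_ofReal ?_) _
  refine (mul_le_mul_of_nonneg_left (hFA _) (by positivity)).trans (le_of_eq ?_)
  rw [norm_smul, norm_inv, Real.norm_of_nonneg ht.le]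
  have : t ^ 2 + (ρ * ‖η‖) ^ 2 ≠ 0 := by positivity
  have : 1 + (ρ * (t⁻¹ * ‖η‖)) ^ 2 ≠ 0 := by positivity
  field_simp

/-- Integrating over the dilations in polar fashion turns the decay of `F` into a Cauchy kernel in
the variable `t`. -/
theorem lintegral_Ioi_pow_mul_comp_smul_le (hF : Continuous F) (hA : 0 ≤ A) (hρ : 0 < ρ)
    (hFA : ∀ ζ, ‖F ζ‖ ≤ A * (ρ * ‖ζ‖ / (1 + (ρ * ‖ζ‖) ^ 2))) (hH : Measurable H) :
    ∫⁻ t in Set.Ioi (0 : ℝ),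
        ∫⁻ ζ, ENNReal.ofReal (t ^ (finrank ℝ V - 1)) * ‖F ζ‖ₑ * H (t • ζ) ≤
      ENNReal.ofReal (A * Real.pi) * ∫⁻ η, H η := by
  calc _ ≤ ∫⁻ t in Set.Ioi (0 : ℝ),
        ∫⁻ η, ENNReal.ofReal (A * (ρ * ‖η‖ / (t ^ 2 + (ρ * ‖η‖) ^ 2))) * H η :=
        setLIntegral_mono' measurableSet_Ioi fun t ht =>
          lintegral_pow_mul_comp_smul_le hF hρ hFA hH ht
    _ = ∫⁻ η, (∫⁻ t in Set.Ioi (0 : ℝ),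
        ENNReal.ofReal (A * (ρ * ‖η‖ / (t ^ 2 + (ρ * ‖η‖) ^ 2)))) * H η := by
        rw [lintegral_lintegral_swap (by fun_prop)]
        exact lintegral_congr fun η => lintegral_mul_const _ (by fun_prop)
    _ ≤ ∫⁻ η, ENNReal.ofReal (A * Real.pi) * H η := by
        gcongr with η
        simp only [ENNReal.ofReal_mul hA]
        rw [lintegral_const_mul _ (by fun_prop)]
        gcongr
        exact (setLIntegral_le_lintegral _ _).trans (lintegral_cauchy_kernel_le (by positivity))
    _ = _ := lintegral_const_mul _ hH

theorem lintegral_Ioi_two_pow_mul_comp_sub_one_smul_le (hF : Continuous F) (hA : 0 ≤ A)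
    (hρ : 0 < ρ) (hFA : ∀ ζ, ‖F ζ‖ ≤ A * (ρ * ‖ζ‖ / (1 + (ρ * ‖ζ‖) ^ 2))) (hH : Measurable H) :
    ∫⁻ t in Set.Ioi (2 : ℝ),
        ∫⁻ ζ, ENNReal.ofReal (t ^ (finrank ℝ V - 1)) * ‖F ζ‖ₑ * H ((t - 1) • ζ) ≤
      ENNReal.ofReal (2 ^ finrank ℝ V * (A * Real.pi)) * ∫⁻ η, H η := by
  set d := finrank ℝ V
  have double {t : ℝ} (ht : 2 < t) : t ^ (d - 1) ≤ 2 ^ d * (t - 1) ^ (d - 1) := by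
    have : 0 ≤ (t - 1) ^ (d - 1) := pow_nonneg (by linarith) _
    calc t ^ (d - 1) ≤ (2 * (t - 1)) ^ (d - 1) := by gcongr; linarith
      _ = 2 ^ (d - 1) * (t - 1) ^ (d - 1) := mul_pow _ _ _
      _ ≤ 2 ^ d * (t - 1) ^ (d - 1) := by
        gcongr
        · exact one_le_two
        · exact Nat.sub_le d 1
  calc _ ≤ ∫⁻ t in Set.Ioi (1 + 1 : ℝ), ENNReal.ofReal (2 ^ d) *
        ∫⁻ ζ, ENNReal.ofReal ((t - 1) ^ (d - 1)) * ‖F ζ‖ₑ * H ((t - 1) • ζ) := by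
        rw [one_add_one_eq_two]
        refine setLIntegral_mono' measurableSet_Ioi fun t ht => ?_
        rw [← lintegral_const_mul' _ _ ENNReal.ofReal_ne_top]
        refine lintegral_mono fun ζ => ?_
        rw [← mul_assoc, ← mul_assoc, ← ENNReal.ofReal_mul (by positivity)]
        gcongr
        exact double ht
    _ = ENNReal.ofReal (2 ^ d) * ∫⁻ t in Set.Ioi (1 : ℝ),
        ∫⁻ ζ, ENNReal.ofReal (t ^ (d - 1)) * ‖F ζ‖ₑ * H (t • ζ) := by
        rw [lintegral_const_mul' _ _ ENNReal.ofReal_ne_top, ← Set.preimage_sub_const_Ioi,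
          setLIntegral_preimage_sub_right
            fun t => ∫⁻ ζ, ENNReal.ofReal (t ^ (d - 1)) * ‖F ζ‖ₑ * H (t • ζ)]
    _ ≤ ENNReal.ofReal (2 ^ d) * (ENNReal.ofReal (A * Real.pi) * ∫⁻ η, H η) := by
        gcongr
        exact (lintegral_mono_set (Set.Ioi_subset_Ioi zero_le_one)).trans
          (lintegral_Ioi_pow_mul_comp_smul_le hF hA hρ hFA hH)
    _ = _ := by rw [← mul_assoc, ← ENNReal.ofReal_mul (by positivity)]

end Dilation

theorem rpow_half_lintegral_fourier_sq {v : V → ℝ} (hv : Integrable v) (hv2 : MemLp v 2) :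
    (∫⁻ η, ‖𝓕 (toC v) η‖ₑ ^ 2) ^ (1 / 2 : ℝ) = eLpNorm v 2 volume := by
  rw [← eLpNorm_two_eq_lintegral, eLpNorm_fourier_eq (v := toC v) hv.ofReal hv2.ofReal]
  exact eLpNorm_congr_norm_ae (.of_forall fun x => by simp)

theorem lintegral_Ioi_two_scalePairing_le [Nontrivial V] {f φ v : V → ℝ} (hf : Continuous f)
    (hfi : Integrable f) (hfF : Integrable (𝓕 (toC f))) (hφ : Integrable φ) (hφ2 : MemLp φ 2)
    (hv : Integrable v) (hv2 : MemLp v 2) {A ρ : ℝ} (hA : 0 ≤ A) (hρ : 0 < ρ)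
    (hFA : ∀ ζ, ‖𝓕 (toC f) ζ‖ ≤ A * (ρ * ‖ζ‖ / (1 + (ρ * ‖ζ‖) ^ 2))) :
    ∫⁻ t in Set.Ioi (2 : ℝ), ENNReal.ofReal (t ^ (finrank ℝ V - 1)) * ‖scalePairing f φ v t‖ₑ ≤
      ENNReal.ofReal (2 ^ finrank ℝ V * (A * Real.pi)) *
        (eLpNorm φ 2 volume * eLpNorm v 2 volume) := by
  have hcf : Continuous (𝓕 (toC f)) := continuous_fourier_of_integrable hfi.ofReal
  have hcφ : Continuous (𝓕 (toC φ)) := continuous_fourier_of_integrable hφ.ofReal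
  have hcv : Continuous (𝓕 (toC v)) := continuous_fourier_of_integrable hv.ofReal
  set c := ENNReal.ofReal (2 ^ finrank ℝ V * (A * Real.pi))
  set w : ℝ × V → ℝ≥0∞ := fun p => ENNReal.ofReal (p.1 ^ (finrank ℝ V - 1)) * ‖𝓕 (toC f) p.2‖ₑ
  set X : ℝ × V → ℝ≥0∞ := fun p => ‖𝓕 (toC φ) ((p.1 - 1) • p.2)‖ₑ
  set Y : ℝ × V → ℝ≥0∞ := fun p => ‖𝓕 (toC v) (-(p.1 • p.2))‖ₑ
  have hw : Measurable w :=
    Measurable.mul (by fun_prop) (hcf.measurable.comp measurable_snd).enorm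
  have hX : Measurable X := (Continuous.measurable (hcφ.comp (by fun_prop))).enorm
  have hY : Measurable Y := (Continuous.measurable (hcv.comp (by fun_prop))).enorm
  have bound_X : ∫⁻ p, w p * X p ^ 2 ∂(volume.restrict (Set.Ioi (2 : ℝ))).prod volume ≤
      c * ∫⁻ η, ‖𝓕 (toC φ) η‖ₑ ^ 2 := by
    rw [lintegral_prod _ (by fun_prop)]
    exact lintegral_Ioi_two_pow_mul_comp_sub_one_smul_le hcf hA hρ hFA
      (H := fun η => ‖𝓕 (toC φ) η‖ₑ ^ 2) (hcφ.measurable.enorm.pow_const 2)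
  have bound_Y : ∫⁻ p, w p * Y p ^ 2 ∂(volume.restrict (Set.Ioi (2 : ℝ))).prod volume ≤
      c * ∫⁻ η, ‖𝓕 (toC v) η‖ₑ ^ 2 := by
    rw [lintegral_prod _ (by fun_prop), ← lintegral_neg_eq_self (fun η => ‖𝓕 (toC v) η‖ₑ ^ 2)]
    refine (lintegral_mono_set (Set.Ioi_subset_Ioi zero_le_two)).trans
      ((lintegral_Ioi_pow_mul_comp_smul_le hcf hA hρ hFA (H := fun η => ‖𝓕 (toC v) (-η)‖ₑ ^ 2)
        ((hcv.measurable.comp measurable_neg).enorm.pow_const 2)).trans ?_)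
    gcongr
    exact ENNReal.ofReal_le_ofReal
      (le_mul_of_one_le_left (by positivity) (one_le_pow₀ one_le_two))
  calc _ ≤ ∫⁻ p, w p * (X p * Y p) ∂(volume.restrict (Set.Ioi (2 : ℝ))).prod volume := by
        rw [lintegral_prod _ (by fun_prop)]
        refine lintegral_mono fun t => ?_
        simp only [w, X, Y, mul_assoc]
        rw [lintegral_const_mul' _ _ ENNReal.ofReal_ne_top]
        gcongr
        exact enorm_scalePairing_le_lintegral_fourier hf hfi hfF hφ hv t
    _ ≤ (c * ∫⁻ η, ‖𝓕 (toC φ) η‖ₑ ^ 2) ^ (1 / 2 : ℝ) *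
        (c * ∫⁻ η, ‖𝓕 (toC v) η‖ₑ ^ 2) ^ (1 / 2 : ℝ) :=
        (lintegral_mul_mul_le_sqrt_mul_sqrt hw hX hY).trans (by gcongr)
    _ = c * (eLpNorm φ 2 volume * eLpNorm v 2 volume) := by
        rw [ENNReal.mul_rpow_of_nonneg _ _ (by norm_num), ENNReal.mul_rpow_of_nonneg _ _
          (by norm_num), rpow_half_lintegral_fourier_sq hφ hφ2,
          rpow_half_lintegral_fourier_sq hv hv2, mul_mul_mul_comm, rpow_half_mul_rpow_half]

end LargeScales

section SmallScales

variable {f φ v : V → ℝ} {Ω : Set V} {t N ρ : ℝ}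

theorem lintegral_enorm_comp_smul_sub (hf : Measurable f) (ht : 0 < t) (z : V) :
    ∫⁻ y, ‖f (t • y - z)‖ₑ = ENNReal.ofReal (t ^ finrank ℝ V)⁻¹ * ∫⁻ y, ‖f y‖ₑ := by
  rw [lintegral_comp_smul (f := fun y => ‖f (y - z)‖ₑ) (by fun_prop) ht,
    lintegral_sub_right_eq_self (fun y => ‖f y‖ₑ)]

theorem lintegral_enorm_comp_sub_smul (hf : Measurable f) (ht : 0 < t) (z : V) :
    ∫⁻ x, ‖f (z - t • x)‖ₑ = ENNReal.ofReal (t ^ finrank ℝ V)⁻¹ * ∫⁻ y, ‖f y‖ₑ := by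
  rw [lintegral_comp_smul (f := fun x => ‖f (z - x)‖ₑ) (by fun_prop) ht,
    lintegral_sub_left_eq_self (fun y => ‖f y‖ₑ)]

theorem setLIntegral_enorm_le_of_norm_le {C : ℝ} (hΩ : volume Ω ≠ ⊤) (hf : ∀ x, ‖f x‖ ≤ C) :
    ∫⁻ x in Ω, ‖f x‖ₑ ≤ ENNReal.ofReal (C * volume.real Ω) := by
  have hC : 0 ≤ C := (norm_nonneg _).trans (hf 0)
  rw [ENNReal.ofReal_mul hC, ofReal_measureReal hΩ, ← setLIntegral_const]
  exact lintegral_mono fun x => by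
    rw [← ofReal_norm]
    exact ENNReal.ofReal_le_ofReal (hf x)

theorem enorm_scalePairing_le (hf : Measurable f) (hφ : Measurable φ) (hv : Measurable v)
    (hΩ : MeasurableSet Ω) (hφΩ : ∀ x ∉ Ω, φ x = 0) {A D : ℝ≥0∞}
    (hA : ∀ x, ∫⁻ y, ‖f (t • y - (t - 1) • x)‖ₑ ≤ A)
    (hD : ∀ y, ∫⁻ x in Ω, ‖f (t • y - (t - 1) • x)‖ₑ ≤ D) :
    ‖scalePairing f φ v t‖ₑ ≤
      (A * D) ^ (1 / 2 : ℝ) * (eLpNorm φ 2 volume * eLpNorm v 2 volume) := by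
  set K : V → V → ℝ≥0∞ := fun x y => Ω.indicator (fun x => ‖f (t • y - (t - 1) • x)‖ₑ) x
  have hK : Measurable K.uncurry := by
    change Measurable ((Prod.fst ⁻¹' Ω).indicator
      fun p : V × V => ‖f (t • p.2 - (t - 1) • p.1)‖ₑ)
    exact Measurable.indicator (by fun_prop) (measurable_fst hΩ)
  simp only [eLpNorm_two_eq_lintegral]
  calc ‖scalePairing f φ v t‖ₑ ≤ ∫⁻ p : V × V, K p.1 p.2 * (‖φ p.1‖ₑ * ‖v p.2‖ₑ) := by
        refine (enorm_integral_le_lintegral_enorm _).trans (lintegral_mono fun p => ?_)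
        by_cases hp : p.1 ∈ Ω
        · simp only [K, Set.indicator_of_mem hp, enorm_mul, mul_comm, le_refl]
        · simp [hφΩ _ hp]
    _ ≤ _ := by
        refine lintegral_prod_mul_le_of_schur hK hφ.enorm hv.enorm (.of_forall fun x => ?_)
          (.of_forall fun y => ?_)
        · exact (lintegral_mono fun y => Set.indicator_le_self _ _ _).trans (hA x)
        · simpa only [K, lintegral_indicator hΩ] using hD y

theorem lintegral_enorm_le_ofReal (hfi : Integrable f) (hN : ∫ y, ‖f y‖ ≤ N) :
    ∫⁻ y, ‖f y‖ₑ ≤ ENNReal.ofReal N := by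
  rw [← ofReal_integral_norm_eq_lintegral_enorm hfi]
  exact ENNReal.ofReal_le_ofReal hN

theorem enorm_scalePairing_le_mul_sqrt_min (hf : Measurable f) (hfi : Integrable f)
    (hN : ∫ y, ‖f y‖ ≤ N) (hρ : 0 < ρ) (hS : ∀ y, ‖f y‖ ≤ N / ρ ^ finrank ℝ V)
    (hφ : Measurable φ) (hv : Measurable v) (hΩ : MeasurableSet Ω) (hΩt : volume Ω ≠ ⊤)
    (hφΩ : ∀ x ∉ Ω, φ x = 0) (ht : 1 < t) :
    ‖scalePairing f φ v t‖ₑ ≤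
      ENNReal.ofReal (N * √(min ((t - 1) ^ finrank ℝ V)⁻¹ (volume.real Ω / ρ ^ finrank ℝ V))) *
        (eLpNorm φ 2 volume * eLpNorm v 2 volume) := by
  set d := finrank ℝ V
  have hN0 : 0 ≤ N := (integral_nonneg fun _ => norm_nonneg _).trans hN
  have ht1 : 0 < t - 1 := sub_pos.2 ht
  have hf1 := lintegral_enorm_le_ofReal hfi hN
  have row (x : V) : ∫⁻ y, ‖f (t • y - (t - 1) • x)‖ₑ ≤ ENNReal.ofReal N := by
    rw [lintegral_enorm_comp_smul_sub hf (one_pos.trans ht)]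
    refine (mul_le_of_le_one_left zero_le ?_).trans hf1
    exact ENNReal.ofReal_le_one.2 (inv_le_one_of_one_le₀ (one_le_pow₀ ht.le))
  have column (y : V) : ∫⁻ x in Ω, ‖f (t • y - (t - 1) • x)‖ₑ ≤
      ENNReal.ofReal (N * min ((t - 1) ^ d)⁻¹ (volume.real Ω / ρ ^ d)) := by
    rw [mul_min_of_nonneg _ _ hN0, ENNReal.ofReal_min]
    refine le_min ((setLIntegral_le_lintegral _ _).trans ?_) ?_
    · rw [lintegral_enorm_comp_sub_smul hf ht1, mul_comm N, ENNReal.ofReal_mul (by positivity)]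
      gcongr
    · rw [mul_div_left_comm, mul_comm]
      exact setLIntegral_enorm_le_of_norm_le hΩt fun x => hS _
  refine (enorm_scalePairing_le hf hφ hv hΩ hφΩ row column).trans_eq ?_
  rw [← ENNReal.ofReal_mul hN0, ofReal_rpow_half (by positivity), ← mul_assoc N, ← sq,
    Real.sqrt_mul (by positivity), Real.sqrt_sq hN0]

theorem inv_pow_le_two_pow_mul_inv_pow (d : ℕ) {s t : ℝ} (ht : 0 < t) (hs : 0 < s)
    (hts : t ≤ 2 * s) : (s ^ d)⁻¹ ≤ 2 ^ d * (t ^ d)⁻¹ := by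
  rw [← div_eq_mul_inv, le_div_iff₀ (by positivity), inv_mul_le_iff₀ (by positivity), mul_comm,
    ← mul_pow]
  gcongr

theorem enorm_scalePairing_le_mul_inv_pow (hf : Measurable f) (hfi : Integrable f)
    (hN : ∫ y, ‖f y‖ ≤ N) (hφ : Measurable φ) (hv : Measurable v) (ht : 2 < t) :
    ‖scalePairing f φ v t‖ₑ ≤ ENNReal.ofReal (2 ^ finrank ℝ V * N * (t ^ finrank ℝ V)⁻¹) *
        (eLpNorm φ 2 volume * eLpNorm v 2 volume) := by
  set d := finrank ℝ V
  have : 0 ≤ N := (integral_nonneg fun _ => norm_nonneg _).trans hN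
  have ht0 : 0 < t := two_pos.trans ht
  have ht1 : 0 < t - 1 := by linarith
  have hf1 := lintegral_enorm_le_ofReal hfi hN
  have bound {s : ℝ} (hs : 0 < s) (hts : t ≤ 2 * s) : ENNReal.ofReal (s ^ d)⁻¹ * ∫⁻ y, ‖f y‖ₑ ≤
      ENNReal.ofReal (2 ^ d * N * (t ^ d)⁻¹) := by
    calc _ ≤ ENNReal.ofReal (2 ^ d * (t ^ d)⁻¹) * ENNReal.ofReal N := by
          gcongr
          exact inv_pow_le_two_pow_mul_inv_pow d ht0 hs hts
      _ = _ := by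
        rw [← ENNReal.ofReal_mul (by positivity)]
        congr 1
        ring
  refine (enorm_scalePairing_le (Ω := Set.univ) hf hφ hv .univ (by simp)
    (fun x => (lintegral_enorm_comp_smul_sub hf ht0 _).trans_le (bound ht0 (by linarith)))
    (fun y => ?_)).trans_eq
    (by rw [ENNReal.mul_rpow_of_nonneg _ _ (by norm_num), rpow_half_mul_rpow_half])
  rw [setLIntegral_univ, lintegral_enorm_comp_sub_smul hf ht1]
  exact bound ht1 (by linarith)

end SmallScales

section ScaleWeight

variable {n k : ℕ} {t : ℝ}

/-- The weight with which the scale `t` enters the Poincaré operator on `(k + 1)`-forms on `ℝⁿ`. -/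
def scaleWeight (n k : ℕ) (t : ℝ) : ℝ := (t - 1) ^ k * t ^ (n - k - 1) / t

theorem scaleWeight_nonneg (ht : 1 < t) : 0 ≤ scaleWeight n k t := by
  have : 0 < t - 1 := sub_pos.2 ht
  have : 0 < t := one_pos.trans ht
  unfold scaleWeight
  positivity

theorem scaleWeight_le_of_le_two (ht1 : 1 < t) (ht2 : t ≤ 2) :
    scaleWeight n k t ≤ 2 ^ n * (t - 1) ^ k := by
  have : 0 < t - 1 := sub_pos.2 ht1
  have h1 : t ^ (n - k - 1) ≤ 2 ^ n :=
    (pow_le_pow_right₀ ht1.le (by omega)).trans (pow_le_pow_left₀ (by linarith) ht2 n)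
  rw [scaleWeight, mul_comm]
  exact (div_le_self (by positivity) ht1.le).trans (by gcongr)

theorem scaleWeight_mul_self_le (hk : k + 1 ≤ n) (ht : 1 < t) :
    scaleWeight n k t * t ≤ t ^ (n - 1) := by
  have : 0 < t - 1 := sub_pos.2 ht
  have h1 : 0 < t := one_pos.trans ht
  rw [scaleWeight, div_mul_cancel₀ _ h1.ne', show n - 1 = k + (n - k - 1) by omega, pow_add]
  gcongr
  linarith

theorem scaleWeight_mul_inv_pow_le (hk : k + 1 ≤ n) (ht : 1 < t) :
    scaleWeight n k t * (t ^ n)⁻¹ ≤ (t ^ 2)⁻¹ := by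
  have ht0 : 0 < t := one_pos.trans ht
  have hw := (le_div_iff₀ ht0).2 (scaleWeight_mul_self_le hk ht)
  calc _ ≤ t ^ (n - 1) / t * (t ^ n)⁻¹ := by gcongr
    _ = (t ^ 2)⁻¹ := by
      rw [← pow_sub_one_mul (by omega : n ≠ 0) t]
      field_simp

@[fun_prop]
theorem measurable_scaleWeight : Measurable (scaleWeight n k) := by
  unfold scaleWeight
  fun_prop

theorem lintegral_Ioi_inv_sq {a : ℝ} (ha : 0 < a) :
    ∫⁻ t in Set.Ioi a, ENNReal.ofReal (t ^ 2)⁻¹ = ENNReal.ofReal a⁻¹ := by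
  have h : Set.EqOn (fun t : ℝ => (t ^ 2)⁻¹) (fun t => t ^ (-2 : ℝ)) (Set.Ioi a) :=
    fun t (ht : a < t) => by
      dsimp only
      rw [Real.rpow_neg (ha.trans ht).le, Real.rpow_two]
  have hint : IntegrableOn (fun t : ℝ => (t ^ 2)⁻¹) (Set.Ioi a) :=
    (integrableOn_congr_fun h measurableSet_Ioi).2 (integrableOn_Ioi_rpow_of_lt (by norm_num) ha)
  rw [← ofReal_integral_eq_lintegral_ofReal hint (.of_forall fun t => by positivity),
    setIntegral_congr_fun measurableSet_Ioi h, integral_Ioi_rpow_of_lt (by norm_num) ha]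
  norm_num [Real.rpow_neg_one]

theorem lintegral_Ioi_two_inv_sq_le : ∫⁻ t in Set.Ioi (2 : ℝ), ENNReal.ofReal (t ^ 2)⁻¹ ≤ 1 := by
  rw [lintegral_Ioi_inv_sq two_pos]
  exact ENNReal.ofReal_le_one.2 (by norm_num)

/-- The integral over small scales `σ = t - 1` of the norms of the scale pairings: each is of order
`√(min σ⁻ⁿ Q)`, where `Q` stands for `|Ω| / ρⁿ`. -/
def smallScale (n k : ℕ) (Q : ℝ) : ℝ≥0∞ :=
  ∫⁻ σ in Set.Ioc (0 : ℝ) 1, ENNReal.ofReal (σ ^ k * √(min (σ ^ n)⁻¹ Q))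

theorem lintegral_Ioi_one_eq_add (g : ℝ → ℝ≥0∞) : ∫⁻ t in Set.Ioi 1, g t =
    (∫⁻ t in Set.Ioc 1 2, g t) + ∫⁻ t in Set.Ioi 2, g t := by
  rw [← Set.Ioc_union_Ioi_eq_Ioi one_le_two,
    lintegral_union measurableSet_Ioi (Set.Ioc_disjoint_Ioi le_rfl)]

end ScaleWeight

section Scales

variable {f φ v : V → ℝ} {Ω : Set V} {N ρ : ℝ} {k : ℕ}

theorem lintegral_Ioc_scalePairing_le (hf : Measurable f) (hfi : Integrable f)
    (hN : ∫ y, ‖f y‖ ≤ N) (hρ : 0 < ρ) (hS : ∀ y, ‖f y‖ ≤ N / ρ ^ finrank ℝ V)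
    (hφ : Measurable φ) (hv : Measurable v) (hΩ : MeasurableSet Ω) (hΩt : volume Ω ≠ ⊤)
    (hφΩ : ∀ x ∉ Ω, φ x = 0) :
    ∫⁻ t in Set.Ioc 1 2, ENNReal.ofReal (scaleWeight (finrank ℝ V) k t) * ‖scalePairing f φ v t‖ₑ ≤
      ENNReal.ofReal (2 ^ finrank ℝ V * N) *
        smallScale (finrank ℝ V) k (volume.real Ω / ρ ^ finrank ℝ V) *
          (eLpNorm φ 2 volume * eLpNorm v 2 volume) := by
  set d := finrank ℝ V
  set Q := volume.real Ω / ρ ^ d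
  set X := eLpNorm φ 2 volume * eLpNorm v 2 volume
  have hN0 : 0 ≤ N := (integral_nonneg fun _ => norm_nonneg _).trans hN
  have shift := setLIntegral_preimage_sub_right
    (fun σ => ENNReal.ofReal (σ ^ k * √(min (σ ^ d)⁻¹ Q))) (Set.Ioc 0 1) 1
  rw [Set.preimage_sub_const_Ioc, zero_add, one_add_one_eq_two] at shift
  rw [smallScale, ← shift, ← lintegral_const_mul _ (by fun_prop),
    ← lintegral_mul_const _ (by fun_prop)]
  refine setLIntegral_mono' measurableSet_Ioc fun t ht => ?_
  have ht1 : 0 < t - 1 := sub_pos.2 ht.1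
  calc _ ≤ ENNReal.ofReal (2 ^ d * (t - 1) ^ k) *
        (ENNReal.ofReal (N * √(min ((t - 1) ^ d)⁻¹ Q)) * X) := by
        gcongr
        · exact scaleWeight_le_of_le_two ht.1 ht.2
        · exact enorm_scalePairing_le_mul_sqrt_min hf hfi hN hρ hS hφ hv hΩ hΩt hφΩ ht.1
    _ = _ := by
        rw [← mul_assoc, ← ENNReal.ofReal_mul (by positivity), ← ENNReal.ofReal_mul (by positivity)]
        congr 2
        ring

theorem lintegral_Ioi_scalePairing_le (hk : k + 1 ≤ finrank ℝ V) (hf : Measurable f)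
    (hfi : Integrable f) (hN : ∫ y, ‖f y‖ ≤ N) (hρ : 0 < ρ)
    (hS : ∀ y, ‖f y‖ ≤ N / ρ ^ finrank ℝ V) (hφ : Measurable φ) (hv : Measurable v)
    (hΩ : MeasurableSet Ω) (hΩt : volume Ω ≠ ⊤) (hφΩ : ∀ x ∉ Ω, φ x = 0) :
    ∫⁻ t in Set.Ioi 1, ENNReal.ofReal (scaleWeight (finrank ℝ V) k t) * ‖scalePairing f φ v t‖ₑ ≤
      ENNReal.ofReal (2 ^ finrank ℝ V * N) *
        (smallScale (finrank ℝ V) k (volume.real Ω / ρ ^ finrank ℝ V) + 1) *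
          (eLpNorm φ 2 volume * eLpNorm v 2 volume) := by
  have hN0 : 0 ≤ N := (integral_nonneg fun _ => norm_nonneg _).trans hN
  rw [lintegral_Ioi_one_eq_add, mul_add, add_mul]
  refine add_le_add (lintegral_Ioc_scalePairing_le hf hfi hN hρ hS hφ hv hΩ hΩt hφΩ)
    (le_trans ?_ (mul_le_mul_left (mul_le_mul_right lintegral_Ioi_two_inv_sq_le _) _))
  rw [← lintegral_const_mul _ (by fun_prop), ← lintegral_mul_const _ (by fun_prop)]
  refine setLIntegral_mono' measurableSet_Ioi fun t (ht : 2 < t) => ?_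
  have ht1 : 1 < t := one_lt_two.trans ht
  have : 0 < t := two_pos.trans ht
  refine (mul_le_mul_right (enorm_scalePairing_le_mul_inv_pow hf hfi hN hφ hv ht) _).trans ?_
  rw [← mul_assoc, ← ENNReal.ofReal_mul (scaleWeight_nonneg ht1),
    ← ENNReal.ofReal_mul (by positivity)]
  gcongr ENNReal.ofReal ?_ * _
  calc _ = 2 ^ finrank ℝ V * N * (scaleWeight (finrank ℝ V) k t * (t ^ finrank ℝ V)⁻¹) := by ring
    _ ≤ _ := by
      gcongr
      exact scaleWeight_mul_inv_pow_le hk ht1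

theorem lintegral_Ioi_sub_one_mul_scalePairing_le (hk : k + 1 ≤ finrank ℝ V) (hf : Continuous f)
    (hfi : Integrable f) (hfF : Integrable (𝓕 (toC f))) (hN : ∫ y, ‖f y‖ ≤ N) (hρ : 0 < ρ)
    (hS : ∀ y, ‖f y‖ ≤ N / ρ ^ finrank ℝ V) {A : ℝ}
    (hFA : ∀ ζ, ‖𝓕 (toC f) ζ‖ ≤ A * (ρ * ‖ζ‖ / (1 + (ρ * ‖ζ‖) ^ 2)))
    (hA : 0 ≤ A) (hφ : Measurable φ) (hφi : Integrable φ) (hφ2 : MemLp φ 2) (hv : Measurable v)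
    (hvi : Integrable v) (hv2 : MemLp v 2) (hΩ : MeasurableSet Ω) (hΩt : volume Ω ≠ ⊤)
    (hφΩ : ∀ x ∉ Ω, φ x = 0) :
    ∫⁻ t in Set.Ioi 1,
        ENNReal.ofReal (scaleWeight (finrank ℝ V) k t * (t - 1)) * ‖scalePairing f φ v t‖ₑ ≤
      ENNReal.ofReal (2 ^ finrank ℝ V) *
        (ENNReal.ofReal N * smallScale (finrank ℝ V) k (volume.real Ω / ρ ^ finrank ℝ V) +
          ENNReal.ofReal (A * Real.pi)) *
        (eLpNorm φ 2 volume * eLpNorm v 2 volume) := by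
  have : Nontrivial V := Module.finrank_pos_iff.1 (by omega : 0 < finrank ℝ V)
  rw [lintegral_Ioi_one_eq_add, mul_add, add_mul, ← mul_assoc (ENNReal.ofReal _),
    ← ENNReal.ofReal_mul (by positivity), ← ENNReal.ofReal_mul (by positivity)]
  refine add_le_add (le_trans ?_
    (lintegral_Ioc_scalePairing_le hf.measurable hfi hN hρ hS hφ hv hΩ hΩt hφΩ))
    (le_trans ?_ (lintegral_Ioi_two_scalePairing_le hf hfi hfF hφi hφ2 hvi hv2 hA hρ hFA))
  · refine setLIntegral_mono' measurableSet_Ioc fun t ht => ?_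
    gcongr
    exact mul_le_of_le_one_right (scaleWeight_nonneg ht.1) (by linarith [ht.2])
  · refine setLIntegral_mono' measurableSet_Ioi fun t (ht : 2 < t) => ?_
    have ht1 : 1 < t := one_lt_two.trans ht
    gcongr
    refine le_trans ?_ (scaleWeight_mul_self_le hk ht1)
    exact mul_le_mul_of_nonneg_left (by linarith) (scaleWeight_nonneg ht1)

end Scales

section Kappa

variable {n k ℓ : ℕ} {q Q : ℝ}

theorem setLIntegral_Ioc_ofReal {f : ℝ → ℝ} {a b : ℝ} (hab : a ≤ b)
    (hf : IntervalIntegrable f volume a b) (h0 : ∀ x ∈ Set.Ioc a b, 0 ≤ f x) :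
    ∫⁻ x in Set.Ioc a b, ENNReal.ofReal (f x) = ENNReal.ofReal (∫ x in a..b, f x) := by
  rw [intervalIntegral.integral_of_le hab, ofReal_integral_eq_lintegral_ofReal
    ((intervalIntegrable_iff_integrableOn_Ioc_of_le hab).1 hf)
    ((ae_restrict_iff' measurableSet_Ioc).2 (.of_forall h0))]

theorem pow_mul_sqrt_min_inv_pow_le {σ : ℝ} (hσ : 0 < σ) :
    σ ^ k * √(min (σ ^ n)⁻¹ Q) ≤ σ ^ ((k : ℝ) - n / 2) := by
  calc σ ^ k * √(min (σ ^ n)⁻¹ Q) ≤ σ ^ k * √(σ ^ n)⁻¹ := by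
        gcongr
        exact min_le_left _ _
    _ = σ ^ ((k : ℝ) - n / 2) := by
        rw [Real.sqrt_eq_rpow, ← Real.rpow_natCast, ← Real.rpow_natCast, ← Real.rpow_neg hσ.le,
          ← Real.rpow_mul hσ.le, ← Real.rpow_add hσ]
        congr 1
        ring

theorem smallScale_le_of_lt (h : n < 2 * (k + 1)) :
    smallScale n k Q ≤ ENNReal.ofReal ((k : ℝ) - n / 2 + 1)⁻¹ := by
  have h' : (n : ℝ) < 2 * (k + 1) := by exact_mod_cast h
  have hp : -1 < (k : ℝ) - n / 2 := by linarith
  calc _ ≤ ∫⁻ σ in Set.Ioc (0 : ℝ) 1, ENNReal.ofReal (σ ^ ((k : ℝ) - n / 2)) :=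
        setLIntegral_mono' measurableSet_Ioc fun σ hσ =>
          ENNReal.ofReal_le_ofReal (pow_mul_sqrt_min_inv_pow_le hσ.1)
    _ = _ := by
        rw [setLIntegral_Ioc_ofReal zero_le_one (intervalIntegral.intervalIntegrable_rpow' hp)
          (fun σ hσ => Real.rpow_nonneg hσ.1.le _), integral_rpow (.inl hp), Real.one_rpow,
          Real.zero_rpow (by linarith), sub_zero, one_div]

theorem smallScale_le_add {s : ℝ} (hs : 0 < s) (hs1 : s ≤ 1) :
    smallScale n k Q ≤ ENNReal.ofReal (s ^ (k + 1) * √Q) +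
      ENNReal.ofReal (∫ σ in s..1, σ ^ ((k : ℝ) - n / 2)) := by
  rw [smallScale, ← Set.Ioc_union_Ioc_eq_Ioc hs.le hs1,
    lintegral_union measurableSet_Ioc (Set.Ioc_disjoint_Ioc_of_le le_rfl)]
  gcongr
  · calc _ ≤ ∫⁻ _ in Set.Ioc (0 : ℝ) s, ENNReal.ofReal (s ^ k * √Q) := by
          refine setLIntegral_mono' measurableSet_Ioc fun σ hσ => ENNReal.ofReal_le_ofReal ?_
          have := hσ.1
          gcongr
          · exact hσ.2
          · exact min_le_right _ _
      _ = _ := by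
          rw [setLIntegral_const, Real.volume_Ioc, sub_zero, ← ENNReal.ofReal_mul (by positivity)]
          congr 1
          ring
  · calc _ ≤ ∫⁻ σ in Set.Ioc s 1, ENNReal.ofReal (σ ^ ((k : ℝ) - n / 2)) :=
          setLIntegral_mono' measurableSet_Ioc fun σ hσ =>
            ENNReal.ofReal_le_ofReal (pow_mul_sqrt_min_inv_pow_le (hs.trans hσ.1))
      _ = _ := setLIntegral_Ioc_ofReal hs1
          (intervalIntegral.intervalIntegrable_rpow (.inr (Set.notMem_uIcc_of_lt hs one_pos)))
          fun σ hσ => Real.rpow_nonneg (hs.trans hσ.1).le _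

theorem one_le_kappa (n ℓ : ℕ) (hq : 1 ≤ q) : 1 ≤ kappa n ℓ q := by
  have hlog : 0 ≤ Real.log q := Real.log_nonneg hq
  unfold kappa
  split_ifs
  · exact le_rfl
  all_goals exact le_add_of_nonneg_right (by positivity)

theorem rpow_le_three_mul_one_add_rpow_mul_log_rpow {a a' b : ℝ} (hq : 1 ≤ q) (haa : a' ≤ a)
    (ha' : a' ≤ 1) (hb : 0 ≤ b) : q ^ a' ≤ 3 * (1 + q ^ a * Real.log q ^ b) := by
  have hlog : 0 ≤ Real.log q := Real.log_nonneg hq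
  have hpos : 0 ≤ q ^ a * Real.log q ^ b := by positivity
  rcases le_total 1 (Real.log q) with h | h
  · have h1 : q ^ a' ≤ q ^ a := Real.rpow_le_rpow_of_exponent_le hq haa
    have h2 : q ^ a ≤ q ^ a * Real.log q ^ b :=
      le_mul_of_one_le_right (by positivity) (Real.one_le_rpow h hb)
    linarith
  · have h1 : q ≤ Real.exp 1 := (Real.log_le_iff_le_exp (by linarith)).1 h
    have h2 : q ^ a' ≤ q ^ (1 : ℝ) := Real.rpow_le_rpow_of_exponent_le hq ha'
    rw [Real.rpow_one] at h2
    linarith [Real.exp_one_lt_d9]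

theorem rpow_le_three_mul_kappa (hq : 1 ≤ q) (hℓ : 1 ≤ ℓ) (h : 2 * ℓ ≤ n) :
    q ^ (1 / 2 - ℓ / n : ℝ) ≤ 3 * kappa n ℓ q := by
  have hℓR : 1 ≤ (ℓ : ℝ) := by exact_mod_cast hℓ
  have hR : 2 * (ℓ : ℝ) ≤ n := by exact_mod_cast h
  have hn : 0 < (n : ℝ) := by linarith
  have hnl : 0 < (n : ℝ) - ℓ := by linarith
  have exponent_le : (1 / 2 - ℓ / n : ℝ) ≤ ((n : ℝ) - 2 * ℓ) / (2 * ((n : ℝ) - ℓ)) := by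
    rw [show (1 / 2 - ℓ / n : ℝ) = ((n : ℝ) - 2 * ℓ) / (2 * n) by field_simp]
    gcongr
    linarith
  have exponent_le_one : (1 / 2 - ℓ / n : ℝ) ≤ 1 := by
    have : 0 ≤ (ℓ / n : ℝ) := by positivity
    linarith
  rw [kappa, if_neg (by omega)]
  split_ifs with h2
  · exact rpow_le_three_mul_one_add_rpow_mul_log_rpow hq exponent_le exponent_le_one (by positivity)
  · have : 2 * (ℓ : ℝ) + 1 ≤ n := by exact_mod_cast (by omega : 2 * ℓ + 1 ≤ n)
    have : 0 ≤ (n : ℝ) - ℓ - 1 := by linarith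
    exact rpow_le_three_mul_one_add_rpow_mul_log_rpow hq exponent_le exponent_le_one (by positivity)

theorem kappa_two_mul_self (hℓ : ℓ ≠ 0) (q : ℝ) : kappa (2 * ℓ) ℓ q = 1 + Real.log q := by
  have hℓR : (ℓ : ℝ) ≠ 0 := by exact_mod_cast hℓ
  rw [kappa, if_neg (by omega), if_pos (by omega), Nat.cast_mul, Nat.cast_two, sub_self, zero_div,
    Real.rpow_zero, one_mul, show 2 * (ℓ : ℝ) / (2 * (2 * ℓ - ℓ)) = 1 by field_simp; ring,
    Real.rpow_one]

theorem integral_inv_le_kappa (hq : 1 ≤ q) :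
    ∫ σ in (q ^ (-(1 / (2 * (k + 1) : ℕ) : ℝ)))..1, σ⁻¹ ≤ kappa (2 * (k + 1)) (k + 1) q := by
  have hq0 : 0 < q := by linarith
  have hlog := Real.log_nonneg hq
  rw [integral_inv_of_pos (by positivity) one_pos, one_div, Real.log_inv, Real.log_rpow hq0,
    kappa_two_mul_self (Nat.succ_ne_zero k), neg_mul, neg_neg, one_div_mul_eq_div]
  have : Real.log q / (2 * (k + 1) : ℕ) ≤ Real.log q :=
    div_le_self hlog (by exact_mod_cast (by omega : 1 ≤ 2 * (k + 1)))
  linarith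

theorem integral_rpow_le_mul_kappa (h : 2 * (k + 1) < n) (hq : 1 ≤ q) :
    ∫ σ in (q ^ (-(1 / n : ℝ)))..1, σ ^ ((k : ℝ) - n / 2) ≤
      3 * ((n : ℝ) / 2 - (k + 1))⁻¹ * kappa n (k + 1) q := by
  have hq0 : 0 < q := by linarith
  have hn : (n : ℝ) ≠ 0 := by exact_mod_cast (by omega : n ≠ 0)
  have hd : 0 < (n : ℝ) / 2 - (k + 1) := by
    have : 2 * ((k : ℝ) + 1) < n := by exact_mod_cast h
    linarith
  have exponent : -(1 / n : ℝ) * ((k : ℝ) - n / 2 + 1) = 1 / 2 - ((k + 1 : ℕ) : ℝ) / n := by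
    push_cast
    field_simp
    ring
  rw [integral_rpow (.inr ⟨by linarith, Set.notMem_uIcc_of_lt (by positivity) one_pos⟩),
    Real.one_rpow, ← Real.rpow_mul hq0.le, exponent, ← neg_div_neg_eq,
    show -((k : ℝ) - n / 2 + 1) = (n : ℝ) / 2 - (k + 1) by ring, div_eq_inv_mul]
  calc _ ≤ ((n : ℝ) / 2 - (k + 1))⁻¹ * (3 * kappa n (k + 1) q) := by
        gcongr
        linarith [rpow_le_three_mul_kappa hq (Nat.le_add_left 1 k) h.le]
    _ = _ := by ring

theorem exists_integral_rpow_le_mul_kappa (h : 2 * (k + 1) ≤ n) :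
    ∃ C : ℝ, 0 ≤ C ∧ ∀ q : ℝ, 1 ≤ q →
      ∫ σ in (q ^ (-(1 / n : ℝ)))..1, σ ^ ((k : ℝ) - n / 2) ≤ C * kappa n (k + 1) q := by
  rcases h.eq_or_lt with rfl | hlt
  · refine ⟨1, zero_le_one, fun q hq => ?_⟩
    have exponent : (k : ℝ) - (2 * (k + 1) : ℕ) / 2 = -1 := by
      push_cast
      ring
    simpa only [exponent, Real.rpow_neg_one, one_mul] using integral_inv_le_kappa hq
  · have : 0 < (n : ℝ) / 2 - (k + 1) := by
      have : 2 * ((k : ℝ) + 1) < n := by exact_mod_cast hlt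
      linarith
    exact ⟨_, by positivity, fun q hq => integral_rpow_le_mul_kappa hlt hq⟩

theorem exists_smallScale_le_mul_kappa (n k : ℕ) {c : ℝ} (hc : 0 ≤ c) :
    ∃ C : ℝ, 0 ≤ C ∧ ∀ q : ℝ, 1 ≤ q →
      smallScale n k (c * q) ≤ ENNReal.ofReal (C * kappa n (k + 1) q) := by
  rcases lt_or_ge n (2 * (k + 1)) with hlt | hge
  · have : (n : ℝ) < 2 * (k + 1) := by exact_mod_cast hlt
    refine ⟨((k : ℝ) - n / 2 + 1)⁻¹, inv_nonneg.2 (by linarith), fun q _ =>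
      (smallScale_le_of_lt hlt).trans_eq ?_⟩
    rw [kappa, if_pos hlt, mul_one]
  obtain ⟨C, hC, hint⟩ := exists_integral_rpow_le_mul_kappa hge
  refine ⟨3 * √c + C, by positivity, fun q hq => ?_⟩
  have hq0 : 0 < q := by linarith
  have hn : (n : ℝ) ≠ 0 := by exact_mod_cast (by omega : n ≠ 0)
  have hκ := one_le_kappa n (k + 1) hq
  have splitting_value : (q ^ (-(1 / n : ℝ))) ^ (k + 1) * √q =
      q ^ (1 / 2 - ((k + 1 : ℕ) : ℝ) / n : ℝ) := by
    rw [← Real.rpow_natCast, ← Real.rpow_mul hq0.le, Real.sqrt_eq_rpow, ← Real.rpow_add hq0]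
    congr 1
    field_simp
    ring
  -- The two bounds of the integrand are of the same order at `σ = q ^ (-1 / n)`.
  refine (smallScale_le_add (s := q ^ (-(1 / n : ℝ))) (by positivity)
    (Real.rpow_le_one_of_one_le_of_nonpos hq (by rw [neg_nonpos]; positivity))).trans ?_
  rw [add_mul, ENNReal.ofReal_add (by positivity) (by positivity)]
  refine add_le_add (ENNReal.ofReal_le_ofReal ?_) (ENNReal.ofReal_le_ofReal (hint q hq))
  calc _ = √c * ((q ^ (-(1 / n : ℝ))) ^ (k + 1) * √q) := by
        rw [Real.sqrt_mul hc]
        ring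
    _ ≤ √c * (3 * kappa n (k + 1) q) := by
        rw [splitting_value]
        gcongr
        exact rpow_le_three_mul_kappa hq (Nat.le_add_left 1 k) hge
    _ = _ := by ring

end Kappa

section Kernels

variable {k : ℕ} {θ : V → ℝ} {Ω : Set V} {M R : ℝ}

/-- The integrand at the scale `t` of the kernel `G_{n-k}(y, x)` on the `n`-dimensional space `V`,
with the argument `x + t (y - x)` of `θ` rewritten as in `scalePairing`. -/
def sliceKernel (k : ℕ) (θ : V → ℝ) (t : ℝ) (x y : V) : ℝ :=
  (t - 1) ^ k * t ^ (finrank ℝ V - k - 1) * θ (t • y - (t - 1) • x)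

/-- The kernel `G_{n-k}(y, x)` on the `n`-dimensional space `V`. -/
def scaleKernel (k : ℕ) (θ : V → ℝ) (x y : V) : ℝ :=
  ∫ t in Set.Ioi 1, sliceKernel k θ t x y

/-- A kernel which, up to a constant, dominates `|G_{n-k}(y, x)| |x - y|` for `x` in a bounded set:
`x - y` is of order `1 / t` where the integrand at the scale `t` does not vanish. -/
def absKernel (k : ℕ) (θ : V → ℝ) (x y : V) : ℝ≥0∞ :=
  ∫⁻ t in Set.Ioi 1,
    ENNReal.ofReal (scaleWeight (finrank ℝ V) k t) * ‖θ (t • y - (t - 1) • x)‖ₑ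

omit [FiniteDimensional ℝ V] [MeasurableSpace V] [BorelSpace V] in
theorem continuous_sliceKernel (hθ : Continuous θ) :
    Continuous fun p : (V × V) × ℝ => sliceKernel k θ p.2 p.1.1 p.1.2 := by
  unfold sliceKernel
  fun_prop

theorem measurable_scaleKernel (hθ : Continuous θ) : Measurable (scaleKernel k θ).uncurry :=
  (continuous_sliceKernel hθ).stronglyMeasurable.integral_prod_right'.measurable

theorem measurable_absKernel (hθ : Measurable θ) : Measurable (absKernel k θ).uncurry := by
  refine Measurable.lintegral_prod_right' (f := fun p : (V × V) × ℝ =>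
    ENNReal.ofReal (scaleWeight (finrank ℝ V) k p.2) * ‖θ (p.2 • p.1.2 - (p.2 - 1) • p.1.1)‖ₑ) ?_
  fun_prop

omit [FiniteDimensional ℝ V] [MeasurableSpace V] [BorelSpace V] in
theorem enorm_sliceKernel_mul_le {t : ℝ} (ht : 1 < t) {x : V} (hR : ∀ a, θ a ≠ 0 → ‖x - a‖ ≤ R)
    (y : V) : ‖sliceKernel k θ t x y‖ₑ * ‖x - y‖ₑ ≤ ENNReal.ofReal R *
      (ENNReal.ofReal (scaleWeight (finrank ℝ V) k t) * ‖θ (t • y - (t - 1) • x)‖ₑ) := by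
  have ht0 : 0 < t := one_pos.trans ht
  have : 0 < t - 1 := sub_pos.2 ht
  set a := t • y - (t - 1) • x with ha
  by_cases h0 : θ a = 0
  · simp [sliceKernel, ← ha, h0]
  have scaled_difference : t • (x - y) = x - a := by
    rw [ha]
    module
  have h1 : t * ‖x - y‖ ≤ R := by
    rw [← Real.norm_of_nonneg ht0.le, ← norm_smul, scaled_difference]
    exact hR a h0
  have h2 : 0 ≤ R := le_trans (by positivity) h1
  have h3 : ‖x - y‖ ≤ R / t := by rwa [le_div_iff₀ ht0, mul_comm]
  simp only [← ofReal_norm]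
  rw [← ENNReal.ofReal_mul (by positivity), ← ENNReal.ofReal_mul (scaleWeight_nonneg ht),
    ← ENNReal.ofReal_mul h2, sliceKernel, ← ha, norm_mul, Real.norm_of_nonneg (by positivity),
    scaleWeight]
  refine ENNReal.ofReal_le_ofReal ?_
  calc _ ≤ (t - 1) ^ k * t ^ (finrank ℝ V - k - 1) * ‖θ a‖ * (R / t) := by gcongr
    _ = _ := by ring

omit [FiniteDimensional ℝ V] [MeasurableSpace V] [BorelSpace V] in
theorem lintegral_enorm_sliceKernel_mul_le {x : V} (hR : ∀ a, θ a ≠ 0 → ‖x - a‖ ≤ R) (y : V) :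
    (∫⁻ t in Set.Ioi 1, ‖sliceKernel k θ t x y‖ₑ) * ‖x - y‖ₑ ≤
      ENNReal.ofReal R * absKernel k θ x y := by
  rw [absKernel, ← lintegral_mul_const' _ _ enorm_ne_top,
    ← lintegral_const_mul' _ _ ENNReal.ofReal_ne_top]
  exact setLIntegral_mono' measurableSet_Ioi fun t ht => enorm_sliceKernel_mul_le ht hR y

theorem lintegral_absKernel_right_le (hk : k + 1 ≤ finrank ℝ V) (hθ : Measurable θ) (x : V) :
    ∫⁻ y, absKernel k θ x y ≤ ∫⁻ a, ‖θ a‖ₑ := by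
  unfold absKernel
  rw [lintegral_lintegral_swap (by fun_prop)]
  calc _ ≤ ∫⁻ t in Set.Ioi (1 : ℝ), ENNReal.ofReal (t ^ 2)⁻¹ * ∫⁻ a, ‖θ a‖ₑ := by
        refine setLIntegral_mono' measurableSet_Ioi fun t (ht : 1 < t) => ?_
        rw [lintegral_const_mul' _ _ ENNReal.ofReal_ne_top,
          lintegral_enorm_comp_smul_sub hθ (one_pos.trans ht), ← mul_assoc,
          ← ENNReal.ofReal_mul (scaleWeight_nonneg ht)]
        gcongr
        exact scaleWeight_mul_inv_pow_le hk ht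
    _ = _ := by
        rw [lintegral_mul_const _ (by fun_prop), lintegral_Ioi_inv_sq one_pos, inv_one,
          ENNReal.ofReal_one, one_mul]

theorem lintegral_absKernel_left_le (hk : k + 1 ≤ finrank ℝ V) (hθ : Measurable θ)
    (hM : ∀ a, ‖θ a‖ ≤ M) (hΩ : volume Ω ≠ ⊤) (y : V) :
    ∫⁻ x in Ω, absKernel k θ x y ≤ ENNReal.ofReal (2 ^ finrank ℝ V) *
      (ENNReal.ofReal (M * volume.real Ω) + ∫⁻ a, ‖θ a‖ₑ) := by
  set d := finrank ℝ V
  set I := ∫⁻ a, ‖θ a‖ₑ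
  unfold absKernel
  rw [lintegral_lintegral_swap (by fun_prop), lintegral_Ioi_one_eq_add, mul_add]
  simp only [lintegral_const_mul' _ _ ENNReal.ofReal_ne_top]
  gcongr
  · calc _ ≤ ∫⁻ _ in Set.Ioc (1 : ℝ) 2,
          ENNReal.ofReal (2 ^ d) * ENNReal.ofReal (M * volume.real Ω) := by
          refine setLIntegral_mono' measurableSet_Ioc fun _ ht => ?_
          gcongr
          · exact (scaleWeight_le_of_le_two ht.1 ht.2).trans (mul_le_of_le_one_right (by positivity)
              (pow_le_one₀ (by linarith [ht.1]) (by linarith [ht.2])))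
          · exact setLIntegral_enorm_le_of_norm_le hΩ fun x => hM _
      _ = _ := by
          rw [setLIntegral_const]
          norm_num
  · calc _ ≤ ∫⁻ t in Set.Ioi (2 : ℝ),
          ENNReal.ofReal (2 ^ d) * (ENNReal.ofReal (t ^ 2)⁻¹ * I) := by
          refine setLIntegral_mono' measurableSet_Ioi fun t (ht : 2 < t) => ?_
          have ht1 : 1 < t := one_lt_two.trans ht
          refine (mul_le_mul_right (setLIntegral_le_lintegral _ _) _).trans ?_
          rw [lintegral_enorm_comp_sub_smul hθ (sub_pos.2 ht1), ← mul_assoc, ← mul_assoc,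
            ← ENNReal.ofReal_mul (scaleWeight_nonneg ht1), ← ENNReal.ofReal_mul (by positivity)]
          refine mul_le_mul_left (ENNReal.ofReal_le_ofReal ?_) _
          calc _ ≤ scaleWeight d k t * (2 ^ d * (t ^ d)⁻¹) :=
                mul_le_mul_of_nonneg_left (inv_pow_le_two_pow_mul_inv_pow d (by linarith)
                  (by linarith) (by linarith)) (scaleWeight_nonneg ht1)
            _ = 2 ^ d * (scaleWeight d k t * (t ^ d)⁻¹) := by ring
            _ ≤ _ := by
                gcongr
                exact scaleWeight_mul_inv_pow_le hk ht1
      _ ≤ ENNReal.ofReal (2 ^ d) * (1 * I) := by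
          rw [lintegral_const_mul' _ _ ENNReal.ofReal_ne_top, lintegral_mul_const _ (by fun_prop)]
          gcongr
          exact lintegral_Ioi_two_inv_sq_le
      _ = _ := by rw [one_mul]

theorem lintegral_absKernel_mul_ne_top (hk : k + 1 ≤ finrank ℝ V) (hθ : Continuous θ)
    (hθc : HasCompactSupport θ) (hΩ : volume Ω ≠ ⊤) {h : V → ℝ≥0∞} (hh : Measurable h)
    (hh_top : ∫⁻ y, h y ≠ ⊤) : ∫⁻ x in Ω, ∫⁻ y, absKernel k θ x y * h y ≠ ⊤ := by
  obtain ⟨M, hM⟩ := hθ.bounded_above_of_compact_support hθc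
  have hK := measurable_absKernel (k := k) hθ.measurable
  rw [lintegral_lintegral_swap (hK.mul (hh.comp measurable_snd)).aemeasurable]
  simp only [lintegral_mul_const _ hK.of_uncurry_right]
  refine ne_top_of_le_ne_top ?_ (lintegral_mono fun y => mul_le_mul_left
    (lintegral_absKernel_left_le hk hθ.measurable hM hΩ y) _)
  rw [lintegral_const_mul _ hh]
  exact ENNReal.mul_ne_top (ENNReal.mul_ne_top ENNReal.ofReal_ne_top (ENNReal.add_ne_top.2
    ⟨ENNReal.ofReal_ne_top, (hθ.integrable_of_hasCompactSupport hθc).2.ne⟩)) hh_top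

end Kernels

section ScalarOperator

variable {k : ℕ} {θ v : V → ℝ} {L : V →L[ℝ] ℝ} {Ω : Set V}

/-- The scalar operator `v ↦ ∫ G_{n-k}(y, x) L(x - y) v(y) dy`; with `L` a coordinate functional,
the coefficients of the Poincaré operator are signed sums of such operators. -/
def scalarOp (k : ℕ) (θ : V → ℝ) (L : V →L[ℝ] ℝ) (v : V → ℝ) (x : V) : ℝ :=
  ∫ y, scaleKernel k θ x y * L (x - y) * v y

theorem measurable_scaleKernel_mul_mul (hθ : Continuous θ) (hv : Measurable v) :
    Measurable fun p : V × V => scaleKernel k θ p.1 p.2 * L (p.1 - p.2) * v p.2 :=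
  ((measurable_scaleKernel hθ).mul (by fun_prop)).mul (by fun_prop)

omit [InnerProductSpace ℝ V] [FiniteDimensional ℝ V] [MeasurableSpace V] [BorelSpace V] in
theorem exists_norm_sub_le (hθc : HasCompactSupport θ) (hΩ : Bornology.IsBounded Ω) :
    ∃ R, ∀ x ∈ Ω, ∀ a, θ a ≠ 0 → ‖x - a‖ ≤ R := by
  obtain ⟨R, hR⟩ := (hΩ.sub hθc.isBounded).exists_norm_le
  exact ⟨R, fun x hx a ha => hR _ (Set.sub_mem_sub hx (subset_tsupport _ ha))⟩

omit [FiniteDimensional ℝ V] [MeasurableSpace V] [BorelSpace V] in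
theorem enorm_scaleKernel_mul_mul_le {R : ℝ} {x : V} (hR : ∀ a, θ a ≠ 0 → ‖x - a‖ ≤ R) (y : V) :
    ‖scaleKernel k θ x y * L (x - y) * v y‖ₑ ≤
      ‖L‖ₑ * ENNReal.ofReal R * (absKernel k θ x y * ‖v y‖ₑ) := by
  rw [enorm_mul, enorm_mul, ← mul_assoc]
  refine mul_le_mul_left ?_ _
  calc _ ≤ (∫⁻ t in Set.Ioi 1, ‖sliceKernel k θ t x y‖ₑ) * (‖L‖ₑ * ‖x - y‖ₑ) := by
        gcongr
        · exact enorm_integral_le_lintegral_enorm _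
        · exact L.le_opENorm _
    _ = ‖L‖ₑ * ((∫⁻ t in Set.Ioi 1, ‖sliceKernel k θ t x y‖ₑ) * ‖x - y‖ₑ) := by ring
    _ ≤ _ := by
        rw [mul_assoc ‖L‖ₑ]
        exact mul_le_mul_right (lintegral_enorm_sliceKernel_mul_le hR y) _

theorem ae_integrable_scaleKernel_mul_mul (hk : k + 1 ≤ finrank ℝ V) (hθ : Continuous θ)
    (hθc : HasCompactSupport θ) (hΩ : MeasurableSet Ω) (hΩb : Bornology.IsBounded Ω)
    (L : V →L[ℝ] ℝ) (hv : Measurable v) (hvi : Integrable v) :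
    ∀ᵐ x ∂volume.restrict Ω, Integrable fun y => scaleKernel k θ x y * L (x - y) * v y := by
  obtain ⟨R, hR⟩ := exists_norm_sub_le hθc hΩb
  have finite := lintegral_absKernel_mul_ne_top hk hθ hθc hΩb.measure_lt_top.ne hv.enorm hvi.2.ne
  have hK : Measurable fun p : V × V => absKernel k θ p.1 p.2 * ‖v p.2‖ₑ :=
    (measurable_absKernel hθ.measurable).mul (by fun_prop)
  filter_upwards [ae_lt_top hK.lintegral_prod_right' finite, ae_restrict_mem hΩ] with x hx hxΩ
  refine ⟨((measurable_scaleKernel_mul_mul hθ hv).comp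
    measurable_prodMk_left).aestronglyMeasurable, ?_⟩
  refine (lintegral_mono fun y => enorm_scaleKernel_mul_mul_le (hR x hxΩ) y).trans_lt ?_
  rw [lintegral_const_mul' _ _ (ENNReal.mul_ne_top enorm_ne_top ENNReal.ofReal_ne_top)]
  exact ENNReal.mul_lt_top (ENNReal.mul_lt_top enorm_lt_top ENNReal.ofReal_lt_top) hx

theorem memLp_scalarOp (hk : k + 1 ≤ finrank ℝ V) (hθ : Continuous θ) (hθc : HasCompactSupport θ)
    (hΩ : MeasurableSet Ω) (hΩb : Bornology.IsBounded Ω) (L : V →L[ℝ] ℝ) (hv : Measurable v)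
    (hv2 : MemLp v 2) : MemLp (scalarOp k θ L v) 2 (volume.restrict Ω) := by
  obtain ⟨R, hR⟩ := exists_norm_sub_le hθc hΩb
  obtain ⟨M, hM⟩ := hθ.bounded_above_of_compact_support hθc
  have hθm := hθ.measurable
  have hK : Measurable (absKernel k θ).uncurry := measurable_absKernel hθm
  have schur := lintegral_sq_lintegral_mul_le_of_schur (μ := volume.restrict Ω) hK hv.enorm
    (.of_forall (lintegral_absKernel_right_le hk hθm))
    (.of_forall (lintegral_absKernel_left_le hk hθm hM hΩb.measure_lt_top.ne))
  set c := ‖L‖ₑ * ENNReal.ofReal R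
  have hc : c ≠ ⊤ := ENNReal.mul_ne_top enorm_ne_top ENNReal.ofReal_ne_top
  have pointwise (x : V) (hx : x ∈ Ω) :
      ‖scalarOp k θ L v x‖ₑ ^ 2 ≤ c ^ 2 * (∫⁻ y, absKernel k θ x y * ‖v y‖ₑ) ^ 2 := by
    rw [← mul_pow, ← lintegral_const_mul' _ _ hc]
    gcongr
    exact (enorm_integral_le_lintegral_enorm _).trans
      (lintegral_mono fun y => enorm_scaleKernel_mul_mul_le (hR x hx) y)
  have hv_sq : ∫⁻ y, ‖v y‖ₑ ^ 2 ≠ ⊤ := by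
    rw [← rpow_half_sq (∫⁻ y, ‖v y‖ₑ ^ 2), ← eLpNorm_two_eq_lintegral]
    exact ENNReal.pow_ne_top hv2.2.ne
  have hθ_fin : ∫⁻ a, ‖θ a‖ₑ ≠ ⊤ := (hθ.integrable_of_hasCompactSupport hθc).2.ne
  refine ⟨(measurable_scaleKernel_mul_mul hθ hv).stronglyMeasurable.integral_prod_right'
    |>.aestronglyMeasurable, ?_⟩
  rw [eLpNorm_two_eq_lintegral]
  refine ENNReal.rpow_lt_top_of_nonneg (by norm_num) (ne_top_of_le_ne_top ?_
    ((setLIntegral_mono' hΩ pointwise).trans_eq (lintegral_const_mul' _ _ (by finiteness))))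
  exact ENNReal.mul_ne_top (by finiteness) (ne_top_of_le_ne_top (by finiteness) schur)

theorem integrable_sliceKernel_prod (hk : k + 1 ≤ finrank ℝ V) (hθ : Continuous θ)
    (hθc : HasCompactSupport θ) (hΩ : MeasurableSet Ω) (hΩb : Bornology.IsBounded Ω)
    (L : V →L[ℝ] ℝ) (hv : Measurable v) (hvi : Integrable v) {ψ : V → ℝ} (hψ : Measurable ψ)
    {B : ℝ} (hB : ∀ x, ‖ψ x‖ ≤ B) :
    Integrable (fun q : (V × V) × ℝ =>
        sliceKernel k θ q.2 q.1.1 q.1.2 * L (q.1.1 - q.1.2) * v q.1.2 * ψ q.1.1)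
      (((volume.restrict Ω).prod volume).prod (volume.restrict (Set.Ioi 1))) := by
  obtain ⟨R, hR⟩ := exists_norm_sub_le hθc hΩb
  have finite := lintegral_absKernel_mul_ne_top hk hθ hθc hΩb.measure_lt_top.ne hv.enorm hvi.2.ne
  have hm : Measurable fun q : (V × V) × ℝ =>
      sliceKernel k θ q.2 q.1.1 q.1.2 * L (q.1.1 - q.1.2) * v q.1.2 * ψ q.1.1 :=
    (((continuous_sliceKernel hθ).measurable.mul (by fun_prop)).mul (by fun_prop)).mul
      (by fun_prop)
  refine ⟨hm.aestronglyMeasurable, ?_⟩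
  rw [HasFiniteIntegral, lintegral_prod _ hm.enorm.aemeasurable,
    lintegral_prod _ hm.enorm.lintegral_prod_right'.aemeasurable]
  set c := ‖L‖ₑ * ENNReal.ofReal R * ENNReal.ofReal B
  have hc : c ≠ ⊤ := by finiteness
  have pointwise (x : V) (hx : x ∈ Ω) (y : V) :
      ∫⁻ t in Set.Ioi (1 : ℝ), ‖sliceKernel k θ t x y * L (x - y) * v y * ψ x‖ₑ ≤
        c * (absKernel k θ x y * ‖v y‖ₑ) := by
    have hBx : ‖ψ x‖ₑ ≤ ENNReal.ofReal B := by
      rw [← ofReal_norm]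
      exact ENNReal.ofReal_le_ofReal (hB x)
    simp only [enorm_mul, mul_assoc, lintegral_mul_const' _ _ (by finiteness :
      ‖L (x - y)‖ₑ * (‖v y‖ₑ * ‖ψ x‖ₑ) ≠ ⊤)]
    calc _ ≤ (∫⁻ t in Set.Ioi 1, ‖sliceKernel k θ t x y‖ₑ) *
          (‖L‖ₑ * ‖x - y‖ₑ * (‖v y‖ₑ * ENNReal.ofReal B)) := by
          gcongr
          exact L.le_opENorm _
      _ = ‖L‖ₑ * ENNReal.ofReal B *
          ((∫⁻ t in Set.Ioi 1, ‖sliceKernel k θ t x y‖ₑ) * ‖x - y‖ₑ) * ‖v y‖ₑ := by ring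
      _ ≤ ‖L‖ₑ * ENNReal.ofReal B * (ENNReal.ofReal R * absKernel k θ x y) * ‖v y‖ₑ := by
          gcongr ?_ * ?_ * _
          · exact le_rfl
          · exact lintegral_enorm_sliceKernel_mul_le (hR x hx) y
      _ = _ := by ring
  refine (setLIntegral_mono' hΩ fun x hx => lintegral_mono (pointwise x hx)).trans_lt ?_
  simp only [lintegral_const_mul' _ _ hc]
  exact ENNReal.mul_lt_top hc.lt_top finite.lt_top

theorem setIntegral_scalarOp_mul (hk : k + 1 ≤ finrank ℝ V) (hθ : Continuous θ)
    (hθc : HasCompactSupport θ) (hΩ : MeasurableSet Ω) (hΩb : Bornology.IsBounded Ω)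
    (L : V →L[ℝ] ℝ) (hv : Measurable v) (hvi : Integrable v) {ψ : V → ℝ} (hψ : Measurable ψ)
    {B : ℝ} (hB : ∀ x, ‖ψ x‖ ≤ B) (hψΩ : ∀ x ∉ Ω, ψ x = 0) :
    ∫ x in Ω, scalarOp k θ L v x * ψ x =
      ∫ t in Set.Ioi (1 : ℝ), (t - 1) ^ k * t ^ (finrank ℝ V - k - 1) *
        ∫ p : V × V, ψ p.1 * (L (p.1 - p.2) * v p.2 * θ (t • p.2 - (t - 1) • p.1)) := by
  have hF := integrable_sliceKernel_prod hk hθ hθc hΩ hΩb L hv hvi hψ hB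
  calc _ = ∫ x in Ω, ∫ y, ∫ t in Set.Ioi (1 : ℝ),
          sliceKernel k θ t x y * L (x - y) * v y * ψ x := by
        simp only [scalarOp, scaleKernel, ← integral_mul_const, mul_assoc]
    _ = ∫ p, (∫ t in Set.Ioi (1 : ℝ),
          sliceKernel k θ t p.1 p.2 * L (p.1 - p.2) * v p.2 * ψ p.1)
          ∂((volume.restrict Ω).prod volume) := (integral_prod _ hF.integral_prod_left).symm
    _ = ∫ t in Set.Ioi (1 : ℝ), (∫ p, sliceKernel k θ t p.1 p.2 * L (p.1 - p.2) * v p.2 * ψ p.1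
          ∂((volume.restrict Ω).prod volume)) := integral_integral_swap hF
    _ = _ := by
        refine integral_congr_ae (.of_forall fun t => ?_)
        have restrict_Ω : ∫ p in Ω ×ˢ Set.univ,
              ψ p.1 * (L (p.1 - p.2) * v p.2 * θ (t • p.2 - (t - 1) • p.1)) =
            ∫ p : V × V, ψ p.1 * (L (p.1 - p.2) * v p.2 * θ (t • p.2 - (t - 1) • p.1)) :=
          setIntegral_eq_integral_of_forall_compl_eq_zero fun p hp => by
            rw [hψΩ p.1 fun h => hp ⟨h, trivial⟩, zero_mul]
        dsimp only
        rw [← restrict_Ω, Measure.volume_eq_prod, ← Measure.prod_restrict, Measure.restrict_univ,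
          ← integral_const_mul]
        refine integral_congr_ae (.of_forall fun p => ?_)
        simp only [sliceKernel]
        ring

end ScalarOperator

section IntegrationByParts

variable {f φ v : V → ℝ}

theorem integrable_scalePairing (hf : Continuous f) (hfc : HasCompactSupport f)
    (hφ : Integrable φ) (hv : Integrable v) (t : ℝ) :
    Integrable fun p : V × V => φ p.1 * v p.2 * f (t • p.2 - (t - 1) • p.1) := by
  obtain ⟨B, hB⟩ := hf.bounded_above_of_compact_support hfc
  exact (hφ.mul_prod hv).mul_bdd (c := B) (by fun_prop) (.of_forall fun p => hB _)

theorem measurable_scalePairing (hf : Continuous f) (hφ : Measurable φ) (hv : Measurable v) :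
    Measurable (scalePairing f φ v) := by
  have hF : Measurable fun q : ℝ × (V × V) =>
      φ q.2.1 * v q.2.2 * f (q.1 • q.2.2 - (q.1 - 1) • q.2.1) :=
    Measurable.mul (by fun_prop) (hf.measurable.comp (Continuous.measurable (by fun_prop)))
  exact hF.stronglyMeasurable.integral_prod_right'.measurable

omit [FiniteDimensional ℝ V] [MeasurableSpace V] [BorelSpace V] in
theorem contDiff_fderiv_apply (hf : ContDiff ℝ ∞ f) (m : V) :
    ContDiff ℝ ∞ fun x => fderiv ℝ f x m :=
  (hf.fderiv_right (by simp)).clm_apply contDiff_const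

omit [FiniteDimensional ℝ V] [MeasurableSpace V] [BorelSpace V] in
theorem fderiv_comp_sub_smul (hf : ContDiff ℝ ∞ f) (a : V) (s : ℝ) (x m : V) :
    fderiv ℝ (fun x => f (a - s • x)) x m = -(s * fderiv ℝ f (a - s • x) m) := by
  have inner : HasFDerivAt (fun x : V => a - s • x) (-(s • ContinuousLinearMap.id ℝ V)) x :=
    ((hasFDerivAt_id x).const_smul s).const_sub a
  have outer := (hf.differentiable (by simp) (a - s • x)).hasFDerivAt
  rw [show fderiv ℝ (fun x => f (a - s • x)) x = _ from (outer.comp x inner).fderiv]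
  simp

theorem integral_fderiv_mul_comp_sub_smul (hf : ContDiff ℝ ∞ f) (hφ : ContDiff ℝ ∞ φ)
    (hφc : HasCompactSupport φ) (a : V) (s : ℝ) (m : V) :
    ∫ x, fderiv ℝ φ x m * f (a - s • x) = s * ∫ x, φ x * fderiv ℝ f (a - s • x) m := by
  have hφ' := contDiff_fderiv_apply hφ m
  have hφc' : HasCompactSupport fun x => fderiv ℝ φ x m := hφc.fderiv_apply (𝕜 := ℝ) _
  set g : V → ℝ := fun x => f (a - s • x)
  have hg : ContDiff ℝ ∞ g := hf.comp (by fun_prop)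
  have hg' := contDiff_fderiv_apply hg m
  have parts := integral_mul_fderiv_eq_neg_fderiv_mul_of_integrable (μ := volume) (f := g)
    (g := φ) (v := m)
    ((hg'.continuous.mul hφ.continuous).integrable_of_hasCompactSupport hφc.mul_left)
    ((hg.continuous.mul hφ'.continuous).integrable_of_hasCompactSupport hφc'.mul_left)
    ((hg.continuous.mul hφ.continuous).integrable_of_hasCompactSupport hφc.mul_left)
    (fun x _ => hg.differentiable (by simp) x) (fun x _ => hφ.differentiable (by simp) x)
  simp only [g, fderiv_comp_sub_smul hf] at parts
  simp_rw [mul_comm (fderiv ℝ φ _ m)]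
  rw [parts, ← integral_neg, ← integral_const_mul]
  congr! 2
  ring

theorem scalePairing_fderiv (hf : ContDiff ℝ ∞ f) (hfc : HasCompactSupport f)
    (hφ : ContDiff ℝ ∞ φ) (hφc : HasCompactSupport φ) (hv : Integrable v) (m : V) (t : ℝ) :
    scalePairing f (fun x => fderiv ℝ φ x m) v t =
      (t - 1) * scalePairing (fun x => fderiv ℝ f x m) φ v t := by
  have hφ' : Integrable fun x => fderiv ℝ φ x m :=
    (contDiff_fderiv_apply hφ m).continuous.integrable_of_hasCompactSupport
      (hφc.fderiv_apply (𝕜 := ℝ) _)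
  have integrable_left := integrable_scalePairing hf.continuous hfc hφ' hv t
  have integrable_right := integrable_scalePairing (contDiff_fderiv_apply hf m).continuous
    (hfc.fderiv_apply (𝕜 := ℝ) _) (hφ.continuous.integrable_of_hasCompactSupport hφc) hv t
  unfold scalePairing
  rw [Measure.volume_eq_prod, integral_prod_symm _ integrable_left,
    integral_prod_symm _ integrable_right, ← integral_const_mul]
  refine integral_congr_ae (.of_forall fun y => ?_)
  have parts := integral_fderiv_mul_comp_sub_smul hf hφ hφc (t • y) (t - 1) m
  simp_rw [mul_comm _ (v y), mul_assoc, integral_const_mul, parts]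
  ring

section Functional

variable (L : V →L[ℝ] ℝ) (c : V)

omit [FiniteDimensional ℝ V] [MeasurableSpace V] [BorelSpace V] in
theorem contDiff_mul_functional (hf : ContDiff ℝ ∞ f) :
    ContDiff ℝ ∞ fun z => f z * L (z - c) :=
  hf.mul (L.contDiff.comp (contDiff_id.sub contDiff_const))

omit [FiniteDimensional ℝ V] [MeasurableSpace V] [BorelSpace V] in
theorem fderiv_mul_functional (hf : ContDiff ℝ ∞ f) (x m : V) :
    fderiv ℝ (fun z => f z * L (z - c)) x m = fderiv ℝ f x m * L (x - c) + L m * f x := by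
  have hL : HasFDerivAt (fun z => L (z - c)) L x :=
    L.hasFDerivAt.comp x ((hasFDerivAt_id x).sub_const c)
  rw [show fderiv ℝ (fun z => f z * L (z - c)) x = _ from
    ((hf.differentiable (by simp) x).hasFDerivAt.mul hL).fderiv]
  simp
  ring

/- With `a = t y - (t - 1) x` one has `t (x - y) = (x - c) - (a - c)`: the factor `L (x - y)` is
split between the test function and the bump before the derivative is moved. -/
theorem mul_integral_fderiv_mul_eq {θ : V → ℝ} (hθ : ContDiff ℝ ∞ θ) (hθc : HasCompactSupport θ)
    (hφ : ContDiff ℝ ∞ φ) (hφc : HasCompactSupport φ) (hv : Integrable v) (m : V) (t : ℝ) :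
    t * ∫ p : V × V,
        fderiv ℝ φ p.1 m * (L (p.1 - p.2) * v p.2 * θ (t • p.2 - (t - 1) • p.1)) =
      (t - 1) * scalePairing (fun x => fderiv ℝ θ x m) (fun x => φ x * L (x - c)) v t -
        L m * scalePairing θ φ v t -
        (t - 1) * scalePairing (fun x => fderiv ℝ (fun z => θ z * L (z - c)) x m) φ v t := by
  have hφL := contDiff_mul_functional L c hφ
  have hφLc : HasCompactSupport fun x => φ x * L (x - c) := hφc.mul_right
  have hθL := contDiff_mul_functional L c hθ
  have hθLc : HasCompactSupport fun x => θ x * L (x - c) := hθc.mul_right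
  rw [← scalePairing_fderiv hθ hθc hφL hφLc hv, ← scalePairing_fderiv hθL hθLc hφ hφc hv]
  have pairing_φL := integrable_scalePairing hθ.continuous hθc
    ((contDiff_fderiv_apply hφL m).continuous.integrable_of_hasCompactSupport
      (hφLc.fderiv_apply (𝕜 := ℝ) _)) hv t
  have pairing_φ := (integrable_scalePairing hθ.continuous hθc
    (hφ.continuous.integrable_of_hasCompactSupport hφc) hv t).const_mul (L m)
  have pairing_θL := integrable_scalePairing hθL.continuous hθLc
    ((contDiff_fderiv_apply hφ m).continuous.integrable_of_hasCompactSupport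
      (hφc.fderiv_apply (𝕜 := ℝ) _)) hv t
  unfold scalePairing
  rw [← integral_const_mul, ← integral_const_mul, ← integral_sub pairing_φL pairing_φ,
    ← integral_sub (by exact pairing_φL.sub pairing_φ) pairing_θL]
  congr! 2
  rw [fderiv_mul_functional L c hφ]
  simp only [map_sub, map_smul, smul_eq_mul]
  ring

end Functional

end IntegrationByParts

section ProductWithFunctional

variable (L : V →L[ℝ] ℝ) (c : V)

omit [FiniteDimensional ℝ V] [MeasurableSpace V] [BorelSpace V] in
theorem fderiv_functional_sub : fderiv ℝ (fun z => L (z - c)) = fun _ => L := by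
  funext x
  exact (L.hasFDerivAt.comp x ((hasFDerivAt_id x).sub_const c)).fderiv

omit [FiniteDimensional ℝ V] [MeasurableSpace V] [BorelSpace V] in
theorem norm_iteratedFDeriv_mul_functional_le {f : V → ℝ} (hf : ContDiff ℝ ∞ f) (k : ℕ) (x : V) :
    ‖iteratedFDeriv ℝ k (fun z => f z * L (z - c)) x‖ ≤
      ‖iteratedFDeriv ℝ k f x‖ * ‖L (x - c)‖ + k * ‖iteratedFDeriv ℝ (k - 1) f x‖ * ‖L‖ := by
  have hL : ContDiff ℝ ∞ fun z => L (z - c) := L.contDiff.comp (contDiff_id.sub contDiff_const)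
  have higher (j : ℕ) : iteratedFDeriv ℝ (j + 2) (fun z => L (z - c)) x = 0 := by
    rw [← norm_eq_zero, ← norm_iteratedFDeriv_fderiv, fderiv_functional_sub,
      iteratedFDeriv_succ_const, Pi.zero_apply, norm_zero]
  refine (norm_iteratedFDeriv_mul_le hf hL x (mod_cast le_top)).trans_eq ?_
  obtain _ | k := k
  · simp
  rw [Finset.sum_range_succ, Finset.sum_range_succ, Finset.sum_eq_zero, zero_add, add_comm]
  · rw [Nat.sub_self, Nat.add_sub_cancel_left, norm_iteratedFDeriv_one, fderiv_functional_sub]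
    simp
  · intro i hi
    obtain ⟨j, rfl⟩ := Nat.exists_eq_add_of_lt (Finset.mem_range.1 hi)
    rw [show i + j + 1 + 1 - i = j + 2 by omega, higher, norm_zero, mul_zero]

end ProductWithFunctional

/-- `θ` is a smooth function supported in the closed ball with centre `c` and radius `ρ`, whose
derivatives have, up to the factor `M`, the size of those of an `L¹`-normalized bump at scale `ρ`.
Only the orders that enter the estimates are controlled, and derivatives are measured as multilinear
maps, which makes the notion independent of coordinates. -/
structure IsScaledBump (M : ℝ) (c : V) (ρ : ℝ) (θ : V → ℝ) : Prop where
  radius_pos : 0 < ρ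
  contDiff : ContDiff ℝ ∞ θ
  tsupport_subset : tsupport θ ⊆ Metric.closedBall c ρ
  integral_le : ∀ k ≤ 2, ∫ x, ‖iteratedFDeriv ℝ k θ x‖ ≤ M / ρ ^ k
  norm_le : ∀ k ≤ 1, ∀ x, ‖iteratedFDeriv ℝ k θ x‖ ≤ M / ρ ^ (finrank ℝ V + k)

namespace IsScaledBump

variable {M ρ : ℝ} {c : V} {θ : V → ℝ}

theorem nonneg (h : IsScaledBump M c ρ θ) : 0 ≤ M := by
  simpa using (integral_nonneg fun x => norm_nonneg _).trans (h.integral_le 0 (by omega))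

theorem hasCompactSupport (h : IsScaledBump M c ρ θ) : HasCompactSupport θ :=
  (isCompact_closedBall c ρ).of_isClosed_subset (isClosed_tsupport θ) h.tsupport_subset

theorem integrable (h : IsScaledBump M c ρ θ) : Integrable θ :=
  h.contDiff.continuous.integrable_of_hasCompactSupport h.hasCompactSupport

theorem integrable_norm_iteratedFDeriv (h : IsScaledBump M c ρ θ) (k : ℕ) :
    Integrable fun x => ‖iteratedFDeriv ℝ k θ x‖ :=
  ((h.contDiff.continuous_iteratedFDeriv (mod_cast le_top)).integrable_of_hasCompactSupport
    (h.hasCompactSupport.iteratedFDeriv k)).norm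

theorem norm_iteratedFDeriv_mul_functional_le (h : IsScaledBump M c ρ θ) (L : V →L[ℝ] ℝ) (k : ℕ)
    (x : V) : ‖iteratedFDeriv ℝ k (fun z => θ z * L (z - c)) x‖ ≤
      ‖L‖ * (ρ * ‖iteratedFDeriv ℝ k θ x‖ + k * ‖iteratedFDeriv ℝ (k - 1) θ x‖) := by
  have hL : ‖iteratedFDeriv ℝ k θ x‖ * ‖L (x - c)‖ ≤ ‖iteratedFDeriv ℝ k θ x‖ * (‖L‖ * ρ) := by
    by_cases hx : iteratedFDeriv ℝ k θ x = 0
    · simp [hx]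
    · have := h.tsupport_subset (support_iteratedFDeriv_subset k hx)
      gcongr
      exact L.le_opNorm_of_le (mem_closedBall_iff_norm.1 this)
  calc _ ≤ _ := PoincareEstimate.norm_iteratedFDeriv_mul_functional_le L c h.contDiff k x
    _ ≤ _ := add_le_add_left hL _
    _ = _ := by ring

theorem scaled_leibniz_le (hρ : 0 < ρ) (hM : 0 ≤ M) {k e : ℕ} (hk : k ≤ 2) {a b : ℝ}
    (ha : a ≤ M / ρ ^ (e + k)) (hb : b ≤ M / ρ ^ (e + (k - 1))) :
    ρ * a + k * b ≤ 3 * ρ * M / ρ ^ (e + k) := by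
  have hρM : 0 ≤ ρ * (M / ρ ^ (e + k)) := by positivity
  have hkb : k * b ≤ k * (ρ * (M / ρ ^ (e + k))) := by
    obtain _ | k := k
    · simp
    · refine mul_le_mul_of_nonneg_left (hb.trans_eq ?_) (Nat.cast_nonneg _)
      rw [Nat.add_sub_cancel, ← add_assoc, pow_succ]
      field_simp
  have hk' : (k : ℝ) ≤ 2 := by exact_mod_cast hk
  calc _ ≤ ρ * (M / ρ ^ (e + k)) + 2 * (ρ * (M / ρ ^ (e + k))) :=
        add_le_add (by gcongr) (hkb.trans (mul_le_mul_of_nonneg_right hk' hρM))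
    _ = _ := by ring

theorem mul_functional (h : IsScaledBump M c ρ θ) (L : V →L[ℝ] ℝ) :
    IsScaledBump (‖L‖ * (3 * ρ * M)) c ρ fun z => θ z * L (z - c) where
  radius_pos := h.radius_pos
  contDiff := contDiff_mul_functional L c h.contDiff
  tsupport_subset := (tsupport_mul_subset_left).trans h.tsupport_subset
  integral_le k hk := by
    have int_k := (h.integrable_norm_iteratedFDeriv k).const_mul ρ
    have int_pred := (h.integrable_norm_iteratedFDeriv (k - 1)).const_mul (k : ℝ)
    refine (integral_mono_of_nonneg (.of_forall fun x => norm_nonneg _)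
      ((int_k.add int_pred).const_mul ‖L‖)
      (.of_forall (h.norm_iteratedFDeriv_mul_functional_le L k))).trans ?_
    simp only [Pi.add_apply]
    rw [integral_const_mul, integral_add int_k int_pred, integral_const_mul, integral_const_mul,
      mul_div_assoc]
    have := scaled_leibniz_le (e := 0) h.radius_pos h.nonneg hk
      (by simpa using h.integral_le k hk) (by simpa using h.integral_le (k - 1) (by omega))
    gcongr
    simpa using this
  norm_le k hk x := by
    refine (h.norm_iteratedFDeriv_mul_functional_le L k x).trans ?_
    rw [mul_div_assoc]
    gcongr
    exact scaled_leibniz_le h.radius_pos h.nonneg (hk.trans one_le_two) (h.norm_le k hk x)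
      (h.norm_le (k - 1) (by omega) x)

variable (m : V)

theorem integral_norm_fderiv_apply_le (h : IsScaledBump M c ρ θ) :
    ∫ x, ‖fderiv ℝ θ x m‖ ≤ M * ‖m‖ / ρ := by
  calc _ ≤ ∫ x, ‖iteratedFDeriv ℝ 1 θ x‖ * ‖m‖ :=
        integral_mono_of_nonneg (.of_forall fun x => norm_nonneg _)
          ((h.integrable_norm_iteratedFDeriv 1).mul_const _)
          (.of_forall fun x => by
            simpa only [norm_iteratedFDeriv_one] using (fderiv ℝ θ x).le_opNorm m)
    _ ≤ M / ρ ^ 1 * ‖m‖ := by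
        rw [integral_mul_const]
        gcongr
        exact h.integral_le 1 (by omega)
    _ = _ := by ring

theorem norm_fderiv_apply_le (h : IsScaledBump M c ρ θ) (x : V) :
    ‖fderiv ℝ θ x m‖ ≤ M * ‖m‖ / ρ / ρ ^ finrank ℝ V := by
  calc _ ≤ ‖iteratedFDeriv ℝ 1 θ x‖ * ‖m‖ := by
        simpa only [norm_iteratedFDeriv_one] using (fderiv ℝ θ x).le_opNorm m
    _ ≤ M / ρ ^ (finrank ℝ V + 1) * ‖m‖ := by
        gcongr
        exact h.norm_le 1 le_rfl x
    _ = _ := by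
        rw [pow_succ]
        ring

omit [FiniteDimensional ℝ V] [MeasurableSpace V] [BorelSpace V] in
theorem norm_fderiv_fderiv_apply_le {F : Type*} [NormedAddCommGroup F] [NormedSpace ℝ F]
    {f : V → F} (hf : ContDiff ℝ ∞ f) (x : V) :
    ‖fderiv ℝ (fun y => fderiv ℝ f y m) x‖ ≤ ‖m‖ * ‖iteratedFDeriv ℝ 2 f x‖ := by
  have hf' : ContDiff ℝ 1 (fderiv ℝ f) := (contDiff_infty.1 hf 2).fderiv_right (by norm_num)
  rw [← norm_iteratedFDeriv_one, ← norm_iteratedFDeriv_fderiv (n := 1)]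
  exact norm_iteratedFDeriv_clm_apply_const hf'.contDiffAt le_rfl

theorem norm_fourier_fderiv_apply_le (h : IsScaledBump M c ρ θ) (ζ : V) :
    ‖𝓕 (toC fun x => fderiv ℝ θ x m) ζ‖ ≤
      (2 * Real.pi + 1) * (M * ‖m‖ / ρ) * (ρ * ‖ζ‖ / (1 + (ρ * ‖ζ‖) ^ 2)) := by
  have hρ := h.radius_pos
  have hθ : ContDiff ℝ ∞ (toC θ) := Complex.ofRealCLM.contDiff.comp h.contDiff
  have hc : HasCompactSupport (toC θ) := h.hasCompactSupport.comp_left Complex.ofReal_zero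
  have fderiv_toC : (toC fun x => fderiv ℝ θ x m) = fun x => fderiv ℝ (toC θ) x m := by
    funext x
    exact (DFunLike.congr_fun (Complex.ofRealCLM.hasFDerivAt.comp x
      (h.contDiff.differentiable (by simp) x).hasFDerivAt).fderiv m).symm
  have norm_toC (k : ℕ) (x : V) : ‖iteratedFDeriv ℝ k (toC θ) x‖ = ‖iteratedFDeriv ℝ k θ x‖ :=
    Complex.ofRealLI.norm_iteratedFDeriv_comp_left h.contDiff.contDiffAt (mod_cast le_top)
  have l1 : ∫ x, ‖toC θ x‖ ≤ M := by simpa using h.integral_le 0 (by omega)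
  have l1_second : ∫ x, ‖fderiv ℝ (fun y => fderiv ℝ (toC θ) y m) x‖ ≤ ‖m‖ * (M / ρ ^ 2) := by
    calc _ ≤ ∫ x, ‖m‖ * ‖iteratedFDeriv ℝ 2 θ x‖ :=
          integral_mono_of_nonneg (.of_forall fun x => norm_nonneg _)
            ((h.integrable_norm_iteratedFDeriv 2).const_mul _)
            (.of_forall fun x => (norm_fderiv_fderiv_apply_le m hθ x).trans_eq (by rw [norm_toC]))
      _ ≤ _ := by
          rw [integral_const_mul]
          gcongr
          exact h.integral_le 2 le_rfl
  rw [fderiv_toC]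
  refine (PoincareEstimate.norm_fourier_fderiv_apply_le (contDiff_infty.1 hθ 2) hc m hρ l1
    l1_second ζ).trans_eq ?_
  congr 1
  field_simp

section Pairing

variable {k : ℕ} {φ v : V → ℝ} {Ω : Set V}

/-- The constant of the estimates for scale integrals of pairings with a scaled bump in
dimension `d`. -/
def bumpConst (d : ℕ) : ℝ := 2 ^ d * ((2 * Real.pi + 1) * Real.pi)

theorem two_pow_le_bumpConst (d : ℕ) : 2 ^ d ≤ bumpConst d :=
  le_mul_of_one_le_right (by positivity) (by nlinarith [Real.pi_gt_three])

theorem lintegral_Ioi_scalePairing_le (h : IsScaledBump M c ρ θ) (hk : k + 1 ≤ finrank ℝ V)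
    (hφ : Measurable φ) (hv : Measurable v) (hΩ : MeasurableSet Ω) (hΩt : volume Ω ≠ ⊤)
    (hφΩ : ∀ x ∉ Ω, φ x = 0) :
    ∫⁻ t in Set.Ioi 1, ENNReal.ofReal (scaleWeight (finrank ℝ V) k t) * ‖scalePairing θ φ v t‖ₑ ≤
      ENNReal.ofReal (bumpConst (finrank ℝ V) * M) *
        (smallScale (finrank ℝ V) k (volume.real Ω / ρ ^ finrank ℝ V) + 1) *
          (eLpNorm φ 2 volume * eLpNorm v 2 volume) := by
  have hM := h.nonneg
  refine (PoincareEstimate.lintegral_Ioi_scalePairing_le hk h.contDiff.continuous.measurable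
    h.integrable (by simpa using h.integral_le 0 (by omega)) h.radius_pos
    (fun y => by simpa using h.norm_le 0 (by omega) y) hφ hv hΩ hΩt hφΩ).trans ?_
  gcongr
  exact two_pow_le_bumpConst _

theorem lintegral_Ioi_sub_one_mul_scalePairing_fderiv_le (h : IsScaledBump M c ρ θ)
    (hk : k + 1 ≤ finrank ℝ V) (hφ : Measurable φ) (hφi : Integrable φ) (hφ2 : MemLp φ 2)
    (hv : Measurable v) (hvi : Integrable v) (hv2 : MemLp v 2) (hΩ : MeasurableSet Ω)
    (hΩt : volume Ω ≠ ⊤) (hφΩ : ∀ x ∉ Ω, φ x = 0) :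
    ∫⁻ t in Set.Ioi 1, ENNReal.ofReal (scaleWeight (finrank ℝ V) k t * (t - 1)) *
        ‖scalePairing (fun x => fderiv ℝ θ x m) φ v t‖ₑ ≤
      ENNReal.ofReal (bumpConst (finrank ℝ V) * (M * ‖m‖ / ρ)) *
        (smallScale (finrank ℝ V) k (volume.real Ω / ρ ^ finrank ℝ V) + 1) *
          (eLpNorm φ 2 volume * eLpNorm v 2 volume) := by
  have hM := h.nonneg
  have hρ := h.radius_pos
  have hf := contDiff_fderiv_apply h.contDiff m
  have hfc : HasCompactSupport fun x => fderiv ℝ θ x m :=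
    h.hasCompactSupport.fderiv_apply (𝕜 := ℝ) _
  have hfF := integrable_fourier_of_hasCompactSupport (Complex.ofRealCLM.contDiff.comp hf)
    (hfc.comp_left Complex.ofReal_zero)
  refine (PoincareEstimate.lintegral_Ioi_sub_one_mul_scalePairing_le hk hf.continuous
    (hf.continuous.integrable_of_hasCompactSupport hfc) hfF (h.integral_norm_fderiv_apply_le m)
    hρ (h.norm_fderiv_apply_le m) (h.norm_fourier_fderiv_apply_le m) (by positivity) hφ hφi hφ2
    hv hvi hv2 hΩ hΩt hφΩ).trans ?_
  refine mul_le_mul_left ?_ _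
  set N := M * ‖m‖ / ρ
  set C := (2 * Real.pi + 1) * Real.pi
  have hN : N ≤ C * N := le_mul_of_one_le_left (by positivity) (by nlinarith [Real.pi_gt_three])
  calc _ ≤ ENNReal.ofReal (2 ^ finrank ℝ V) * (ENNReal.ofReal (C * N) *
        smallScale (finrank ℝ V) k (volume.real Ω / ρ ^ finrank ℝ V) + ENNReal.ofReal (C * N)) := by
        rw [mul_right_comm _ N]
        gcongr
    _ = _ := by
        have bumpConst_mul : bumpConst (finrank ℝ V) * N = 2 ^ finrank ℝ V * (C * N) :=
          mul_assoc _ _ _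
        rw [bumpConst_mul, ENNReal.ofReal_mul (by positivity : (0 : ℝ) ≤ 2 ^ finrank ℝ V)]
        simp only [mul_add, mul_one, mul_assoc]

end Pairing

end IsScaledBump

theorem enorm_scaleWeight_mul_integral_fderiv_mul_le {k : ℕ} {θ φ v : V → ℝ}
    (hθ : ContDiff ℝ ∞ θ) (hθc : HasCompactSupport θ) (hφ : ContDiff ℝ ∞ φ)
    (hφc : HasCompactSupport φ) (hv : Integrable v) (L : V →L[ℝ] ℝ) (c m : V) {t : ℝ}
    (ht : 1 < t) :
    ‖(t - 1) ^ k * t ^ (finrank ℝ V - k - 1) * ∫ p : V × V,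
        fderiv ℝ φ p.1 m * (L (p.1 - p.2) * v p.2 * θ (t • p.2 - (t - 1) • p.1))‖ₑ ≤
      ENNReal.ofReal (scaleWeight (finrank ℝ V) k t * (t - 1)) *
          ‖scalePairing (fun x => fderiv ℝ θ x m) (fun x => φ x * L (x - c)) v t‖ₑ +
        ‖L m‖ₑ * (ENNReal.ofReal (scaleWeight (finrank ℝ V) k t) * ‖scalePairing θ φ v t‖ₑ) +
        ENNReal.ofReal (scaleWeight (finrank ℝ V) k t * (t - 1)) *
          ‖scalePairing (fun x => fderiv ℝ (fun z => θ z * L (z - c)) x m) φ v t‖ₑ := by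
  have weight_nonneg := scaleWeight_nonneg (n := finrank ℝ V) (k := k) ht
  have weight_mul_nonneg := mul_nonneg weight_nonneg (sub_nonneg.2 ht.le)
  have weight_mul : (t - 1) ^ k * t ^ (finrank ℝ V - k - 1) = scaleWeight (finrank ℝ V) k t * t :=
    (div_mul_cancel₀ _ (zero_lt_one.trans ht).ne').symm
  rw [weight_mul, mul_assoc, mul_integral_fderiv_mul_eq L c hθ hθc hφ hφc hv m t, mul_sub, mul_sub,
    mul_left_comm _ (L m), ← mul_assoc _ (t - 1), ← mul_assoc _ (t - 1)]
  refine enorm_sub_le.trans (add_le_add (enorm_sub_le.trans_eq ?_) ?_)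
  · simp only [enorm_mul, Real.enorm_of_nonneg weight_nonneg,
      Real.enorm_of_nonneg (sub_nonneg.2 ht.le), ENNReal.ofReal_mul weight_nonneg]
  · rw [enorm_mul, Real.enorm_of_nonneg weight_mul_nonneg]

theorem eLpNorm_mul_functional_le {φ : V → ℝ} {Ω : Set V} (hφΩ : ∀ x ∉ Ω, φ x = 0) {c : V}
    {R : ℝ} (hR : ∀ x ∈ Ω, ‖x - c‖ ≤ R) (L : V →L[ℝ] ℝ) :
    eLpNorm (fun x => φ x * L (x - c)) 2 volume ≤
      ENNReal.ofReal (‖L‖ * R) * eLpNorm φ 2 volume := by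
  refine eLpNorm_le_mul_eLpNorm_of_ae_le_mul (.of_forall fun x => ?_) 2
  by_cases hx : x ∈ Ω
  · rw [norm_mul, mul_comm]
    gcongr
    exact L.le_of_opNorm_le_of_le le_rfl (hR x hx)
  · simp [hφΩ x hx]

namespace IsScaledBump

variable {M ρ : ℝ} {c : V} {θ : V → ℝ} {k : ℕ} {φ v : V → ℝ} {Ω : Set V}

theorem lintegral_Ioi_scalePairing_fderiv_mul_functional_le (h : IsScaledBump M c ρ θ)
    (hk : k + 1 ≤ finrank ℝ V) (hφ : ContDiff ℝ ∞ φ) (hφc : HasCompactSupport φ)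
    (hv : Measurable v) (hvi : Integrable v) (hv2 : MemLp v 2) (hΩ : MeasurableSet Ω)
    (hΩt : volume Ω ≠ ⊤) (hφΩ : ∀ x ∉ Ω, φ x = 0) {R : ℝ} (hR : ∀ x ∈ Ω, ‖x - c‖ ≤ R)
    (L : V →L[ℝ] ℝ) (m : V) :
    ∫⁻ t in Set.Ioi 1, ENNReal.ofReal (scaleWeight (finrank ℝ V) k t * (t - 1)) *
        ‖scalePairing (fun x => fderiv ℝ θ x m) (fun x => φ x * L (x - c)) v t‖ₑ ≤
      ENNReal.ofReal (bumpConst (finrank ℝ V) * (‖L‖ * ‖m‖ * M) * (R / ρ)) *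
        (smallScale (finrank ℝ V) k (volume.real Ω / ρ ^ finrank ℝ V) + 1) *
          (eLpNorm φ 2 volume * eLpNorm v 2 volume) := by
  have hM := h.nonneg
  have hρ := h.radius_pos
  have bumpConst_nonneg : 0 ≤ bumpConst (finrank ℝ V) :=
    le_trans (by positivity) (two_pow_le_bumpConst _)
  have hφL := contDiff_mul_functional L c hφ
  have hφLc : HasCompactSupport fun x => φ x * L (x - c) := hφc.mul_right
  calc _ ≤ ENNReal.ofReal (bumpConst (finrank ℝ V) * (M * ‖m‖ / ρ)) *
        (smallScale (finrank ℝ V) k (volume.real Ω / ρ ^ finrank ℝ V) + 1) *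
          (ENNReal.ofReal (‖L‖ * R) * eLpNorm φ 2 volume * eLpNorm v 2 volume) := by
        refine (h.lintegral_Ioi_sub_one_mul_scalePairing_fderiv_le m hk hφL.continuous.measurable
          (hφL.continuous.integrable_of_hasCompactSupport hφLc)
          (hφL.continuous.memLp_of_hasCompactSupport hφLc) hv hvi hv2 hΩ hΩt
          (fun x hx => by rw [hφΩ x hx, zero_mul])).trans ?_
        gcongr
        exact eLpNorm_mul_functional_le hφΩ hR L
    _ = _ := by
        have constant : bumpConst (finrank ℝ V) * (‖L‖ * ‖m‖ * M) * (R / ρ) =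
            bumpConst (finrank ℝ V) * (M * ‖m‖ / ρ) * (‖L‖ * R) := by ring
        rw [constant, ENNReal.ofReal_mul (q := ‖L‖ * R) (by positivity)]
        ring

theorem lintegral_Ioi_scalePairing_fderiv_bump_mul_functional_le (h : IsScaledBump M c ρ θ)
    (hk : k + 1 ≤ finrank ℝ V) (hφ : ContDiff ℝ ∞ φ) (hφc : HasCompactSupport φ)
    (hv : Measurable v) (hvi : Integrable v) (hv2 : MemLp v 2) (hΩ : MeasurableSet Ω)
    (hΩt : volume Ω ≠ ⊤) (hφΩ : ∀ x ∉ Ω, φ x = 0) (L : V →L[ℝ] ℝ) (m : V) :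
    ∫⁻ t in Set.Ioi 1, ENNReal.ofReal (scaleWeight (finrank ℝ V) k t * (t - 1)) *
        ‖scalePairing (fun x => fderiv ℝ (fun z => θ z * L (z - c)) x m) φ v t‖ₑ ≤
      ENNReal.ofReal (3 * (bumpConst (finrank ℝ V) * (‖L‖ * ‖m‖ * M))) *
        (smallScale (finrank ℝ V) k (volume.real Ω / ρ ^ finrank ℝ V) + 1) *
          (eLpNorm φ 2 volume * eLpNorm v 2 volume) := by
  have hρ := h.radius_pos
  have constant : bumpConst (finrank ℝ V) * (‖L‖ * (3 * ρ * M) * ‖m‖ / ρ) =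
      3 * (bumpConst (finrank ℝ V) * (‖L‖ * ‖m‖ * M)) := by
    field_simp
  rw [← constant]
  exact (h.mul_functional L).lintegral_Ioi_sub_one_mul_scalePairing_fderiv_le m hk
    hφ.continuous.measurable (hφ.continuous.integrable_of_hasCompactSupport hφc)
    (hφ.continuous.memLp_of_hasCompactSupport hφc) hv hvi hv2 hΩ hΩt hφΩ

theorem enorm_mul_lintegral_Ioi_scalePairing_le (h : IsScaledBump M c ρ θ)
    (hk : k + 1 ≤ finrank ℝ V) (hφ : Measurable φ) (hv : Measurable v) (hΩ : MeasurableSet Ω)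
    (hΩt : volume Ω ≠ ⊤) (hφΩ : ∀ x ∉ Ω, φ x = 0) (L : V →L[ℝ] ℝ) (m : V) :
    ‖L m‖ₑ * ∫⁻ t in Set.Ioi 1,
        ENNReal.ofReal (scaleWeight (finrank ℝ V) k t) * ‖scalePairing θ φ v t‖ₑ ≤
      ENNReal.ofReal (bumpConst (finrank ℝ V) * (‖L‖ * ‖m‖ * M)) *
        (smallScale (finrank ℝ V) k (volume.real Ω / ρ ^ finrank ℝ V) + 1) *
          (eLpNorm φ 2 volume * eLpNorm v 2 volume) := by
  have enorm_le : ‖L m‖ₑ ≤ ENNReal.ofReal (‖L‖ * ‖m‖) :=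
    (ofReal_norm _).symm.trans_le (ENNReal.ofReal_le_ofReal (L.le_opNorm m))
  rw [mul_left_comm (bumpConst _), ENNReal.ofReal_mul (by positivity), mul_assoc, mul_assoc,
    ← mul_assoc (ENNReal.ofReal (bumpConst _ * _))]
  gcongr
  exact h.lintegral_Ioi_scalePairing_le hk hφ hv hΩ hΩt hφΩ

theorem lintegral_Ioi_enorm_integral_fderiv_mul_le (h : IsScaledBump M c ρ θ)
    (hk : k + 1 ≤ finrank ℝ V) (hφ : ContDiff ℝ ∞ φ) (hφc : HasCompactSupport φ)
    (hv : Measurable v) (hvi : Integrable v) (hv2 : MemLp v 2) (hΩ : MeasurableSet Ω)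
    (hΩt : volume Ω ≠ ⊤) (hφΩ : ∀ x ∉ Ω, φ x = 0) {R : ℝ} (hρR : ρ ≤ R)
    (hR : ∀ x ∈ Ω, ‖x - c‖ ≤ R) (L : V →L[ℝ] ℝ) (m : V) :
    ∫⁻ t in Set.Ioi 1, ‖(t - 1) ^ k * t ^ (finrank ℝ V - k - 1) * ∫ p : V × V,
        fderiv ℝ φ p.1 m * (L (p.1 - p.2) * v p.2 * θ (t • p.2 - (t - 1) • p.1))‖ₑ ≤
      ENNReal.ofReal (5 * (bumpConst (finrank ℝ V) * (‖L‖ * ‖m‖ * M)) * (R / ρ)) *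
        (smallScale (finrank ℝ V) k (volume.real Ω / ρ ^ finrank ℝ V) + 1) *
          (eLpNorm φ 2 volume * eLpNorm v 2 volume) := by
  have hM := h.nonneg
  have hφm := hφ.continuous.measurable
  have bumpConst_nonneg : 0 ≤ bumpConst (finrank ℝ V) :=
    le_trans (by positivity) (two_pow_le_bumpConst _)
  have measurable_left := measurable_scalePairing (contDiff_fderiv_apply h.contDiff m).continuous
    (contDiff_mul_functional L c hφ).continuous.measurable hv
  have measurable_bump := measurable_scalePairing h.contDiff.continuous hφm hv
  have : Measurable (scaleWeight (finrank ℝ V) k) := measurable_scaleWeight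
  refine (setLIntegral_mono' measurableSet_Ioi fun t ht =>
    enorm_scaleWeight_mul_integral_fderiv_mul_le h.contDiff h.hasCompactSupport hφ hφc hvi L c m
      ht).trans ?_
  rw [lintegral_add_left (by fun_prop), lintegral_add_left (by fun_prop),
    lintegral_const_mul _ (by fun_prop)]
  refine (add_le_add (add_le_add
    (h.lintegral_Ioi_scalePairing_fderiv_mul_functional_le hk hφ hφc hv hvi hv2 hΩ hΩt hφΩ hR L m)
    (h.enorm_mul_lintegral_Ioi_scalePairing_le hk hφm hv hΩ hΩt hφΩ L m))
    (h.lintegral_Ioi_scalePairing_fderiv_bump_mul_functional_le hk hφ hφc hv hvi hv2 hΩ hΩt hφΩ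
      L m)).trans ?_
  set A := bumpConst (finrank ℝ V) * (‖L‖ * ‖m‖ * M)
  have hA : 0 ≤ A := by positivity
  have hRρ : 1 ≤ R / ρ := (one_le_div h.radius_pos).2 hρR
  rw [← add_mul, ← add_mul, ← add_mul, ← add_mul, ← ENNReal.ofReal_add (by positivity) hA,
    ← ENNReal.ofReal_add (by positivity) (by positivity)]
  gcongr
  nlinarith

theorem enorm_setIntegral_scalarOp_mul_fderiv_le (h : IsScaledBump M c ρ θ)
    (hk : k + 1 ≤ finrank ℝ V) (hφ : ContDiff ℝ ∞ φ) (hφc : HasCompactSupport φ)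
    (hφΩ : tsupport φ ⊆ Ω)
    (hv : Measurable v) (hvi : Integrable v) (hv2 : MemLp v 2) (hΩ : MeasurableSet Ω)
    (hΩb : Bornology.IsBounded Ω) {R : ℝ} (hρR : ρ ≤ R)
    (hR : ∀ x ∈ Ω, ‖x - c‖ ≤ R) (L : V →L[ℝ] ℝ) (m : V) :
    ‖∫ x in Ω, scalarOp k θ L v x * fderiv ℝ φ x m‖ₑ ≤
      ENNReal.ofReal (5 * (bumpConst (finrank ℝ V) * (‖L‖ * ‖m‖ * M)) * (R / ρ)) *
        (smallScale (finrank ℝ V) k (volume.real Ω / ρ ^ finrank ℝ V) + 1) *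
          (eLpNorm φ 2 volume * eLpNorm v 2 volume) := by
  have hψ := (contDiff_fderiv_apply hφ m).continuous
  obtain ⟨B, hB⟩ := hψ.bounded_above_of_compact_support (hφc.fderiv_apply (𝕜 := ℝ) m)
  have fderiv_eq_zero (x : V) (hx : x ∉ Ω) : fderiv ℝ φ x m = 0 := by
    rw [image_eq_zero_of_notMem_tsupport fun hx' => hx (hφΩ (tsupport_fderiv_subset ℝ hx')),
      zero_apply]
  have eq_zero (x : V) (hx : x ∉ Ω) : φ x = 0 :=
    image_eq_zero_of_notMem_tsupport fun hx' => hx (hφΩ hx')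
  rw [setIntegral_scalarOp_mul hk h.contDiff.continuous h.hasCompactSupport hΩ hΩb L hv hvi
    hψ.measurable hB fderiv_eq_zero]
  exact (enorm_integral_le_lintegral_enorm _).trans
    (h.lintegral_Ioi_enorm_integral_fderiv_mul_le hk hφ hφc hv hvi hv2 hΩ hΩb.measure_lt_top.ne
      eq_zero hρR hR L m)

end IsScaledBump

end EuclideanSpace

section WeakDerivatives

open TopologicalSpace
open scoped Distributions LineDeriv

theorem exists_norm_le_forall_inner_eq {W H : Type*} [AddCommGroup W] [Module ℝ W]
    [NormedAddCommGroup H] [InnerProductSpace ℝ H] [CompleteSpace H] (L : W →ₗ[ℝ] ℝ)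
    (ι : W →ₗ[ℝ] H) {M : ℝ} (hM : 0 ≤ M) (h : ∀ x, ‖L x‖ ≤ M * ‖ι x‖) :
    ∃ g : H, ‖g‖ ≤ M ∧ ∀ x, inner ℝ g (ι x) = L x := by
  let onRange : StrongDual ℝ (LinearMap.range ι) := L.compLeftInverse ι
  have onRange_apply (x : W) : onRange ⟨ι x, x, rfl⟩ = L x :=
    LinearMap.compLeftInverse_apply_of_bdd L ι ⟨M, h⟩ x (ι x) rfl
  have norm_onRange : ‖onRange‖ ≤ M := by
    refine ContinuousLinearMap.opNorm_le_bound _ hM ?_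
    rintro ⟨_, x, rfl⟩
    rw [onRange_apply]
    exact h x
  obtain ⟨extension, extension_apply, norm_extension⟩ :=
    exists_extension_norm_eq (LinearMap.range ι) onRange
  refine ⟨(InnerProductSpace.toDual ℝ H).symm extension, ?_, fun x => ?_⟩
  · rwa [LinearIsometryEquiv.norm_map, norm_extension]
  · rw [InnerProductSpace.toDual_symm_apply, ← onRange_apply]
    exact extension_apply ⟨ι x, x, rfl⟩

section TestFunctions

variable {V : Type*} [NormedAddCommGroup V] [NormedSpace ℝ V] [MeasurableSpace V]
  [OpensMeasurableSpace V] {Ω : Opens V} {μ : Measure V}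

omit [MeasurableSpace V] [OpensMeasurableSpace V] in
theorem testFunction_lineDeriv_apply (m x : V) (φ : 𝓓(Ω, ℝ)) : (∂_{m} φ) x = fderiv ℝ φ x m :=
  (TestFunction.lineDerivCLM_apply_of_le (𝕜 := ℝ) (n := ⊤) (f := φ) le_rfl).trans
    (φ.contDiff.differentiable (by simp)).differentiableAt.lineDeriv_eq_fderiv

theorem memLp_two_testFunction [IsFiniteMeasureOnCompacts μ] (φ : 𝓓(Ω, ℝ)) : MemLp φ 2 μ :=
  φ.continuous.memLp_of_hasCompactSupport φ.hasCompactSupport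

/-- The class in `L²(μ)` of a test function, as a linear map. -/
def testFunctionToLp (Ω : Opens V) (μ : Measure V) [IsFiniteMeasureOnCompacts μ] :
    𝓓(Ω, ℝ) →ₗ[ℝ] Lp ℝ 2 μ where
  toFun φ := (memLp_two_testFunction φ).toLp φ
  map_add' φ ψ := MemLp.toLp_add (memLp_two_testFunction φ) (memLp_two_testFunction ψ)
  map_smul' a φ := MemLp.toLp_const_smul a (memLp_two_testFunction φ)

theorem inner_testFunctionToLp [IsFiniteMeasureOnCompacts μ] (g : Lp ℝ 2 μ) (φ : 𝓓(Ω, ℝ)) :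
    inner ℝ g (testFunctionToLp Ω μ φ) = ∫ x, g x * φ x ∂μ := by
  rw [L2.inner_def]
  refine integral_congr_ae ?_
  filter_upwards [(memLp_two_testFunction (μ := μ) φ).coeFn_toLp] with x hx
  rw [testFunctionToLp, LinearMap.coe_mk, AddHom.coe_mk, hx]
  simp [mul_comm]

theorem exists_integral_mul_lineDeriv_eq_neg [IsFiniteMeasureOnCompacts μ] {f : V → ℝ}
    (hf : MemLp f 2 μ) (m : V) {M : ℝ} (hM : 0 ≤ M)
    (h : ∀ φ : 𝓓(Ω, ℝ), ‖∫ x, f x * (∂_{m} φ) x ∂μ‖ₑ ≤ ENNReal.ofReal M * eLpNorm φ 2 μ) :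
    ∃ g : V → ℝ, MemLp g 2 μ ∧ eLpNorm g 2 μ ≤ ENNReal.ofReal M ∧
      ∀ φ : 𝓓(Ω, ℝ), ∫ x, f x * (∂_{m} φ) x ∂μ = -∫ x, g x * φ x ∂μ := by
  let L : 𝓓(Ω, ℝ) →ₗ[ℝ] ℝ := -((innerSL ℝ (hf.toLp f)).toLinearMap ∘ₗ testFunctionToLp Ω μ ∘ₗ
    (TestFunction.lineDerivCLM ℝ m).toLinearMap)
  have L_apply (φ : 𝓓(Ω, ℝ)) : L φ = -∫ x, f x * (∂_{m} φ) x ∂μ := by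
    refine congrArg Neg.neg ((inner_testFunctionToLp (hf.toLp f) (∂_{m} φ)).trans ?_)
    refine integral_congr_ae ?_
    filter_upwards [hf.coeFn_toLp] with x hx
    rw [hx]
  obtain ⟨g, norm_g, inner_g⟩ := exists_norm_le_forall_inner_eq L (testFunctionToLp Ω μ) hM
    fun φ => by
      have norm_toLp : ‖testFunctionToLp Ω μ φ‖ = (eLpNorm φ 2 μ).toReal :=
        Lp.norm_toLp φ (memLp_two_testFunction φ)
      have := ENNReal.toReal_mono (ENNReal.mul_ne_top ENNReal.ofReal_ne_top
        (memLp_two_testFunction φ).2.ne) (h φ)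
      rwa [ENNReal.toReal_mul, ENNReal.toReal_ofReal hM, toReal_enorm, ← norm_neg, ← L_apply,
        ← norm_toLp] at this
  refine ⟨g, Lp.memLp g, ?_, fun φ => ?_⟩
  · rw [← ENNReal.ofReal_toReal (Lp.memLp g).2.ne]
    exact ENNReal.ofReal_le_ofReal norm_g
  · rw [← inner_testFunctionToLp, inner_g, L_apply, neg_neg]

theorem integrable_mul_testFunction {f : V → ℝ} (hf : LocallyIntegrableOn f Ω μ) (φ : 𝓓(Ω, ℝ)) :
    Integrable (fun x => f x * φ x) μ :=
  (φ.integrable_bilin (ContinuousLinearMap.mul ℝ ℝ) hf).congr (.of_forall fun _ => mul_comm _ _)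

end TestFunctions

variable {n : ℕ} {Ω : Opens (E n)} {j : Fin n} {f g : E n → ℝ}

theorem hasWeakPartial_iff_testFunction :
    HasWeakPartial Ω j f g ↔ LocallyIntegrableOn f Ω ∧ LocallyIntegrableOn g Ω ∧
      ∀ φ : 𝓓(Ω, ℝ), ∫ x in Ω, f x * (∂_{e j} φ) x = -∫ x in Ω, g x * φ x := by
  refine and_congr_right' (and_congr_right' ⟨fun h φ => ?_, fun h φ hφ hφc hφΩ => ?_⟩)
  · simpa only [testFunction_lineDeriv_apply] using
      h φ φ.contDiff φ.hasCompactSupport φ.tsupport_subset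
  · simpa only [testFunction_lineDeriv_apply] using! h ⟨φ, hφ, hφc, hφΩ⟩

theorem locallyIntegrableOn_of_memLp_two {Ω : Set (E n)} (hf : MemLp f 2 (volume.restrict Ω)) :
    LocallyIntegrableOn f Ω :=
  locallyIntegrableOn_of_locallyIntegrable_restrict (hf.locallyIntegrable one_le_two)

theorem exists_hasWeakPartial_of_forall_enorm_integral_le
    (hf : MemLp f 2 (volume.restrict Ω)) (j : Fin n) {M : ℝ} (hM : 0 ≤ M)
    (h : ∀ φ : 𝓓(Ω, ℝ), ‖∫ x in Ω, f x * (∂_{e j} φ) x‖ₑ ≤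
      ENNReal.ofReal M * eLpNorm φ 2 (volume.restrict Ω)) :
    ∃ g : E n → ℝ, HasWeakPartial Ω j f g ∧ MemLp g 2 (volume.restrict Ω) ∧
      eLpNorm g 2 (volume.restrict Ω) ≤ ENNReal.ofReal M := by
  obtain ⟨g, hg, eLpNorm_g, integral_eq⟩ := exists_integral_mul_lineDeriv_eq_neg hf (e j) hM h
  exact ⟨g, hasWeakPartial_iff_testFunction.2 ⟨locallyIntegrableOn_of_memLp_two hf,
    locallyIntegrableOn_of_memLp_two hg, integral_eq⟩, hg, eLpNorm_g⟩

namespace HasWeakPartial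

theorem ae_eq {g' : E n → ℝ} (h : HasWeakPartial Ω j f g) (h' : HasWeakPartial Ω j f g') :
    g =ᵐ[volume.restrict Ω] g' := by
  obtain ⟨-, hg, integral_eq⟩ := hasWeakPartial_iff_testFunction.1 h
  obtain ⟨-, hg', integral_eq'⟩ := hasWeakPartial_iff_testFunction.1 h'
  have setIntegral_eq (g : E n → ℝ) (φ : 𝓓(Ω, ℝ)) : ∫ x in Ω, g x * φ x = ∫ x, g x * φ x :=
    setIntegral_eq_integral_of_forall_compl_eq_zero fun x hx => by
      rw [image_eq_zero_of_notMem_tsupport fun hx' => hx (φ.tsupport_subset hx'), mul_zero]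
  have sub_eq_zero_ae := Ω.isOpen.ae_eq_zero_of_integral_contDiff_smul_eq_zero (μ := volume)
    (hg.sub hg') fun φ hφ hφc hφΩ => by
      let ψ : 𝓓(Ω, ℝ) := ⟨φ, hφ, hφc, hφΩ⟩
      calc ∫ x, φ x • (g - g') x = ∫ x, (g x * ψ x - g' x * ψ x) := by
            refine integral_congr_ae (.of_forall fun x => ?_)
            simp only [Pi.sub_apply, smul_eq_mul]
            exact (mul_comm _ _).trans (sub_mul _ _ _)
        _ = 0 := by
            rw [integral_sub (integrable_mul_testFunction hg ψ) (integrable_mul_testFunction hg' ψ),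
              ← setIntegral_eq, ← setIntegral_eq, sub_eq_zero, ← neg_inj, ← integral_eq,
              ← integral_eq']
  rw [Filter.EventuallyEq, ae_restrict_iff' Ω.isOpen.measurableSet]
  filter_upwards [sub_eq_zero_ae] with x hx hxΩ
  exact sub_eq_zero.1 (hx hxΩ)

theorem congr_left {f' : E n → ℝ} (h : HasWeakPartial Ω j f g)
    (hff' : f =ᵐ[volume.restrict Ω] f') : HasWeakPartial Ω j f' g := by
  refine ⟨h.1.congr hff', h.2.1, fun φ hφ hφc hφΩ => ?_⟩
  rw [← h.2.2 φ hφ hφc hφΩ]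
  refine integral_congr_ae ?_
  filter_upwards [hff'] with x hx
  rw [hx]

theorem zero : HasWeakPartial Ω j 0 0 :=
  hasWeakPartial_iff_testFunction.2
    ⟨locallyIntegrableOn_zero, locallyIntegrableOn_zero, fun φ => by simp⟩

theorem add {f' g' : E n → ℝ} (h : HasWeakPartial Ω j f g) (h' : HasWeakPartial Ω j f' g') :
    HasWeakPartial Ω j (f + f') (g + g') := by
  obtain ⟨hf, hg, integral_eq⟩ := hasWeakPartial_iff_testFunction.1 h
  obtain ⟨hf', hg', integral_eq'⟩ := hasWeakPartial_iff_testFunction.1 h'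
  refine hasWeakPartial_iff_testFunction.2 ⟨hf.add hf', hg.add hg', fun φ => ?_⟩
  have integral_add_mul {v w : E n → ℝ} (hv : LocallyIntegrableOn v Ω)
      (hw : LocallyIntegrableOn w Ω) (ψ : 𝓓(Ω, ℝ)) :
      ∫ x in Ω, (v + w) x * ψ x = (∫ x in Ω, v x * ψ x) + ∫ x in Ω, w x * ψ x := by
    simp only [Pi.add_apply, add_mul]
    exact integral_add (integrable_mul_testFunction hv ψ).restrict
      (integrable_mul_testFunction hw ψ).restrict
  rw [integral_add_mul hf hf', integral_add_mul hg hg', integral_eq, integral_eq', neg_add]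

theorem sum {ι : Type*} {s : Finset ι} {f g : ι → E n → ℝ}
    (h : ∀ i ∈ s, HasWeakPartial Ω j (f i) (g i)) :
    HasWeakPartial Ω j (∑ i ∈ s, f i) (∑ i ∈ s, g i) := by
  classical
  induction s using Finset.induction_on with
  | empty => exact zero
  | insert i s hi ih =>
    rw [Finset.sum_insert hi, Finset.sum_insert hi]
    rw [Finset.forall_mem_insert] at h
    exact h.1.add (ih h.2)

end HasWeakPartial

theorem setIntegral_weakPartial_sq (h : HasWeakPartial Ω j f g) :
    ∫ x in Ω, weakPartial Ω j f x ^ 2 = ∫ x in Ω, g x ^ 2 := by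
  have hex : ∃ g, HasWeakPartial Ω j f g := ⟨g, h⟩
  refine integral_congr_ae ?_
  rw [weakPartial, dif_pos hex]
  filter_upwards [hex.choose_spec.ae_eq h] with x hx
  rw [hx]

end WeakDerivatives

section ScalarEstimate

variable {V : Type*} [NormedAddCommGroup V] [InnerProductSpace ℝ V] [FiniteDimensional ℝ V]
  [MeasurableSpace V] [BorelSpace V]

theorem measureReal_div_diam_ball_pow [Nontrivial V] (s : Set V) (c : V) {r : ℝ} (hr : 0 < r) :
    volume.real s / Metric.diam (Metric.ball c r) ^ finrank ℝ V =
      volume.real (Metric.ball (0 : V) 1) / 2 ^ finrank ℝ V *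
        (volume.real s / volume.real (Metric.ball c r)) := by
  have volume_ball : volume.real (Metric.ball c r) =
      r ^ finrank ℝ V * volume.real (Metric.ball (0 : V) 1) := by
    rw [measureReal_def, Measure.addHaar_ball_of_pos _ _ hr, ENNReal.toReal_mul,
      ENNReal.toReal_ofReal (by positivity), measureReal_def]
  have volume_unitBall_ne_zero : volume.real (Metric.ball (0 : V) 1) ≠ 0 :=
    ENNReal.toReal_ne_zero.2 ⟨(Metric.measure_ball_pos _ _ one_pos).ne', measure_ball_lt_top.ne⟩
  rw [Metric.diam_ball_eq c hr.le, volume_ball, mul_pow]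
  field_simp

theorem one_le_measureReal_div {s t : Set V} (h : s ⊆ t) (hs : volume s ≠ 0) (ht : volume t ≠ ⊤) :
    1 ≤ volume.real t / volume.real s := by
  have volume_s_pos : 0 < volume.real s :=
    ENNReal.toReal_pos hs (ne_top_of_le_ne_top ht (measure_mono h))
  rw [one_le_div volume_s_pos]
  exact measureReal_mono h ht

theorem exists_smallScale_add_one_le_mul_kappa {k : ℕ} (hk : k + 1 ≤ finrank ℝ V) :
    ∃ C : ℝ, 0 ≤ C ∧ ∀ (Ω : Set V) (c : V) (r : ℝ), volume Ω ≠ ⊤ → 0 < r → Metric.ball c r ⊆ Ω →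
      smallScale (finrank ℝ V) k
          (volume.real Ω / Metric.diam (Metric.ball c r) ^ finrank ℝ V) + 1 ≤
        ENNReal.ofReal (C * kappa (finrank ℝ V) (k + 1)
          (volume.real Ω / volume.real (Metric.ball c r))) := by
  have := nontrivial_of_finrank_pos (R := ℝ) (M := V) (by omega)
  obtain ⟨C, hC, smallScale_le⟩ := exists_smallScale_le_mul_kappa (finrank ℝ V) k
    (c := volume.real (Metric.ball (0 : V) 1) / 2 ^ finrank ℝ V) (by positivity)
  refine ⟨C + 1, by positivity, fun Ω c r hΩ hr hball => ?_⟩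
  have ratio_ge_one := one_le_measureReal_div hball (Metric.measure_ball_pos _ _ hr).ne' hΩ
  have one_le := one_le_kappa (finrank ℝ V) (k + 1) ratio_ge_one
  rw [measureReal_div_diam_ball_pow Ω c hr, add_mul, one_mul,
    ENNReal.ofReal_add (by positivity) (by positivity)]
  exact add_le_add (smallScale_le _ ratio_ge_one) (ENNReal.one_le_ofReal.2 one_le)

theorem exists_enorm_setIntegral_scalarOp_mul_fderiv_le {k : ℕ} (hk : k + 1 ≤ finrank ℝ V) :
    ∃ C : ℝ, 0 ≤ C ∧ ∀ {M : ℝ} {Ω : Set V} {c : V} {r : ℝ} {θ φ v : V → ℝ} (L : V →L[ℝ] ℝ) (m : V),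
      MeasurableSet Ω → Bornology.IsBounded Ω → 0 < r → Metric.ball c r ⊆ Ω →
      IsScaledBump M c (Metric.diam (Metric.ball c r)) θ →
      ContDiff ℝ ∞ φ → HasCompactSupport φ → tsupport φ ⊆ Ω →
      Measurable v → Integrable v → MemLp v 2 →
      ‖∫ x in Ω, scalarOp k θ L v x * fderiv ℝ φ x m‖ₑ ≤
        ENNReal.ofReal (C * (‖L‖ * ‖m‖ * M) *
          (Metric.diam Ω / Metric.diam (Metric.ball c r)) *
            kappa (finrank ℝ V) (k + 1) (volume.real Ω / volume.real (Metric.ball c r))) *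
          (eLpNorm φ 2 volume * eLpNorm v 2 volume) := by
  obtain ⟨C, hC, smallScale_le⟩ := exists_smallScale_add_one_le_mul_kappa hk
  have bumpConst_nonneg : 0 ≤ IsScaledBump.bumpConst (finrank ℝ V) :=
    (by positivity : (0 : ℝ) ≤ 2 ^ finrank ℝ V).trans (IsScaledBump.two_pow_le_bumpConst _)
  refine ⟨5 * IsScaledBump.bumpConst (finrank ℝ V) * C, by positivity,
    fun {M Ω c r θ φ v} L m hΩ hΩb hr hball hθ hφ hφc hφΩ hv hvi hv2 => ?_⟩
  have dist_center_le (x : V) (hx : x ∈ Ω) : ‖x - c‖ ≤ Metric.diam Ω := by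
    rw [← dist_eq_norm]
    exact Metric.dist_le_diam_of_mem hΩb hx (hball (Metric.mem_ball_self hr))
  have hM := hθ.nonneg
  refine (hθ.enorm_setIntegral_scalarOp_mul_fderiv_le hk hφ hφc hφΩ hv hvi hv2 hΩ hΩb
    (Metric.diam_mono hball hΩb) dist_center_le L m).trans ?_
  gcongr
  have : 0 ≤ Metric.diam Ω / Metric.diam (Metric.ball c r) := by positivity
  refine (mul_le_mul_right (smallScale_le Ω c r hΩb.measure_lt_top.ne hr hball) _).trans_eq ?_
  rw [← ENNReal.ofReal_mul (by positivity)]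
  congr 1
  ring

theorem exists_forall_hasWeakPartial_scalarOp {n k : ℕ} (hk : k + 1 ≤ n) :
    ∃ C : ℝ, 0 ≤ C ∧ ∀ {M : ℝ} {Ω : Set (E n)} {c : E n} {r : ℝ} {θ v : E n → ℝ} (i j : Fin n),
      IsOpen Ω → Bornology.IsBounded Ω → 0 < r → Metric.ball c r ⊆ Ω →
      IsScaledBump M c (Metric.diam (Metric.ball c r)) θ →
      Measurable v → Integrable v → MemLp v 2 →
      ∃ g : E n → ℝ, HasWeakPartial Ω j (scalarOp k θ (EuclideanSpace.proj i) v) g ∧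
        MemLp g 2 (volume.restrict Ω) ∧
        eLpNorm g 2 (volume.restrict Ω) ≤
          ENNReal.ofReal (C * M * (Metric.diam Ω / Metric.diam (Metric.ball c r)) *
            kappa n (k + 1) (volume.real Ω / volume.real (Metric.ball c r)) *
              (eLpNorm v 2 volume).toReal) := by
  have finrank_eq : finrank ℝ (E n) = n := finrank_euclideanSpace_fin
  obtain ⟨C, hC, pairing_le⟩ := exists_enorm_setIntegral_scalarOp_mul_fderiv_le (V := E n)
    (hk.trans_eq finrank_eq.symm)
  refine ⟨C, hC, fun {M Ω c r θ v} i j hΩ hΩb hr hball hθ hv hvi hv2 => ?_⟩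
  have norm_proj_le : ‖(EuclideanSpace.proj i : E n →L[ℝ] ℝ)‖ ≤ 1 :=
    ContinuousLinearMap.opNorm_le_bound _ zero_le_one fun x => by
      simpa using PiLp.norm_apply_le x i
  have norm_e : ‖(e j : E n)‖ = 1 := by simp [e]
  have kappa_ge_one := one_le_kappa n (k + 1)
    (one_le_measureReal_div hball (Metric.measure_ball_pos _ _ hr).ne' hΩb.measure_lt_top.ne)
  have hM := hθ.nonneg
  have memLp := memLp_scalarOp (hk.trans_eq finrank_eq.symm) hθ.contDiff.continuous
    hθ.hasCompactSupport hΩ.measurableSet hΩb (EuclideanSpace.proj i) hv hv2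
  lift Ω to TopologicalSpace.Opens (E n) using hΩ
  refine exists_hasWeakPartial_of_forall_enorm_integral_le memLp j (by positivity) fun φ => ?_
  have eLpNorm_φ : eLpNorm φ 2 (volume.restrict Ω) = eLpNorm φ 2 volume := by
    rw [← eLpNorm_indicator_eq_eLpNorm_restrict Ω.isOpen.measurableSet,
      Set.indicator_eq_self.2 ((subset_tsupport φ).trans φ.tsupport_subset)]
  simp only [testFunction_lineDeriv_apply]
  refine (pairing_le (EuclideanSpace.proj i) (e j) Ω.isOpen.measurableSet hΩb hr hball hθ
    φ.contDiff φ.hasCompactSupport φ.tsupport_subset hv hvi hv2).trans ?_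
  rw [eLpNorm_φ, ENNReal.ofReal_mul (q := (eLpNorm v 2 volume).toReal) (by positivity),
    ENNReal.ofReal_toReal hv2.2.ne, mul_comm (eLpNorm φ 2 volume), ← mul_assoc, finrank_eq, norm_e,
    mul_one]
  gcongr
  exact mul_le_of_le_one_left hM norm_proj_le

end ScalarEstimate

section Forms

variable {n k ℓ : ℕ}

theorem component_eq_zero_or_eq_mul_coeff (m : Fin ℓ → Fin n) :
    (∀ η : Form n ℓ, η (fun l => e (m l)) = 0) ∨
      ∃ (I : Fin ℓ ↪o Fin n) (s : ℝ), |s| = 1 ∧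
        ∀ η : Form n ℓ, η (fun l => e (m l)) = s * coeff I η := by
  by_cases hm : Function.Injective m
  · let σ := Tuple.sort m
    have sorted : StrictMono (m ∘ σ) :=
      (Tuple.monotone_sort m).strictMono_of_injective (hm.comp σ.injective)
    refine .inr ⟨.ofStrictMono _ sorted, ((Equiv.Perm.sign σ : ℤ) : ℝ), ?_, fun η => ?_⟩
    · rcases Int.units_eq_one_or (Equiv.Perm.sign σ) with h | h <;> simp [h]
    · have coeff_sorted : coeff (.ofStrictMono _ sorted) η =
          Equiv.Perm.sign σ • η (fun l => e (m l)) :=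
        η.toAlternatingMap.map_perm (fun l => e (m l)) σ
      rw [coeff_sorted]
      rcases Int.units_eq_one_or (Equiv.Perm.sign σ) with h | h <;> simp [h]
  · refine .inl fun η => η.map_eq_zero_of_not_injective _ fun h => hm fun a b hab => h ?_
    simp only [hab]

theorem form_eq_zero_of_coeff_eq_zero {η : Form n ℓ} (h : ∀ I, coeff I η = 0) : η = 0 := by
  refine ContinuousAlternatingMap.toAlternatingMap_injective ?_
  refine Basis.ext_alternating (EuclideanSpace.basisFun (Fin n) ℝ).toBasis fun m _ => ?_
  suffices η (fun l => e (m l)) = 0 by simpa [e] using! this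
  rcases component_eq_zero_or_eq_mul_coeff m with component_eq_zero | ⟨I, s, -, component_eq⟩
  · exact component_eq_zero η
  · rw [component_eq, h, mul_zero]

/-- The coefficient `η ↦ η_I` as a continuous linear functional on forms. -/
def coeffCLM (I : Fin ℓ ↪o Fin n) : Form n ℓ →L[ℝ] ℝ :=
  ContinuousAlternatingMap.apply ℝ (E n) ℝ fun l => e (I l)

theorem integrable_form_of_coeff {μ : Measure (E n)} {w : E n → Form n ℓ}
    (h : ∀ I, Integrable (fun y => coeff I (w y)) μ) : Integrable w μ := by
  let coordinates : Form n ℓ →L[ℝ] (Fin ℓ ↪o Fin n) → ℝ := .pi coeffCLM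
  obtain ⟨leftInv, leftInv_apply⟩ := coordinates.toLinearMap.exists_leftInverse_of_injective
    (LinearMap.ker_eq_bot'.2 fun _ hη => form_eq_zero_of_coeff_eq_zero (congrFun hη))
  exact (leftInv.toContinuousLinearMap.integrable_comp (Integrable.of_eval h)).congr
    (.of_forall fun y => LinearMap.congr_fun leftInv_apply (w y))

theorem coeff_integral {μ : Measure (E n)} {w : E n → Form n ℓ} (hw : Integrable w μ)
    (I : Fin ℓ ↪o Fin n) : coeff I (∫ y, w y ∂μ) = ∫ y, coeff I (w y) ∂μ :=
  ((coeffCLM I).integral_comp_comm hw).symm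

theorem coeff_contract (J : Fin k ↪o Fin n) (z : E n) (η : Form n (k + 1)) :
    coeff J (contract z η) =
      ∑ i, z i * η fun l => e ((Fin.cons i J : Fin (k + 1) → Fin n) l) := by
  have sum_basis : z = ∑ i, z i • e i := by
    simpa [e] using ((EuclideanSpace.basisFun (Fin n) ℝ).sum_repr z).symm
  have vecCons_basis (i : Fin n) : (Matrix.vecCons (e i) fun l => e (J l)) =
      fun l => (e ((Fin.cons i J : Fin (k + 1) → Fin n) l) : E n) := by
    funext l
    refine Fin.cases ?_ (fun l => ?_) l <;> simp
  conv_lhs => rw [sum_basis]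
  rw [contract, map_sum]
  change coeffCLM J _ = _
  rw [map_sum]
  refine Finset.sum_congr rfl fun i _ => ?_
  rw [map_smul, map_smul, smul_eq_mul, ← vecCons_basis]
  rfl

theorem G_eq_scaleKernel (hk : k + 1 ≤ n) (θ : E n → ℝ) (x y : E n) :
    G θ ((n : ℤ) - ((k + 1 : ℕ) : ℤ) + 1) y x = scaleKernel k θ x y := by
  have exponent_left : (n : ℤ) - ((n : ℤ) - ((k + 1 : ℕ) : ℤ) + 1) = (k : ℕ) := by
    push_cast
    ring
  have exponent_right : (n : ℤ) - ((k + 1 : ℕ) : ℤ) + 1 - 1 = ((n - k - 1 : ℕ) : ℤ) := by omega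
  refine setIntegral_congr_fun measurableSet_Ioi fun t _ => ?_
  simp only [sliceKernel]
  rw [exponent_left, exponent_right, zpow_natCast, zpow_natCast, finrank_euclideanSpace_fin]
  congr 2
  module

theorem coeff_poincareIntegrand (hk : k + 1 ≤ n) (θ : E n → ℝ) (u : E n → Form n (k + 1))
    (J : Fin k ↪o Fin n) (x y : E n) :
    coeff J (poincareIntegrand θ u x y) =
      ∑ i, scaleKernel k θ x y * (EuclideanSpace.proj i : E n →L[ℝ] ℝ) (x - y) *
        u y fun l => e ((Fin.cons i J : Fin (k + 1) → Fin n) l) := by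
  calc coeff J (poincareIntegrand θ u x y)
      = G θ ((n : ℤ) - ((k + 1 : ℕ) : ℤ) + 1) y x * coeff J (contract (x - y) (u y)) := rfl
    _ = _ := by
        rw [G_eq_scaleKernel hk, coeff_contract, Finset.mul_sum]
        exact Finset.sum_congr rfl fun i _ => (mul_assoc _ _ _).symm

end Forms

section SquareIntegrable

variable {α : Type*} [MeasurableSpace α] {μ : Measure α} {s : Set α} {f v : α → ℝ}

theorem eLpNorm_two_eq_ofReal_sqrt (hf : MemLp f 2 μ) :
    eLpNorm f 2 μ = ENNReal.ofReal √(∫ x, f x ^ 2 ∂μ) := by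
  rw [eLpNorm_two_eq_lintegral, ← ofReal_rpow_half (integral_nonneg fun x => sq_nonneg _),
    ofReal_integral_eq_lintegral_ofReal hf.integrable_sq (.of_forall fun x => sq_nonneg _)]
  simp only [← ofReal_norm, Real.norm_eq_abs, ← ENNReal.ofReal_pow (abs_nonneg _), sq_abs]

/-- `v` is a measurable square integrable function on the whole space which vanishes outside `s` and
represents `f` on `s`. -/
structure IsL2Extension (μ : Measure α) (s : Set α) (f v : α → ℝ) : Prop where
  measurable : Measurable v
  memLp : MemLp v 2 μ
  eq_zero_of_notMem : ∀ x ∉ s, v x = 0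
  ae_eq : f =ᵐ[μ.restrict s] v

theorem exists_isL2Extension (hs : MeasurableSet s) (hf : MemLp f 2 (μ.restrict s)) :
    ∃ v, IsL2Extension μ s f v := by
  have ae_eq_mk := hf.1.ae_eq_mk
  exact ⟨s.indicator (hf.1.mk f), hf.1.stronglyMeasurable_mk.measurable.indicator hs,
    (memLp_indicator_iff_restrict hs).2 (hf.ae_eq ae_eq_mk),
    fun _ hx => Set.indicator_of_notMem hx _, ae_eq_mk.trans (indicator_ae_eq_restrict hs).symm⟩

namespace IsL2Extension

theorem indicator_eq (h : IsL2Extension μ s f v) : s.indicator v = v :=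
  Set.indicator_eq_self.2 fun _ hx => by_contra fun hxs => hx (h.eq_zero_of_notMem _ hxs)

theorem integrable (h : IsL2Extension μ s f v) (hs : MeasurableSet s) (hμs : μ s ≠ ⊤) :
    Integrable v μ := by
  have : IsFiniteMeasure (μ.restrict s) := isFiniteMeasure_restrict.2 hμs
  rw [← h.indicator_eq, integrable_indicator_iff hs]
  exact h.memLp.restrict s |>.integrable one_le_two

theorem eLpNorm_eq (h : IsL2Extension μ s f v) (hs : MeasurableSet s) :
    eLpNorm v 2 μ = eLpNorm f 2 (μ.restrict s) := by
  rw [eLpNorm_congr_ae h.ae_eq, ← eLpNorm_indicator_eq_eLpNorm_restrict hs, h.indicator_eq]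

end IsL2Extension

end SquareIntegrable

namespace MemL2Form

variable {n ℓ : ℕ} {Ω : Set (E n)} {u : E n → Form n ℓ}

theorem eLpNorm_coeff_le (hu : MemL2Form Ω u) (I : Fin ℓ ↪o Fin n) :
    eLpNorm (fun x => coeff I (u x)) 2 (volume.restrict Ω) ≤
      ENNReal.ofReal (l2NormForm Ω u) := by
  rw [eLpNorm_two_eq_ofReal_sqrt (hu I)]
  refine ENNReal.ofReal_le_ofReal (Real.sqrt_le_sqrt ?_)
  exact Finset.single_le_sum (f := fun I => ∫ x in Ω, coeff I (u x) ^ 2)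
    (fun I _ => integral_nonneg fun x => sq_nonneg _) (Finset.mem_univ I)

theorem memLp_component_and_eLpNorm_le (hu : MemL2Form Ω u) (m : Fin ℓ → Fin n) :
    MemLp (fun y => u y fun l => e (m l)) 2 (volume.restrict Ω) ∧
      eLpNorm (fun y => u y fun l => e (m l)) 2 (volume.restrict Ω) ≤
        ENNReal.ofReal (l2NormForm Ω u) := by
  rcases component_eq_zero_or_eq_mul_coeff m with component_eq_zero | ⟨I, s, hs, component_eq⟩
  · simp [component_eq_zero]
  · simp only [component_eq]
    refine ⟨(hu I).const_mul s, le_of_eq_of_le ?_ (hu.eLpNorm_coeff_le I)⟩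
    refine eLpNorm_congr_norm_ae (.of_forall fun x => ?_)
    rw [norm_mul, Real.norm_eq_abs s, hs, one_mul]

end MemL2Form

section PoincareOperator

variable {n k : ℕ} {Ω : Set (E n)} {θ : E n → ℝ} {u : E n → Form n (k + 1)}
  {v : (Fin k ↪o Fin n) → Fin n → E n → ℝ}

/-- `v J i` represents the component of `u` at the indices `i, J₁, …, J_k`. These are the components
entering the coefficient at `J` of an interior product with `u`. -/
def RepresentsComponents (Ω : Set (E n)) (u : E n → Form n (k + 1))
    (v : (Fin k ↪o Fin n) → Fin n → E n → ℝ) : Prop :=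
  ∀ (J : Fin k ↪o Fin n) (i : Fin n), IsL2Extension volume Ω
    (fun y => u y fun l => e ((Fin.cons i J : Fin (k + 1) → Fin n) l)) (v J i)

theorem MemL2Form.exists_representsComponents (hu : MemL2Form Ω u) (hΩ : MeasurableSet Ω) :
    ∃ v, RepresentsComponents Ω u v := by
  choose v hv using fun (J : Fin k ↪o Fin n) (i : Fin n) => exists_isL2Extension hΩ
    (hu.memLp_component_and_eLpNorm_le (Fin.cons i J : Fin (k + 1) → Fin n)).1
  exact ⟨v, hv⟩

namespace RepresentsComponents

theorem eLpNorm_le (h : RepresentsComponents Ω u v) (hu : MemL2Form Ω u) (hΩ : MeasurableSet Ω)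
    (J : Fin k ↪o Fin n) (i : Fin n) :
    eLpNorm (v J i) 2 volume ≤ ENNReal.ofReal (l2NormForm Ω u) := by
  rw [(h J i).eLpNorm_eq hΩ]
  exact (hu.memLp_component_and_eLpNorm_le _).2

theorem coeff_poincareIntegrand_ae_eq (h : RepresentsComponents Ω u v) (hk : k + 1 ≤ n)
    (J : Fin k ↪o Fin n) (x : E n) :
    (fun y => coeff J (poincareIntegrand θ u x y)) =ᵐ[volume.restrict Ω] fun y => ∑ i,
      scaleKernel k θ x y * (EuclideanSpace.proj i : E n →L[ℝ] ℝ) (x - y) * v J i y := by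
  filter_upwards [ae_all_iff.2 fun i => (h J i).ae_eq] with y hy
  simp only [coeff_poincareIntegrand hk, hy]

theorem ae_integrable (h : RepresentsComponents Ω u v) (hk : k + 1 ≤ n) (hθ : Continuous θ)
    (hθc : HasCompactSupport θ) (hΩ : MeasurableSet Ω) (hΩb : Bornology.IsBounded Ω) :
    ∀ᵐ x ∂volume.restrict Ω, ∀ J i, Integrable fun y =>
      scaleKernel k θ x y * (EuclideanSpace.proj i : E n →L[ℝ] ℝ) (x - y) * v J i y :=
  ae_all_iff.2 fun J => ae_all_iff.2 fun i =>
    ae_integrable_scaleKernel_mul_mul (hk.trans_eq finrank_euclideanSpace_fin.symm) hθ hθc hΩ hΩb _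
      (h J i).measurable ((h J i).integrable hΩ hΩb.measure_lt_top.ne)

theorem ae_integrableOn_poincareIntegrand (h : RepresentsComponents Ω u v) (hk : k + 1 ≤ n)
    (hθ : Continuous θ) (hθc : HasCompactSupport θ) (hΩ : MeasurableSet Ω)
    (hΩb : Bornology.IsBounded Ω) :
    ∀ᵐ x ∂volume.restrict Ω, IntegrableOn (poincareIntegrand θ u x) Ω := by
  filter_upwards [h.ae_integrable hk hθ hθc hΩ hΩb] with x hx
  refine integrable_form_of_coeff fun J => ?_
  exact (integrable_finsetSum _ fun i _ => (hx J i).restrict).congr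
    (h.coeff_poincareIntegrand_ae_eq hk J x).symm

theorem coeff_poincareOp_ae_eq (h : RepresentsComponents Ω u v) (hk : k + 1 ≤ n)
    (hθ : Continuous θ) (hθc : HasCompactSupport θ) (hΩ : MeasurableSet Ω)
    (hΩb : Bornology.IsBounded Ω) (J : Fin k ↪o Fin n) :
    (fun x => coeff J (poincareOp Ω θ u x)) =ᵐ[volume.restrict Ω]
      ∑ i, scalarOp k θ (EuclideanSpace.proj i) (v J i) := by
  filter_upwards [h.ae_integrable hk hθ hθc hΩ hΩb,
    h.ae_integrableOn_poincareIntegrand hk hθ hθc hΩ hΩb] with x integrable_x integrableOn_x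
  rw [poincareOp, coeff_integral integrableOn_x,
    integral_congr_ae (h.coeff_poincareIntegrand_ae_eq hk J x),
    integral_finsetSum _ fun i _ => (integrable_x J i).restrict, Finset.sum_apply]
  refine Finset.sum_congr rfl fun i _ => ?_
  refine setIntegral_eq_integral_of_forall_compl_eq_zero fun y hy => ?_
  rw [(h J i).eq_zero_of_notMem y hy, mul_zero]

end RepresentsComponents

end PoincareOperator

section FormEstimate

variable {n k ℓ : ℕ}

theorem integral_sq_le_of_eLpNorm_le {α : Type*} [MeasurableSpace α] {μ : Measure α} {f : α → ℝ}
    (hf : MemLp f 2 μ) {B : ℝ} (hB : 0 ≤ B) (h : eLpNorm f 2 μ ≤ ENNReal.ofReal B) :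
    ∫ x, f x ^ 2 ∂μ ≤ B ^ 2 := by
  rw [eLpNorm_two_eq_ofReal_sqrt hf, ENNReal.ofReal_le_ofReal_iff hB] at h
  exact (Real.sqrt_le_left hB).1 h

/-- The coefficients of `w` have weak partial derivatives on `Ω` with `L²` norm at most `B`. -/
def HasWeakPartialsBoundedBy (Ω : Set (E n)) (w : E n → Form n ℓ) (B : ℝ) : Prop :=
  ∀ (I : Fin ℓ ↪o Fin n) (j : Fin n), ∃ g : E n → ℝ,
    HasWeakPartial Ω j (fun x => coeff I (w x)) g ∧ MemLp g 2 (volume.restrict Ω) ∧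
      eLpNorm g 2 (volume.restrict Ω) ≤ ENNReal.ofReal B

namespace HasWeakPartialsBoundedBy

variable {w : E n → Form n ℓ} {B : ℝ}

theorem memH1Form {Ω : Set (E n)} (h : HasWeakPartialsBoundedBy Ω w B) (hw : MemL2Form Ω w) :
    MemH1Form Ω w := fun I => ⟨hw I, fun j =>
  let ⟨g, weakPartial_g, memLp_g, _⟩ := h I j
  ⟨g, weakPartial_g, memLp_g⟩⟩

theorem h1SeminormForm_le {Ω : TopologicalSpace.Opens (E n)}
    (h : HasWeakPartialsBoundedBy Ω w B) (hB : 0 ≤ B) :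
    h1SeminormForm Ω w ≤ √(Fintype.card (Fin ℓ ↪o Fin n) * n) * B := by
  rw [h1SeminormForm, ← Real.sqrt_sq hB, ← Real.sqrt_mul (by positivity)]
  refine Real.sqrt_le_sqrt ?_
  calc _ ≤ ∑ _I : Fin ℓ ↪o Fin n, ∑ _j : Fin n, B ^ 2 := by
        refine Finset.sum_le_sum fun I _ => Finset.sum_le_sum fun j _ => ?_
        obtain ⟨g, weakPartial_g, memLp_g, norm_g⟩ := h I j
        rw [setIntegral_weakPartial_sq weakPartial_g]
        exact integral_sq_le_of_eLpNorm_le memLp_g hB norm_g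
    _ = _ := by
        simp only [Finset.sum_const, Finset.card_univ, Fintype.card_fin, nsmul_eq_mul]
        ring

end HasWeakPartialsBoundedBy

theorem memL2Form_poincareOp {Ω : Set (E n)} {θ : E n → ℝ} {u : E n → Form n (k + 1)}
    (hk : k + 1 ≤ n) (hθ : Continuous θ) (hθc : HasCompactSupport θ) (hΩ : MeasurableSet Ω)
    (hΩb : Bornology.IsBounded Ω) (hu : MemL2Form Ω u) : MemL2Form Ω (poincareOp Ω θ u) := by
  obtain ⟨v, hv⟩ := hu.exists_representsComponents hΩ
  intro J
  refine MemLp.ae_eq (hv.coeff_poincareOp_ae_eq hk hθ hθc hΩ hΩb J).symm ?_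
  exact memLp_finsetSum' _ fun i _ => memLp_scalarOp (hk.trans_eq finrank_euclideanSpace_fin.symm)
    hθ hθc hΩ hΩb _ (hv J i).measurable (hv J i).memLp

theorem exists_hasWeakPartialsBoundedBy_poincareOp (hk : k + 1 ≤ n) :
    ∃ C : ℝ, 0 ≤ C ∧ ∀ {M : ℝ} {Ω : Set (E n)} {c : E n} {r : ℝ} {θ : E n → ℝ}
      {u : E n → Form n (k + 1)},
      IsOpen Ω → Bornology.IsBounded Ω → 0 < r → Metric.ball c r ⊆ Ω →
      IsScaledBump M c (Metric.diam (Metric.ball c r)) θ → MemL2Form Ω u →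
      HasWeakPartialsBoundedBy Ω (poincareOp Ω θ u)
        (C * M * (Metric.diam Ω / Metric.diam (Metric.ball c r)) *
          kappa n (k + 1) (volume.real Ω / volume.real (Metric.ball c r)) * l2NormForm Ω u) := by
  obtain ⟨C, hC, hasWeakPartial_scalarOp⟩ := exists_forall_hasWeakPartial_scalarOp hk
  refine ⟨n * C, by positivity, fun {M Ω c r θ u} hΩ hΩb hr hball hθ hu J j => ?_⟩
  obtain ⟨v, hv⟩ := hu.exists_representsComponents hΩ.measurableSet
  choose g weakPartial_g memLp_g norm_g using fun i : Fin n =>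
    hasWeakPartial_scalarOp i j hΩ hΩb hr hball hθ (hv J i).measurable
      ((hv J i).integrable hΩ.measurableSet hΩb.measure_lt_top.ne) (hv J i).memLp
  have coeff_ae_eq := hv.coeff_poincareOp_ae_eq hk hθ.contDiff.continuous hθ.hasCompactSupport
    hΩ.measurableSet hΩb J
  lift Ω to TopologicalSpace.Opens (E n) using hΩ
  refine ⟨∑ i, g i, (HasWeakPartial.sum fun i _ => weakPartial_g i).congr_left coeff_ae_eq.symm,
    memLp_finsetSum' _ fun i _ => memLp_g i, ?_⟩
  set D := C * M * (Metric.diam (Ω : Set (E n)) / Metric.diam (Metric.ball c r)) *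
    kappa n (k + 1) (volume.real (Ω : Set (E n)) / volume.real (Metric.ball c r))
  have hD : 0 ≤ D := by
    have := hθ.nonneg
    have := one_le_kappa n (k + 1)
      (one_le_measureReal_div hball (Metric.measure_ball_pos _ _ hr).ne' hΩb.measure_lt_top.ne)
    positivity
  calc _ ≤ ∑ i, eLpNorm (g i) 2 (volume.restrict Ω) :=
        eLpNorm_sum_le (fun i _ => (memLp_g i).1) one_le_two
    _ ≤ ∑ _i : Fin n, ENNReal.ofReal (D * l2NormForm Ω u) := by
        refine Finset.sum_le_sum fun i _ => (norm_g i).trans ?_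
        gcongr
        exact ENNReal.toReal_le_of_le_ofReal (Real.sqrt_nonneg _)
          (hv.eLpNorm_le hu Ω.isOpen.measurableSet J i)
    _ = _ := by
        rw [Finset.sum_const, Finset.card_univ, Fintype.card_fin, nsmul_eq_mul,
          ← ENNReal.ofReal_natCast, ← ENNReal.ofReal_mul (by positivity)]
        congr 1
        simp only [D]
        ring

end FormEstimate

section Regularizer

variable {n : ℕ}

theorem norm_le_sum_abs_apply_e {k : ℕ} (A : E n [×k]→L[ℝ] ℝ) :
    ‖A‖ ≤ ∑ i : Fin k → Fin n, |A fun l => e (i l)| := by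
  refine A.opNorm_le_bound (by positivity) fun x => ?_
  have sum_basis (l : Fin k) : x l = ∑ i, x l i • e i := by
    simpa [e] using ((EuclideanSpace.basisFun (Fin n) ℝ).sum_repr (x l)).symm
  conv_lhs => rw [funext sum_basis, A.map_sum]
  rw [Finset.sum_mul]
  refine (norm_sum_le _ _).trans (Finset.sum_le_sum fun i _ => ?_)
  rw [A.map_smul_univ, norm_smul, norm_prod, mul_comm, Real.norm_eq_abs (A _)]
  gcongr with l
  exact PiLp.norm_apply_le (x l) (i l)

theorem integrable_partialDeriv {θ : E n → ℝ} (hθ : ContDiff ℝ ∞ θ) (hθc : HasCompactSupport θ)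
    {k : ℕ} (i : Fin k → Fin n) : Integrable fun x => partialDeriv i θ x :=
  have hcont := hθ.continuous_iteratedFDeriv (m := k) (mod_cast le_top)
  ((ContinuousMultilinearMap.apply ℝ _ ℝ fun l => e (i l)).continuous.comp
    hcont).integrable_of_hasCompactSupport ((hθc.iteratedFDeriv k).comp_left rfl)

theorem IsRegularizer.isScaledBump {K : ℕ → ℝ} {c : E n} {r : ℝ} {θ : E n → ℝ}
    (h : IsRegularizer K c r θ) (hn : n ≠ 0) (hr : 0 < r) :
    IsScaledBump (∑ k ∈ Finset.range 3, n ^ k * |K k|) c (Metric.diam (Metric.ball c r)) θ := by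
  have : NeZero n := ⟨hn⟩
  have diam_ball : Metric.diam (Metric.ball c r) = 2 * r := Metric.diam_ball_eq c hr.le
  set ρ := Metric.diam (Metric.ball c r)
  have hρ : 0 < ρ := by linarith
  have hasCompactSupport : HasCompactSupport θ :=
    (isCompact_closedBall c r).of_isClosed_subset (isClosed_tsupport θ) h.tsupport_subset
  have sum_le {k : ℕ} (hk : k ≤ 2) (l : ℕ) :
      ∑ _i : Fin k → Fin n, K k / ρ ^ l ≤ (∑ k ∈ Finset.range 3, n ^ k * |K k|) / ρ ^ l := by
    have : n ^ k * |K k| ≤ ∑ k ∈ Finset.range 3, n ^ k * |K k| :=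
      Finset.single_le_sum (f := fun k => (n : ℝ) ^ k * |K k|) (fun k _ => by positivity)
        (Finset.mem_range.2 (by omega))
    simp only [Finset.sum_const, Finset.card_univ, Fintype.card_fun, Fintype.card_fin,
      nsmul_eq_mul, Nat.cast_pow, ← mul_div_assoc]
    gcongr
    exact (mul_le_mul_of_nonneg_left (le_abs_self _) (by positivity)).trans this
  have integrable_abs {k : ℕ} (i : Fin k → Fin n) : Integrable fun x => |partialDeriv i θ x| :=
    (integrable_partialDeriv h.contDiff hasCompactSupport i).abs
  refine ⟨hρ, h.contDiff, h.tsupport_subset.trans (Metric.closedBall_subset_closedBall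
    (by linarith)), fun k hk => ?_, fun k hk x => ?_⟩
  · calc _ ≤ ∫ x, ∑ i : Fin k → Fin n, |partialDeriv i θ x| :=
          integral_mono_of_nonneg (.of_forall fun x => norm_nonneg _)
            (integrable_finsetSum _ fun i _ => integrable_abs i)
            (.of_forall fun x => norm_le_sum_abs_apply_e _)
      _ = ∑ i : Fin k → Fin n, ∫ x, |partialDeriv i θ x| :=
          integral_finsetSum _ fun i _ => integrable_abs i
      _ ≤ _ := (Finset.sum_le_sum fun i _ => h.l1_bound k i).trans (sum_le hk k)
  · rw [finrank_euclideanSpace_fin]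
    exact (norm_le_sum_abs_apply_e _).trans
      ((Finset.sum_le_sum fun i _ => h.sup_bound k i x).trans (sum_le (hk.trans one_le_two) _))

end Regularizer

end

end PoincareEstimate

open MeasureTheory PoincareEstimate in
theorem mainTheorem1_general (n k : ℕ) (hk : k + 1 ≤ n) :
    ∃ C : ℝ, ∀ (M : ℝ) (Ω : Set (E n)) (c : E n) (r : ℝ) (θ : E n → ℝ),
      IsOpen Ω → Bornology.IsBounded Ω → 0 < r → Metric.ball c r ⊆ Ω →
      IsScaledBump M c (Metric.diam (Metric.ball c r)) θ →
      ∀ u : E n → Form n (k + 1), MemL2Form Ω u →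
        (∀ᵐ x ∂(volume.restrict Ω), IntegrableOn (poincareIntegrand θ u x) Ω) ∧
        MemH1Form Ω (poincareOp Ω θ u) ∧
        h1SeminormForm Ω (poincareOp Ω θ u) ≤
          C * M * (Metric.diam Ω / Metric.diam (Metric.ball c r)) *
            kappa n (k + 1) (volume.real Ω / volume.real (Metric.ball c r)) *
            l2NormForm Ω u := by
  obtain ⟨C, hC, weakPartials⟩ := exists_hasWeakPartialsBoundedBy_poincareOp hk
  refine ⟨√(Fintype.card (Fin k ↪o Fin n) * n) * C, fun M Ω c r θ hΩ hΩb hr hball hθ u hu => ?_⟩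
  have hθ_cont := hθ.contDiff.continuous
  have hθc := hθ.hasCompactSupport
  have weakPartials_u := weakPartials hΩ hΩb hr hball hθ hu
  obtain ⟨v, hv⟩ := hu.exists_representsComponents hΩ.measurableSet
  refine ⟨hv.ae_integrableOn_poincareIntegrand hk hθ_cont hθc hΩ.measurableSet hΩb,
    weakPartials_u.memH1Form (memL2Form_poincareOp hk hθ_cont hθc hΩ.measurableSet hΩb hu), ?_⟩
  lift Ω to TopologicalSpace.Opens (E n) using hΩ
  have := hθ.nonneg
  have := one_le_kappa n (k + 1)
    (one_le_measureReal_div hball (Metric.measure_ball_pos _ _ hr).ne' hΩb.measure_lt_top.ne)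
  have bound_nonneg : 0 ≤ l2NormForm Ω u := Real.sqrt_nonneg _
  calc _ ≤ _ := weakPartials_u.h1SeminormForm_le (by positivity)
    _ = _ := by ring

open MeasureTheory PoincareEstimate in
/-- The degree of the forms is `ℓ = k + 1`, with `1 ≤ ℓ ≤ n`; the constant `C` depends only on
`n`, `ℓ` and the constants `K` in the bounds on the derivatives of `θ`. -/
theorem mainTheorem1 (n k : ℕ) (hk : k + 1 ≤ n) (K : ℕ → ℝ) :
    ∃ C : ℝ, ∀ (Ω : Set (E n)) (c : E n) (r : ℝ) (θ : E n → ℝ),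
      IsOpen Ω → Bornology.IsBounded Ω → 0 < r → StarShapedWrt Ω (Metric.ball c r) →
      IsRegularizer K c r θ →
      ∀ u : E n → Form n (k + 1), MemL2Form Ω u →
        (∀ᵐ x ∂(volume.restrict Ω), IntegrableOn (poincareIntegrand θ u x) Ω) ∧
        MemH1Form Ω (poincareOp Ω θ u) ∧
        h1SeminormForm Ω (poincareOp Ω θ u) ≤
          C * (Metric.diam Ω / Metric.diam (Metric.ball c r)) *
            kappa n (k + 1) (volume.real Ω / volume.real (Metric.ball c r)) *
            l2NormForm Ω u := by
  obtain ⟨C, main⟩ := mainTheorem1_general n k hk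
  exact ⟨C * ∑ k ∈ Finset.range 3, n ^ k * |K k|, fun Ω c r θ hΩ hΩb hr hstar hθ =>
    main _ Ω c r θ hΩ hΩb hr hstar.1 (hθ.isScaledBump (by omega) hr)⟩
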